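/- Let $\{X_t\}_{t\in\mathbb Z}$ be a real, zero-mean time series. Assume that $\mathrm E|X_t|^8<\infty$, that all joint moments of $\{X_t\}$ up to order $8$ are invariant to shift, and that for all $2\le s\le 8$ and $1\le i\le s-1$ $$\sum_{j_1,\dots,j_{s-1}\in\mathbb Z}(1+|j_i|)\,|\kappa_s(j_1,\dots,j_{s-1})|<\infty,$$ where $\kappa_s(j_1,\dots,j_{s-1})=\mathrm{cum}(X_t,X_{t+j_1},\dots,X_{t+j_{s-1}})$ is the joint cumulant. For $T\ge1$ put $\omega_k=2\pi k/T$, $J_T(\omega)=(2\pi T)^{-1/2}\sum_{t=1}^TX_te^{it\omega}$ and, for $\psi:[0,2\pi]\to\mathbb C$ and integers $r\ge0$, $$A_T(\psi;r)=\frac1T\sum_{k=1}^T\psi(\omega_k)J_T(\omega_k)\overline{J_T(\omega_{k+r})},\qquad A_T(\psi)=A_T(\psi;0).$$ Let $\Theta\subseteq\mathbb R^d$ be open (for example the interior of the parameter space), let $\theta\in\Theta$ be the true parameter, and let $\widehat\theta_T$ be an estimator of $\theta$ with $|\widehat\theta_T-\theta|=O_p(T^{-1/2})$. Let $\phi(\omega;\vartheta)$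 be a complex-valued function such that $\phi(\cdot;\vartheta)$ is differentiable on $[0,2\pi]$ for each $\vartheta\in\Theta$, $\phi(\omega;\cdot)$ is twice differentiable on $\Theta$ for each $\omega\in[0,2\pi]$, and $$\sup_{\vartheta\in\Theta,\ \omega\in[0,2\pi]}\left|\frac{\partial\phi(\omega;\vartheta)}{\partial\omega}\right|<\infty,\qquad \sup_{\vartheta\in\Theta,\ \omega\in[0,2\pi]}\left\|\frac{\partial^2\phi(\omega;\vartheta)}{\partial\vartheta^2}\right\|<\infty.$$ Write $\phi_\vartheta=\phi(\cdot;\vartheta)$. Let $M=M_T\ge1$ be any sequence of integers, and let $$\widehat V_{\widehat\theta,M}(0)=\frac TM\sum_{r=1}^M\big|A_T(\phi_{\widehat\theta_T};r)\big|^2 .$$ Then the limit $V_\theta=\lim_{T\to\infty}T\,\mathrm{var}[A_T(\phi_\theta)]$ exists and is finite (where $\mathrm{var}[Z]=\mathrm E|Z-\mathrm E Z|^2$), and, as $T\to\infty$, $$\left|\widehat V_{\widehat\theta,M}(0)-V_\theta\right|=O_p\!\left(\frac MT+\frac1{\sqrt M}\right).$$ -/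

import Mathlib

open MeasureTheory Filter Topology Finset

noncomputable section

namespace OrthSample

variable {Ω : Type*} [MeasurableSpace Ω]

/-- The joint cumulant `cum(Y₁, …, Yₙ)` of real random variables: the sum over all set partitions
`P` of `{1, …, n}` of `(-1)^(|P| - 1) (|P| - 1)! ∏_{B ∈ P} E[∏_{i ∈ B} Y_i]`. -/
def cumulant (μ : Measure Ω) {n : ℕ} (Y : Fin n → Ω → ℝ) : ℝ :=
  ∑ P : Finpartition (Finset.univ : Finset (Fin n)),
    (-1 : ℝ) ^ (P.parts.card - 1) * ((P.parts.card - 1).factorial : ℝ) *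
      ∏ B ∈ P.parts, ∫ w, (∏ i ∈ B, Y i w) ∂μ

/-- The cumulant `κ_{n+1}(j₁, …, jₙ) = cum(X_0, X_{j₁}, …, X_{jₙ})` of order `n + 1` of a
(stationary) time series. -/
def kappa (μ : Measure Ω) (X : ℤ → Ω → ℝ) {n : ℕ} (j : Fin n → ℤ) : ℝ :=
  cumulant μ (fun i : Fin (n + 1) => X ((Fin.cons 0 j : Fin (n + 1) → ℤ) i))

/-- All moments up to order `p` are invariant to shift. -/
def IsStationaryOfOrder (μ : Measure Ω) (X : ℤ → Ω → ℝ) (p : ℕ) : Prop :=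
  ∀ n : ℕ, n ≤ p → ∀ (t : Fin n → ℤ) (h : ℤ),
    ∫ w, (∏ i, X (t i + h) w) ∂μ = ∫ w, (∏ i, X (t i) w) ∂μ

/-- `X` is `p`th-order stationary, `E|X_t|^p < ∞`, and for each order `s = n + 1` with
`2 ≤ s ≤ p` and each `i`, `∑_{j₁, …, j_{s-1}} (1 + |j_i|) |κ_s(j₁, …, j_{s-1})| < ∞`. -/
structure CumulantCondition (μ : Measure Ω) (X : ℤ → Ω → ℝ) (p : ℕ) : Prop where
  stationary : IsStationaryOfOrder μ X p
  memLp : ∀ t, MemLp (X t) (p : ENNReal) μ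
  summable : ∀ n : ℕ, 1 ≤ n → n + 1 ≤ p → ∀ i : Fin n,
    Summable (fun j : Fin n → ℤ => (1 + |(j i : ℝ)|) * |kappa μ X j|)

/-- The Fourier frequency `ω_k = 2πk/T`. -/
def freq (T k : ℕ) : ℝ := 2 * Real.pi * k / T

/-- The discrete Fourier transform `J_T(ω) = (2πT)^{-1/2} ∑_{t=1}^T X_t exp(itω)`. -/
def dft (X : ℤ → Ω → ℝ) (T : ℕ) (ω : ℝ) (w : Ω) : ℂ :=
  ((1 / Real.sqrt (2 * Real.pi * T) : ℝ) : ℂ) *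
    ∑ t ∈ Finset.Icc 1 T, (X (t : ℤ) w : ℂ) * Complex.exp (Complex.I * t * ω)

/-- `A_T(φ; r) = T⁻¹ ∑_{k=1}^T φ(ω_k) J_T(ω_k) conj(J_T(ω_{k+r}))`. -/
def weightedPeriodogram (X : ℤ → Ω → ℝ) (T : ℕ) (φ : ℝ → ℂ) (r : ℕ) (w : Ω) : ℂ :=
  (1 / (T : ℂ)) * ∑ k ∈ Finset.Icc 1 T,
    φ (freq T k) * dft X T (freq T k) w * (starRingEnd ℂ) (dft X T (freq T (k + r)) w)

/-- `(T/M) ∑_{r=1}^M |A_T(φ; r)|²`. -/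
def varEstimator (X : ℤ → Ω → ℝ) (T M : ℕ) (φ : ℝ → ℂ) (w : Ω) : ℝ :=
  ((T : ℝ) / M) * ∑ r ∈ Finset.Icc 1 M, ‖weightedPeriodogram X T φ r w‖ ^ 2

/-- The variance `E|Z - E Z|²` of a complex random variable. -/
def complexVariance (μ : Measure Ω) (Z : Ω → ℂ) : ℝ :=
  ∫ w, ‖Z w - ∫ w', Z w' ∂μ‖ ^ 2 ∂μ

/-- `Y_T = O_p(a_T)` as `T → ∞`. -/
def IsBigOInProb (μ : Measure Ω) (Y : ℕ → Ω → ℝ) (a : ℕ → ℝ) : Prop :=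
  ∀ ε : ℝ, 0 < ε → ∃ K : ℝ, ∀ᶠ T in atTop,
    μ {w | K * a T < |Y T w|} ≤ ENNReal.ofReal ε

end OrthSample

end

/-! For `1 ≤ r < T` the variables `A_T(φ; r)` form an orthogonal sample. Shifting one of the two
frequencies kills the mean up to `O(1/T)`, but changes `T` times the variance only by `O((r +
1)/T)`. So the `T |A_T(φ; r)|²`, `r ≤ M`, are nearly uncorrelated variables with mean close to `V`,
and their average has bias `O(M/T)` and variance `O(1/M + 1/T)`, provided `2M < T`. If `2M ≥ T`, the
claimed rate is at least `1/2`, and it is enough that the estimator is bounded in mean for every `M`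
(`integral_varEstimator_le`).

All moments come from one estimate, `norm_setCumulant_sub_le`. By multilinearity and stationarity,
the cumulant of `s` transforms at frequencies `2πqᵢ/T` is `(2πT)^(-s/2)` times `T 1{T ∣ ∑ qᵢ}` times
a Fourier series of `κ_s`, up to a boundary error that the summability condition bounds by a
constant.

Bias: `variance_expansion` writes the variance as a double average of a fourth cumulant and two
products of second moments. The first is a two-dimensional Riemann sum. In the products the
divisibility condition selects one `l` for each `k`, which leaves one-dimensional Riemann sums. This
gives `exists_variance_rate`.

Variance: here only orders of magnitude matter, so a cumulant is replaced by the weight `1 + T 1{T ∣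
∑ qᵢ}`. In the covariance of `|A_T(φ; r)|²` and `|A_T(φ; s)|²` only the partitions that join the two
variables survive (`sub_eq_sum_nonsplit`). View the blocks of a partition as vertices and each
factor `J conj(J)` as an edge with a free frequency. Summing over a frequency contracts its edge at
the price `3T`, which the normalisation cancels; at the end each connected component carries one
weight, at its total shift (`exists_sum_prod_weight_le`). The shifts are `r, -r, s, -s`, so at most
one component has a total divisible by `T`, or two if `T ∣ r ± s` (`prod_weight_le`). Hence `T²`
times the covariance is `O(1/T)`, or `O(1)` when `r = s`.

Plug-in: with probability close to one, `|θhat - θ| ≤ B/√T`. Then the weight changes by a linear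
combination of the partial derivatives at `θ`, whose coefficients are random and `O(1/√T)`, plus a
remainder `O(1/T)`. The partial derivatives are deterministic weights, so moment bounds apply to
them; the random remainder is bounded pathwise by `A_T(1; 0)`. The estimator changes by
`O_p(T^(-1/2))`, which never exceeds the rate (`one_div_sqrt_le_rate`). -/

noncomputable section

namespace OrthSample

/-! ### Moments and cumulants as set functions. -/

section Combinatorics

variable {ι R : Type*} [DecidableEq ι] [CommRing R]

/-- The cumulant set function of a moment set function. -/
def setCumulant (m : Finset ι → R) (S : Finset ι) : R :=
  ∑ P : Finpartition S, (-1 : R) ^ (P.parts.card - 1) * ((P.parts.card - 1).factorial : R) *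
    ∏ B ∈ P.parts, m B

/-- Sum over all partitions of the product over the blocks. -/
def partitionSum (c : Finset ι → R) (S : Finset ι) : R :=
  ∑ P : Finpartition S, ∏ B ∈ P.parts, c B

/-- The partition obtained by removing one block. -/
def removeBlock {S : Finset ι} (Q : Finpartition S) (C : Finset ι) (hC : C ∈ Q.parts) :
    Finpartition (S \ C) where
  parts := Q.parts.erase C
  supIndep := Q.supIndep.subset (erase_subset _ _)
  sup_parts := by
    ext x
    simp only [Finset.mem_sup, Finset.mem_erase, id, Finset.mem_sdiff]
    constructor
    · rintro ⟨B, ⟨hne, hB⟩, hx⟩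
      exact ⟨Q.subset hB hx, fun hxC => hne (Q.eq_of_mem_parts hB hC hx hxC)⟩
    · rintro ⟨hx, hxC⟩
      obtain ⟨B, hB, hxB⟩ := Q.exists_mem hx
      exact ⟨B, ⟨fun h => hxC (h ▸ hxB), hB⟩, hxB⟩
  bot_notMem h := Q.bot_notMem (mem_of_mem_erase h)

/-- A partition with a marked block is a nonempty subset with a partition of the complement. -/
theorem sum_marked_block (S : Finset ι) (F : Finset ι → Finset (Finset ι) → R) :
    ∑ Q : Finpartition S, ∑ C ∈ Q.parts, F C (Q.parts.erase C) =
      ∑ C ∈ S.powerset.erase ∅, ∑ P : Finpartition (S \ C), F C P.parts := by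
  rw [Finset.sum_sigma', Finset.sum_sigma']
  refine Finset.sum_bij'
    (i := fun x hx => ⟨x.2, removeBlock x.1 x.2 (by simpa using hx)⟩)
    (j := fun x hx => ⟨x.2.extend (c := S) (b := x.1)
      (by simp at hx; simpa [Finset.bot_eq_empty] using hx.1) sdiff_disjoint
      (by simp at hx; simpa using hx.2), x.1⟩)
    ?_ ?_ ?_ ?_ ?_
  · rintro ⟨Q, C⟩ h
    simp only [mem_sigma, mem_univ, true_and] at h
    simpa using ⟨(Q.nonempty_of_mem_parts h).ne_empty, Q.subset h⟩
  · rintro ⟨C, P⟩ h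
    simp [Finpartition.extend]
  · rintro ⟨Q, C⟩ h
    simp only [mem_sigma, mem_univ, true_and] at h
    simp only [Sigma.mk.injEq, heq_eq_eq, and_true]
    ext1
    simp [Finpartition.extend, removeBlock, insert_erase h]
  · rintro ⟨C, P⟩ h
    have hC : C ∉ P.parts := by
      intro hC
      have h1 := P.subset hC
      simp at h
      obtain ⟨x, hx⟩ := nonempty_iff_ne_empty.2 h.1
      exact (Finset.mem_sdiff.1 (h1 hx)).2 hx
    simp only [Sigma.mk.injEq, heq_eq_eq, true_and]
    ext1
    simp [Finpartition.extend, removeBlock, hC]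
  · rintro ⟨Q, C⟩ h
    simp [removeBlock]

theorem partitionSum_empty (c : Finset ι → R) : partitionSum c ∅ = 1 := by
  have h := Fintype.sum_unique (ι := Finpartition (⊥ : Finset ι)) (fun P => ∏ B ∈ P.parts, c B)
  rw [Finpartition.default_eq_empty] at h
  simpa [partitionSum, Finpartition.empty] using h

/-- Partitions are sorted by their block containing `i`: marking that block in `sum_marked_block`
leaves a free partition of the rest. -/
theorem partitionSum_rec (c : Finset ι → R) {S : Finset ι} {i : ι} (hi : i ∈ S) :
    partitionSum c S = ∑ B ∈ S.powerset with i ∈ B, c B * partitionSum c (S \ B) := by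
  have h := sum_marked_block S (fun C p => if i ∈ C then c C * ∏ B ∈ p, c B else 0)
  have h1 : ∀ Q : Finpartition S, ∑ C ∈ Q.parts,
      (if i ∈ C then c C * ∏ B ∈ Q.parts.erase C, c B else 0) = ∏ B ∈ Q.parts, c B := by
    intro Q
    rw [Finset.sum_eq_single_of_mem (Q.part i) (Q.part_mem.2 hi)]
    · rw [if_pos (Q.mem_part_self.2 hi), Finset.mul_prod_erase _ _ (Q.part_mem.2 hi)]
    · intro B hB hne
      rw [if_neg]
      exact fun hiB => hne (Q.part_eq_of_mem hB hiB).symm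
  simp only [h1] at h
  rw [partitionSum, h, Finset.sum_filter]
  rw [Finset.sum_erase]
  · refine Finset.sum_congr rfl fun C _ => ?_
    by_cases hC : i ∈ C <;> simp [hC, partitionSum, Finset.mul_sum]
  · simp

/-- Mark a block that avoids `i`. A partition with `n` blocks has `n - 1` of them, and `coef n + (n
- 1) * coef (n - 1)` vanishes for `n ≥ 2`; so adding the marked sum to the cumulant leaves only the
one-block partition, that is `m S`. A marked block `C` gives the term `B = S \ C`. -/
theorem setCumulant_rec (m : Finset ι → R) (hm : m ∅ = 1) {S : Finset ι} {i : ι} (hi : i ∈ S) :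
    m S = ∑ B ∈ S.powerset with i ∈ B, setCumulant m B * m (S \ B) := by
  let coef : ℕ → R := fun n => (-1 : R) ^ (n - 1) * ((n - 1).factorial : R)
  have h := sum_marked_block S (fun C p => if i ∈ C then 0 else coef p.card * (m C * ∏ B ∈ p, m B))
  have hSne : S ≠ ⊥ := by rintro rfl; simp at hi
  -- the left side, by partitions
  have h1 : ∀ Q : Finpartition S, ∑ C ∈ Q.parts,
      (if i ∈ C then 0 else coef (Q.parts.erase C).card * (m C * ∏ B ∈ Q.parts.erase C, m B)) =
      ((Q.parts.card - 1 : ℕ) : R) * coef (Q.parts.card - 1) * ∏ B ∈ Q.parts, m B := by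
    intro Q
    have : ∀ C ∈ Q.parts, (if i ∈ C then 0 else
        coef (Q.parts.erase C).card * (m C * ∏ B ∈ Q.parts.erase C, m B)) =
        if C = Q.part i then 0 else coef (Q.parts.card - 1) * ∏ B ∈ Q.parts, m B := by
      intro C hC
      rw [card_erase_of_mem hC, Finset.mul_prod_erase _ _ hC]
      have : i ∈ C ↔ C = Q.part i := by
        rw [eq_comm, Q.part_eq_iff_mem hC]
      simp [this]
    rw [Finset.sum_congr rfl this, ← Finset.sum_filter_add_sum_filter_not _ (fun C => C = Q.part i)]
    rw [Finset.sum_congr rfl (g := fun _ => 0) (by simp +contextual)]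
    rw [Finset.sum_congr (s₁ := {x ∈ Q.parts | ¬ x = Q.part i}) rfl
      (g := fun _ => coef (Q.parts.card - 1) * ∏ B ∈ Q.parts, m B) (by simp +contextual)]
    have hfil : ({x ∈ Q.parts | ¬ x = Q.part i}) = Q.parts.erase (Q.part i) := by
      ext; simp [and_comm]
    rw [hfil]
    simp [card_erase_of_mem (Q.part_mem.2 hi), mul_assoc]
  simp only [h1] at h
  have h2 : ∀ Q : Finpartition S, coef Q.parts.card * ∏ B ∈ Q.parts, m B +
      ((Q.parts.card - 1 : ℕ) : R) * coef (Q.parts.card - 1) * ∏ B ∈ Q.parts, m B =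
      if Q = Finpartition.indiscrete hSne then m S else 0 := by
    intro Q
    have hpos : 0 < Q.parts.card := card_pos.2 (Q.parts_nonempty hSne)
    by_cases hQ : Q = Finpartition.indiscrete hSne
    · subst hQ; simp [coef]
    · rw [if_neg hQ]
      have h3 : 1 < Q.parts.card := by
        by_contra hle
        have : Q.parts.card = 1 := by omega
        obtain ⟨B, hB⟩ := card_eq_one.1 this
        apply hQ
        ext1
        have := Q.sup_parts
        rw [hB] at this
        simp at this
        simp [hB, this]
      obtain ⟨n, hn⟩ : ∃ n, Q.parts.card = n + 2 := ⟨Q.parts.card - 2, by omega⟩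
      simp only [hn, coef, show n + 2 - 1 = n + 1 by omega, Nat.add_sub_cancel,
        Nat.factorial_succ, pow_succ]
      push_cast
      ring
  have h4 : setCumulant m S + ∑ Q : Finpartition S,
      ((Q.parts.card - 1 : ℕ) : R) * coef (Q.parts.card - 1) * ∏ B ∈ Q.parts, m B = m S := by
    rw [setCumulant, ← Finset.sum_add_distrib]
    simp only [coef] at h2
    rw [Finset.sum_congr rfl (fun Q _ => h2 Q)]
    simp
  rw [h] at h4
  refine h4.symm.trans ?_
  rw [← Finset.add_sum_erase ({B ∈ S.powerset | i ∈ B}) _ (a := S) (by simp [hi])]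
  simp only [Finset.sdiff_self, hm, mul_one]
  congr 1
  symm
  -- Complementation matches only the nonzero terms: those with `i ∈ C` are zero and have no
  -- partner.
  refine Finset.sum_bij_ne_zero (fun B _ _ => S \ B) ?_ ?_ ?_ ?_
  · intro B hB _
    simp only [Finset.mem_erase, Finset.mem_filter, Finset.mem_powerset] at hB ⊢
    refine ⟨fun h => hB.1 (subset_antisymm hB.2.1 (sdiff_eq_empty_iff_subset.1 h)), sdiff_subset⟩
  · intro B hB _ B' hB' _ h
    simp only [Finset.mem_erase, Finset.mem_filter, Finset.mem_powerset] at hB hB'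
    rw [← Finset.sdiff_sdiff_eq_self hB.2.1, h, Finset.sdiff_sdiff_eq_self hB'.2.1]
  · intro C hC hne
    simp only [mem_erase, Finset.mem_powerset] at hC
    have hiC : i ∉ C := by
      intro hiC; simp [hiC] at hne
    refine ⟨S \ C, ?_, ?_, Finset.sdiff_sdiff_eq_self hC.2⟩
    · simp only [Finset.mem_erase, Finset.mem_filter, Finset.mem_powerset, Finset.mem_sdiff]
      refine ⟨fun h => hC.1 ?_, sdiff_subset, hi, hiC⟩
      rw [← Finset.sdiff_sdiff_eq_self hC.2, h, sdiff_self, bot_eq_empty]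
    · rw [Finset.sdiff_sdiff_eq_self hC.2]
      intro h0
      apply hne
      rw [setCumulant, Finset.sum_mul] at h0
      simp only [hiC, if_false]
      rw [← h0]
      refine Finset.sum_congr rfl fun P _ => ?_
      simp only [coef]; ring
  · intro B hB _
    simp only [Finset.mem_erase, Finset.mem_filter, Finset.mem_powerset] at hB
    have : i ∉ S \ B := by simp [hB.2.2]
    simp only [this, if_false]
    rw [Finset.sdiff_sdiff_eq_self hB.2.1, setCumulant, Finset.sum_mul]
    refine Finset.sum_congr rfl fun P _ => ?_
    simp only [coef]; ring

/-- The moments as sums over partitions of products of cumulants. -/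
theorem eq_partitionSum_setCumulant (m : Finset ι → R) (hm : m ∅ = 1) (S : Finset ι) :
    m S = partitionSum (setCumulant m) S := by
  induction S using Finset.strongInduction with
  | H S ih =>
    rcases S.eq_empty_or_nonempty with rfl | ⟨i, hi⟩
    · rw [hm, partitionSum_empty]
    · rw [setCumulant_rec m hm hi, partitionSum_rec _ hi]
      refine Finset.sum_congr rfl fun B hB => ?_
      simp only [Finset.mem_filter, Finset.mem_powerset] at hB
      rw [ih]
      exact ⟨sdiff_subset, fun h => (Finset.mem_sdiff.1 (h hi)).2 hB.2⟩

theorem partitionSum_congr {c c' : Finset ι → R} {S : Finset ι} (h : ∀ B ⊆ S, c B = c' B) :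
    partitionSum c S = partitionSum c' S :=
  Finset.sum_congr rfl fun P _ => Finset.prod_congr rfl fun _ hB => h _ (P.subset hB)

/-- The sum over those partitions of which every block lies on one side is a product. -/
theorem partitionSum_union (c : Finset ι → R) (S U : Finset ι) (hSU : Disjoint S U) :
    partitionSum (fun B => if B ⊆ S ∨ B ⊆ U then c B else 0) (S ∪ U) =
      partitionSum c S * partitionSum c U := by
  set c' : Finset ι → R := fun B => if B ⊆ S ∨ B ⊆ U then c B else 0
  -- The induction removes elements from `S'`, while the criterion inside `c'` keeps referring to
  -- the fixed set `S`.
  suffices H : ∀ S' ⊆ S, partitionSum c' (S' ∪ U) = partitionSum c S' * partitionSum c U from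
    H S subset_rfl
  intro S'
  induction S' using Finset.strongInduction with
  | H S' ih =>
    intro hS'
    rcases S'.eq_empty_or_nonempty with rfl | ⟨i, hi⟩
    · rw [partitionSum_empty, one_mul, empty_union]
      exact partitionSum_congr fun B hB => by simp [c', hB]
    · rw [partitionSum_rec c hi, partitionSum_rec c' (mem_union_left U hi), Finset.sum_mul]
      symm
      apply Finset.sum_subset_zero_on_sdiff
      · intro B hB
        simp only [Finset.mem_filter, Finset.mem_powerset] at hB ⊢
        exact ⟨hB.1.trans subset_union_left, hB.2⟩
      · intro B hB
        simp only [Finset.mem_filter, Finset.mem_powerset, Finset.mem_sdiff, not_and] at hB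
        have : ¬ (B ⊆ S ∨ B ⊆ U) := by
          rintro (h | h)
          · refine hB.2 (fun x hx => ?_) hB.1.2
            rcases mem_union.1 (hB.1.1 hx) with h1 | h1
            · exact h1
            · exact absurd h1 (disjoint_left.1 hSU (h hx))
          · exact disjoint_left.1 hSU (hS' hi) (h hB.1.2)
        simp [c', this]
      · intro B hB
        simp only [Finset.mem_filter, Finset.mem_powerset] at hB
        have h1 : (S' ∪ U) \ B = (S' \ B) ∪ U := by
          rw [union_sdiff_distrib]
          congr 1
          exact sdiff_eq_self_of_disjoint ((hSU.mono_left (hB.1.trans hS')).symm)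
        have h2 : c' B = c B := by simp [c', hB.1.trans hS']
        rw [h1, h2, ih _ ⟨sdiff_subset, fun h => (Finset.mem_sdiff.1 (h hi)).2 hB.2⟩
          (sdiff_subset.trans hS'), mul_assoc]

/-- The covariance of two products, as a sum over the partitions that do not split. -/
theorem sub_eq_sum_nonsplit (m : Finset ι → R) (hm : m ∅ = 1) (S U : Finset ι)
    (hSU : Disjoint S U) :
    m (S ∪ U) - m S * m U = ∑ P : Finpartition (S ∪ U),
      if ∃ B ∈ P.parts, ¬ B ⊆ S ∧ ¬ B ⊆ U then ∏ B ∈ P.parts, setCumulant m B else 0 := by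
  rw [eq_partitionSum_setCumulant m hm (S ∪ U), eq_partitionSum_setCumulant m hm S,
    eq_partitionSum_setCumulant m hm U, ← partitionSum_union _ S U hSU, partitionSum, partitionSum,
    ← Finset.sum_sub_distrib]
  refine Finset.sum_congr rfl fun P _ => ?_
  split_ifs with h
  · obtain ⟨B, hB, h1, h2⟩ := h
    rw [Finset.prod_eq_zero hB (f := fun B => if B ⊆ S ∨ B ⊆ U then _ else _) (by simp [h1, h2]),
      sub_zero]
  · rw [sub_eq_zero]
    refine Finset.prod_congr rfl fun B hB => ?_
    push Not at h
    rw [if_pos]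
    by_cases h1 : B ⊆ S
    · exact Or.inl h1
    · exact Or.inr (h B hB h1)

theorem setCumulant_empty (m : Finset ι → R) : setCumulant m ∅ = 1 := by
  have h := Fintype.sum_unique (ι := Finpartition (⊥ : Finset ι)) (fun P =>
    (-1 : R) ^ (P.parts.card - 1) * ((P.parts.card - 1).factorial : R) * ∏ B ∈ P.parts, m B)
  rw [Finpartition.default_eq_empty] at h
  simpa [setCumulant, Finpartition.empty] using h

/-- The recursion, solved for its top term, determines the cumulants by induction on the set. This
transports them along embeddings and evaluates the second and fourth ones without listing
partitions. -/
theorem setCumulant_eq_sub (m : Finset ι → R) (hm : m ∅ = 1) {S : Finset ι} {i : ι} (hi : i ∈ S) :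
    setCumulant m S = m S -
      ∑ B ∈ (S.powerset.filter (i ∈ ·)).erase S, setCumulant m B * m (S \ B) := by
  have h := setCumulant_rec m hm hi
  rw [← Finset.add_sum_erase ({B ∈ S.powerset | i ∈ B}) _ (a := S) (by simp [hi])] at h
  simp only [Finset.sdiff_self, hm, mul_one] at h
  exact eq_sub_of_add_eq h.symm

theorem setCumulant_map {κ : Type*} [DecidableEq κ] (e : κ ↪ ι) (m : Finset ι → R) (hm : m ∅ = 1)
    (S : Finset κ) : setCumulant m (S.map e) = setCumulant (fun B => m (B.map e)) S := by
  induction S using Finset.strongInduction with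
  | H S ih =>
    rcases S.eq_empty_or_nonempty with rfl | ⟨i, hi⟩
    · rw [map_empty, setCumulant_empty, setCumulant_empty]
    · rw [setCumulant_eq_sub m hm (mem_map_of_mem e hi), setCumulant_eq_sub _ (by simpa) hi]
      congr 1
      symm
      refine Finset.sum_bij (fun B _ => B.map e) ?_ ?_ ?_ ?_
      · intro B hB
        simpa using hB
      · intro B _ B' _ h
        exact map_injective e h
      · intro B hB
        simp only [Finset.mem_erase, Finset.mem_filter, Finset.mem_powerset] at hB
        obtain ⟨B', hB', rfl⟩ := subset_map_iff.1 hB.2.1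
        exact ⟨B', by simpa using hB, rfl⟩
      · intro B hB
        simp only [Finset.mem_erase, Finset.mem_filter, Finset.mem_powerset] at hB
        rw [ih B (Finset.ssubset_iff_subset_ne.2 ⟨hB.2.1, hB.1⟩), Finset.map_sdiff]

theorem map_setCumulant {R' : Type*} [CommRing R'] (f : R →+* R') (m : Finset ι → R)
    (S : Finset ι) : f (setCumulant m S) = setCumulant (fun B => f (m B)) S := by
  simp [setCumulant, map_sum, map_prod]

theorem setCumulant_singleton (m : Finset ι → R) (hm : m ∅ = 1) (i : ι) :
    setCumulant m {i} = m {i} := by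
  have h := setCumulant_eq_sub m hm (mem_singleton_self i)
  rw [h, show (({i} : Finset ι).powerset.filter (i ∈ ·)).erase {i} = ∅ from ?_]
  · simp
  · ext B
    simp only [Finset.mem_erase, Finset.mem_filter, Finset.mem_powerset, subset_singleton_iff, notMem_empty, iff_false]
    rintro ⟨h1, rfl | rfl, h3⟩ <;> simp_all

/-- The cumulant of a pair with centred entries. -/
theorem setCumulant_two (m : Finset (Fin 2) → R) (hm : m ∅ = 1) (h0 : m {0} = 0) :
    setCumulant m univ = m univ := by
  rw [setCumulant_eq_sub m hm (mem_univ 0)]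
  rw [show ((univ : Finset (Fin 2)).powerset.filter (0 ∈ ·)).erase univ = {{0}} by decide]
  simp [setCumulant_singleton m hm, h0]

/-- The fourth cumulant of centred variables. -/
theorem setCumulant_four (m : Finset (Fin 4) → R) (hm : m ∅ = 1) (h0 : ∀ i, m {i} = 0) :
    setCumulant m univ = m univ - m {0, 1} * m {2, 3} - m {0, 2} * m {1, 3} -
      m {0, 3} * m {1, 2} := by
  have h2 : ∀ i j : Fin 4, i ≠ j → setCumulant m {i, j} = m {i, j} := by
    intro i j hij
    rw [setCumulant_eq_sub m hm (mem_insert_self i {j}),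
      show (({i, j} : Finset (Fin 4)).powerset.filter (i ∈ ·)).erase {i, j} = {{i}} from ?_]
    · simp [setCumulant_singleton m hm, h0]
    · revert i j; decide
  rw [setCumulant_eq_sub m hm (mem_univ 0)]
  rw [show ((univ : Finset (Fin 4)).powerset.filter (0 ∈ ·)).erase univ =
    {{0}, {0, 1}, {0, 2}, {0, 3}, {0, 1, 2}, {0, 1, 3}, {0, 2, 3}} by decide]
  have e1 : (univ : Finset (Fin 4)) \ {0, 1} = {2, 3} := by decide
  have e2 : (univ : Finset (Fin 4)) \ {0, 2} = {1, 3} := by decide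
  have e3 : (univ : Finset (Fin 4)) \ {0, 3} = {1, 2} := by decide
  have e4 : (univ : Finset (Fin 4)) \ {0, 1, 2} = {3} := by decide
  have e5 : (univ : Finset (Fin 4)) \ {0, 1, 3} = {2} := by decide
  have e6 : (univ : Finset (Fin 4)) \ {0, 2, 3} = {1} := by decide
  repeat rw [Finset.sum_insert (by decide)]
  rw [Finset.sum_singleton, e1, e2, e3, e4, e5, e6, setCumulant_singleton m hm, h2 _ _ (by decide),
    h2 _ _ (by decide), h2 _ _ (by decide)]
  simp only [h0]
  ring

end Combinatorics

end OrthSample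

end

noncomputable section

namespace OrthSample

/-! ### Counting frequencies: weights and the contraction of pairs. -/

section Weights

/-- The weight `1 + T 1{T ∣ x}` that bounds a normalised cumulant of Fourier transforms whose
frequencies add up to `x`. -/
def weight (T : ℕ) (x : ℤ) : ℝ := 1 + if (T : ℤ) ∣ x then (T : ℝ) else 0

theorem one_le_weight (T : ℕ) (x : ℤ) : 1 ≤ weight T x := by
  unfold weight; split_ifs <;> simp

theorem weight_nonneg (T : ℕ) (x : ℤ) : 0 ≤ weight T x := zero_le_one.trans (one_le_weight T x)

theorem weight_le (T : ℕ) (x : ℤ) : weight T x ≤ T + 1 := by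
  unfold weight; split_ifs <;> simp [add_comm]

theorem weight_of_dvd {T : ℕ} {x : ℤ} (h : (T : ℤ) ∣ x) : weight T x = T + 1 := by
  simp [weight, h, add_comm]

theorem weight_of_not_dvd {T : ℕ} {x : ℤ} (h : ¬ (T : ℤ) ∣ x) : weight T x = 1 := by
  simp [weight, h]

theorem weight_neg (T : ℕ) (x : ℤ) : weight T (-x) = weight T x := by
  simp [weight]

/-- The indices `1, …, T` represent each residue modulo `T` once, and `ε` is a unit. -/
theorem card_filter_dvd_le_one (T : ℕ) (a ε : ℤ) (hε : ε = 1 ∨ ε = -1) :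
    #{k ∈ Icc 1 T | (T : ℤ) ∣ a + ε * (k : ℕ)} ≤ 1 := by
  rw [card_le_one]
  intro k hk l hl
  simp only [Finset.mem_filter, Finset.mem_Icc] at hk hl
  have h := dvd_sub hk.2 hl.2
  have h1 : (T : ℤ) ∣ (k : ℤ) - l := by
    rcases hε with rfl | rfl
    · simpa using h
    · rw [← dvd_neg]; convert h using 1; ring
  have h2 := Int.eq_zero_of_abs_lt_dvd h1 (by rw [abs_lt]; omega)
  omega

/-- This is the contraction of one edge. The product expands into `1`, two single indicators with
factor `T`, and a double indicator with factor `T²`. Each divisibility has at most one solution `k`,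
and both together force `T ∣ a + b`; the four sums are at most `T`, `T`, `T` and `T² 1{T ∣ a + b}`.
-/
theorem sum_weight_mul_weight_le (T : ℕ) (a b ε : ℤ) (hε : ε = 1 ∨ ε = -1) :
    ∑ k ∈ Icc 1 T, weight T (a + ε * (k : ℕ)) * weight T (b - ε * (k : ℕ)) ≤
      T * 3 * weight T (a + b) := by
  have h1 : ∀ k : ℕ, weight T (a + ε * k) * weight T (b - ε * k) ≤
      1 + (T * if (T : ℤ) ∣ a + ε * k then (1 : ℝ) else 0) +
      (T * if (T : ℤ) ∣ b + (-ε) * k then (1 : ℝ) else 0) +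
      (T * (if (T : ℤ) ∣ a + b then (T : ℝ) else 0)) * if (T : ℤ) ∣ a + ε * k then (1 : ℝ) else 0 := by
    intro k
    have hb : b + (-ε) * (k : ℤ) = b - ε * k := by ring
    rw [hb]
    unfold weight
    by_cases hA : (T : ℤ) ∣ a + ε * k <;> by_cases hB : (T : ℤ) ∣ b - ε * k
    · have : (T : ℤ) ∣ a + b := by
        have := dvd_add hA hB
        rwa [show a + ε * (k : ℤ) + (b - ε * k) = a + b by ring] at this
      simp only [hA, hB, this, if_true]
      apply le_of_eq; ring
    all_goals
      simp only [hA, hB, if_true, if_false]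
      split_ifs <;> nlinarith [Nat.cast_nonneg (α := ℝ) T]
  have h2 : ∀ (a ε : ℤ), (ε = 1 ∨ ε = -1) →
      ∑ k ∈ Icc 1 T, (if (T : ℤ) ∣ a + ε * (k : ℕ) then (1 : ℝ) else 0) ≤ 1 := by
    intro a ε hε
    rw [Finset.sum_boole]
    exact_mod_cast card_filter_dvd_le_one T a ε hε
  refine (Finset.sum_le_sum fun k _ => h1 k).trans ?_
  rw [Finset.sum_add_distrib, Finset.sum_add_distrib, Finset.sum_add_distrib, ← Finset.mul_sum,
    ← Finset.mul_sum, ← Finset.mul_sum]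
  have hT : (0 : ℝ) ≤ T := Nat.cast_nonneg T
  have h3 := mul_le_mul_of_nonneg_left (h2 a ε hε) hT
  have h4 := mul_le_mul_of_nonneg_left (h2 b (-ε) (by rcases hε with rfl | rfl <;> simp)) hT
  have h5 := mul_le_mul_of_nonneg_left (h2 a ε hε)
    (mul_nonneg hT (show (0 : ℝ) ≤ if (T : ℤ) ∣ a + b then (T : ℝ) else 0 by split_ifs <;> simp))
  have h6 : (∑ k ∈ Icc 1 T, (1 : ℝ)) = T := by simp
  rw [h6]
  have h7 : (0 : ℝ) ≤ if (T : ℤ) ∣ a + b then (T : ℝ) else 0 := by split_ifs <;> simp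
  unfold weight
  nlinarith [mul_nonneg hT h7]

theorem sum_piFinset_succ {α M : Type*} [DecidableEq α] [AddCommMonoid M] {n : ℕ} (A : Finset α)
    (F : (Fin (n + 1) → α) → M) :
    ∑ k ∈ Fintype.piFinset (fun _ => A), F k =
      ∑ k' ∈ Fintype.piFinset (fun _ : Fin n => A), ∑ x ∈ A, F (Fin.cons x k') := by
  rw [Finset.sum_comm, ← Finset.sum_product']
  refine Finset.sum_bij' (fun k _ => (k 0, Fin.tail k)) (fun p _ => Fin.cons p.1 p.2) ?_ ?_ ?_ ?_ ?_
  · intro k hk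
    simp only [Fintype.mem_piFinset] at hk
    simp [Fin.tail, hk]
  · rintro ⟨x, k⟩ h
    simp only [Finset.mem_product, Fintype.mem_piFinset] at h ⊢
    intro i
    refine Fin.cases ?_ ?_ i
    · simpa using h.1
    · simpa using h.2
  · intro k _; simp
  · rintro ⟨x, k⟩ _; simp
  · intro k _; simp

/-- The contribution to the block `v` of a pair with frequencies `ε k` and `-ε (k + r)`, whose
elements lie in the blocks `b true` and `b false`. -/
def edgeValue {V : Type*} [DecidableEq V] (b : Bool → V) (ε r : ℤ) (k : ℕ) (v : V) : ℤ :=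
  (if b true = v then ε * k else 0) - (if b false = v then ε * (k + r) else 0)

/-- Gluing the block `v₀` onto `u₀` hands the contribution of `v₀` to `u₀` and leaves the other
blocks alone; `v₀` itself no longer counts afterwards. -/
theorem edgeValue_merge {V : Type*} [DecidableEq V] (b : Bool → V) (ε r : ℤ) (k : ℕ) {u₀ v₀ v : V}
    (hne : v ≠ v₀) : edgeValue (fun c => if b c = v₀ then u₀ else b c) ε r k v =
      edgeValue b ε r k v + if u₀ = v then edgeValue b ε r k v₀ else 0 := by
  have key : ∀ c : Bool, ∀ x : ℤ, (if (if b c = v₀ then u₀ else b c) = v then x else 0) =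
      (if b c = v then x else 0) + if u₀ = v then (if b c = v₀ then x else 0) else 0 := by
    intro c x
    by_cases h1 : b c = v₀ <;> by_cases h3 : u₀ = v <;> simp [h1, h3, hne.symm]
  simp only [edgeValue, key]
  split_ifs <;> ring

/-- The elements of `L` are the vertices of a multigraph, and the pair `i` is an edge from `b i
true` to `b i false` with free label `k i`. The labels are summed out one at a time; `f` sends a
vertex to a representative of its component. In the total over a component every label cancels and
only the shifts are left. The constants `a` are arbitrary because contraction changes them. -/
theorem exists_sum_prod_weight_le {V : Type*} [DecidableEq V] (T : ℕ) : ∀ (n : ℕ) (L : Finset V)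
    (b : Fin n → Bool → V) (_ : ∀ i c, b i c ∈ L) (a : V → ℤ) (ε r : Fin n → ℤ)
    (_ : ∀ i, ε i = 1 ∨ ε i = -1),
    ∃ f : V → V, (∀ i, f (b i true) = f (b i false)) ∧
      ∑ k ∈ Fintype.piFinset (fun _ : Fin n => Icc 1 T), ∏ v ∈ L,
          weight T (a v + ∑ i, edgeValue (b i) (ε i) (r i) (k i) v) ≤
        (T * 3 : ℝ) ^ n * ∏ u ∈ L.image f, weight T
          ((∑ v ∈ L, if f v = u then a v else 0) -
            ∑ i, if f (b i true) = u then ε i * r i else 0) := by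
  intro n
  induction n with
  | zero =>
    intro L b _ a ε r _
    refine ⟨id, by simp, ?_⟩
    simp only [Fintype.piFinset_of_isEmpty, univ_unique, Finset.sum_singleton, univ_eq_empty,
      Finset.sum_empty, pow_zero, one_mul, image_id, id]
    refine le_of_eq (Finset.prod_congr rfl fun v hv => ?_)
    simp [hv]
  | succ n ih =>
    intro L b hb a ε r hε
    have hT : (0 : ℝ) ≤ T := Nat.cast_nonneg T
    set u₀ := b 0 true with hu₀
    set v₀ := b 0 false with hv₀
    have hu : u₀ ∈ L := hb 0 true
    have hv : v₀ ∈ L := hb 0 false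
    set rest : (Fin n → ℕ) → V → ℤ := fun k v =>
      ∑ i : Fin n, edgeValue (b i.succ) (ε i.succ) (r i.succ) (k i) v with hrest
    simp only [sum_piFinset_succ, Fin.sum_univ_succ, Fin.cons_zero, Fin.cons_succ]
    change ∃ f : V → V, (∀ i, f (b i true) = f (b i false)) ∧
      ∑ k ∈ Fintype.piFinset (fun _ : Fin n => Icc 1 T), ∑ x ∈ Icc 1 T, ∏ v ∈ L,
          weight T (a v + (edgeValue (b 0) (ε 0) (r 0) x v + rest k v)) ≤ _
    by_cases huv : u₀ = v₀
    -- The edge is a loop: its label cancels, `-ε r` joins the constant of its vertex, and the sum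
    -- over the label is a bare factor `T ≤ 3T`.
    · obtain ⟨f, hf, h⟩ := ih L (fun i => b i.succ) (fun i c => hb _ _)
        (fun v => a v - if u₀ = v then ε 0 * r 0 else 0) (fun i => ε i.succ) (fun i => r i.succ)
        (fun i => hε _)
      refine ⟨f, fun i => Fin.cases (by rw [← hu₀, ← hv₀, huv]) hf i, ?_⟩
      have e1 : ∀ (x : ℕ) (v : V), edgeValue (b 0) (ε 0) (r 0) x v =
          -(if u₀ = v then ε 0 * r 0 else 0) := by
        intro x v
        simp only [edgeValue, ← hu₀, ← hv₀, ← huv]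
        split_ifs <;> ring
      have e2 : ∀ (k : Fin n → ℕ) (v : V), a v + (-(if u₀ = v then ε 0 * r 0 else 0) + rest k v) =
          (a v - if u₀ = v then ε 0 * r 0 else 0) + rest k v := by intros; ring
      have e3 : ∀ u, (∑ v ∈ L, if f v = u then (a v - if u₀ = v then ε 0 * r 0 else 0) else 0) =
          (∑ v ∈ L, if f v = u then a v else 0) - if f u₀ = u then ε 0 * r 0 else 0 := by
        intro u
        have : ∀ v, (if f v = u then (a v - if u₀ = v then ε 0 * r 0 else 0) else 0) =
            (if f v = u then a v else 0) -
              if u₀ = v then (if f u₀ = u then ε 0 * r 0 else 0) else 0 := by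
          intro v
          by_cases h1 : u₀ = v
          · subst h1; split_ifs <;> ring
          · simp [h1]
        simp only [this, Finset.sum_sub_distrib, Finset.sum_ite_eq, hu, if_true]
      simp only [e1, e2, Finset.sum_const, Nat.card_Icc, Nat.add_sub_cancel, ← Finset.smul_sum]
      simp only [e3] at h
      rw [nsmul_eq_mul, pow_succ, mul_comm _ ((T : ℝ) * 3), mul_assoc ((T : ℝ) * 3)]
      refine (mul_le_mul_of_nonneg_left h hT).trans ?_
      rw [mul_assoc (T : ℝ) 3]
      refine mul_le_mul_of_nonneg_left ?_ hT
      have e4 : ∀ u, (∑ v ∈ L, if f v = u then a v else 0) - (if f u₀ = u then ε 0 * r 0 else 0) -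
          (∑ i : Fin n, if f (b i.succ true) = u then ε i.succ * r i.succ else 0) =
          (∑ v ∈ L, if f v = u then a v else 0) - ((if f u₀ = u then ε 0 * r 0 else 0) +
          ∑ i : Fin n, if f (b i.succ true) = u then ε i.succ * r i.succ else 0) := by
        intro u; ring
      simp only [e4]
      have : 0 ≤ ((T : ℝ) * 3) ^ n * ∏ u ∈ L.image f, weight T
          ((∑ v ∈ L, if f v = u then a v else 0) - ((if f u₀ = u then ε 0 * r 0 else 0) +
          ∑ i : Fin n, if f (b i.succ true) = u then ε i.succ * r i.succ else 0)) :=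
        mul_nonneg (by positivity) (Finset.prod_nonneg fun _ _ => weight_nonneg _ _)
      linarith
    -- The edge joins two vertices: `v₀` is glued onto `u₀`, and the constant of `u₀` gains `a v₀ -
    -- ε r`.
    · have huL : u₀ ∈ L.erase v₀ := Finset.mem_erase.2 ⟨huv, hu⟩
      set g : V → V := fun v => if v = v₀ then u₀ else v with hg
      have hgL : ∀ v ∈ L, g v ∈ L.erase v₀ := by
        intro v hv
        by_cases h : v = v₀
        · simpa [hg, h] using ⟨huv, hu⟩
        · simpa [hg, h] using hv
      obtain ⟨f, hf, h⟩ := ih (L.erase v₀) (fun i c => g (b i.succ c)) (fun i c => hgL _ (hb _ _))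
        (fun v => a v + if u₀ = v then a v₀ - ε 0 * r 0 else 0) (fun i => ε i.succ)
        (fun i => r i.succ) (fun i => hε _)
      have gu : g u₀ = u₀ := by simp [hg]
      have gv : g v₀ = u₀ := by simp [hg]
      have hf0 : (f ∘ g) (b 0 true) = (f ∘ g) (b 0 false) := by
        simp only [Function.comp, ← hu₀, ← hv₀, gu, gv]
      refine ⟨f ∘ g, fun i => Fin.cases hf0 hf i, ?_⟩
      have himg : L.image (f ∘ g) = (L.erase v₀).image f := by
        rw [← image_image]
        congr 1
        ext v
        constructor
        · intro h; obtain ⟨w, hw, rfl⟩ := Finset.mem_image.1 h; exact hgL w hw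
        · intro h
          have h' := Finset.mem_erase.1 h
          exact Finset.mem_image.2 ⟨v, h'.2, by simp [hg, h'.1]⟩
      have hinner : ∀ k : Fin n → ℕ, ∑ x ∈ Icc 1 T, ∏ v ∈ L,
          weight T (a v + (edgeValue (b 0) (ε 0) (r 0) x v + rest k v)) ≤
          (T * 3) * ∏ v ∈ L.erase v₀, weight T ((a v + if u₀ = v then a v₀ - ε 0 * r 0 else 0) +
            ∑ i : Fin n, edgeValue (fun c => g (b i.succ c)) (ε i.succ) (r i.succ) (k i) v) := by
        intro k
        have e1 : ∀ x : ℕ, ∏ v ∈ L,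
            weight T (a v + (edgeValue (b 0) (ε 0) (r 0) x v + rest k v)) =
            (∏ v ∈ (L.erase v₀).erase u₀, weight T (a v + rest k v)) *
            (weight T ((a u₀ + rest k u₀) + ε 0 * x) *
             weight T ((a v₀ + rest k v₀ - ε 0 * r 0) - ε 0 * x)) := by
          intro x
          rw [← Finset.mul_prod_erase L _ hv, ← Finset.mul_prod_erase _ _ huL]
          have e0 : ∏ v ∈ (L.erase v₀).erase u₀,
              weight T (a v + (edgeValue (b 0) (ε 0) (r 0) x v + rest k v)) =
              ∏ v ∈ (L.erase v₀).erase u₀, weight T (a v + rest k v) := by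
            refine Finset.prod_congr rfl fun v hv => ?_
            simp only [Finset.mem_erase] at hv
            simp [edgeValue, ← hu₀, ← hv₀, Ne.symm hv.1, Ne.symm hv.2.1]
          have e2 : edgeValue (b 0) (ε 0) (r 0) x v₀ = - (ε 0 * (x + r 0)) := by
            simp [edgeValue, ← hu₀, ← hv₀, huv]
          have e3 : edgeValue (b 0) (ε 0) (r 0) x u₀ = ε 0 * x := by
            simp [edgeValue, ← hu₀, ← hv₀, Ne.symm huv]
          rw [e0, e2, e3, show a v₀ + (-(ε 0 * (x + r 0)) + rest k v₀) =
            (a v₀ + rest k v₀ - ε 0 * r 0) - ε 0 * x by ring,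
            show a u₀ + (ε 0 * x + rest k u₀) = (a u₀ + rest k u₀) + ε 0 * x by ring]
          ring
        simp only [e1, ← Finset.mul_sum]
        have hsum : ∀ v ≠ v₀, ∑ i : Fin n, edgeValue (fun c => g (b i.succ c)) (ε i.succ)
            (r i.succ) (k i) v = rest k v + if u₀ = v then rest k v₀ else 0 := by
          intro v hne
          simp only [hg, edgeValue_merge _ _ _ _ hne, Finset.sum_add_distrib, hrest]
          split_ifs <;> simp
        have e5 : ∏ v ∈ L.erase v₀, weight T ((a v + if u₀ = v then a v₀ - ε 0 * r 0 else 0) +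
            ∑ i : Fin n, edgeValue (fun c => g (b i.succ c)) (ε i.succ) (r i.succ) (k i) v) =
            (∏ v ∈ (L.erase v₀).erase u₀, weight T (a v + rest k v)) *
            weight T ((a u₀ + rest k u₀) + (a v₀ + rest k v₀ - ε 0 * r 0)) := by
          rw [← Finset.mul_prod_erase _ _ huL, mul_comm]
          congr 1
          · refine Finset.prod_congr rfl fun v hv => ?_
            simp only [Finset.mem_erase] at hv
            rw [hsum v hv.2.1]
            simp [Ne.symm hv.1]
          · rw [hsum u₀ huv]
            simp only [if_true]
            congr 1; ring
        rw [e5, mul_left_comm]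
        refine mul_le_mul_of_nonneg_left ?_ (Finset.prod_nonneg fun _ _ => weight_nonneg _ _)
        exact sum_weight_mul_weight_le T _ _ _ (hε 0)
      refine (Finset.sum_le_sum fun k _ => hinner k).trans ?_
      rw [← Finset.mul_sum, pow_succ, mul_comm _ ((T : ℝ) * 3), mul_assoc ((T : ℝ) * 3)]
      refine mul_le_mul_of_nonneg_left (h.trans (le_of_eq ?_)) (by positivity)
      rw [himg]
      congr 1
      refine Finset.prod_congr rfl fun u _ => ?_
      congr 1
      rw [← Finset.add_sum_erase L _ hv]
      simp only [Function.comp, gv, gu, ← hu₀]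
      have e6 : ∑ v ∈ L.erase v₀, (if f (g v) = u then a v else 0) =
          ∑ v ∈ L.erase v₀, (if f v = u then a v else 0) := by
        refine Finset.sum_congr rfl fun v hv => ?_
        simp [hg, (Finset.mem_erase.1 hv).1]
      have e7 : (∑ v ∈ L.erase v₀, if f v = u then (a v + if u₀ = v then a v₀ - ε 0 * r 0 else 0)
          else 0) = (∑ v ∈ L.erase v₀, if f v = u then a v else 0) +
            if f u₀ = u then a v₀ - ε 0 * r 0 else 0 := by
        have : ∀ v, (if f v = u then (a v + if u₀ = v then a v₀ - ε 0 * r 0 else 0) else 0) =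
            (if f v = u then a v else 0) +
              if u₀ = v then (if f u₀ = u then a v₀ - ε 0 * r 0 else 0) else 0 := by
          intro v
          by_cases h1 : u₀ = v
          · subst h1; split_ifs <;> ring
          · simp [h1]
        simp only [this, Finset.sum_add_distrib, Finset.sum_ite_eq, huL, if_true]
      rw [e6, e7]
      split_ifs <;> ring

/-- The frequency of an element of a pair. -/
def pairFreq {n : ℕ} (ε r : Fin n → ℤ) (k : Fin n → ℕ) (e : Fin n × Bool) : ℤ :=
  if e.2 then ε e.1 * k e.1 else -(ε e.1 * (k e.1 + r e.1))

/-- The graph bound for the blocks of a partition. Here `h i` labels the component of the pair `i`;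
later arguments use only that pairs meeting a common block share their label. -/
theorem exists_sum_prod_weight_partition_le (T : ℕ) {n : ℕ}
    (P : Finpartition (univ : Finset (Fin n × Bool))) (ε r : Fin n → ℤ)
    (hε : ∀ i, ε i = 1 ∨ ε i = -1) :
    ∃ h : Fin n → Finset (Fin n × Bool), (∀ B ∈ P.parts, ∀ e ∈ B, ∀ e' ∈ B, h e.1 = h e'.1) ∧
      ∑ k ∈ Fintype.piFinset (fun _ : Fin n => Icc 1 T), ∏ B ∈ P.parts,
          weight T (∑ e ∈ B, pairFreq ε r k e) ≤
        (T * 3 : ℝ) ^ n * ∏ u ∈ univ.image h, weight T (∑ i, if h i = u then ε i * r i else 0) := by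
  obtain ⟨f, hf, H⟩ := exists_sum_prod_weight_le T n P.parts (fun i c => P.part (i, c))
    (fun i c => P.part_mem.2 (mem_univ _)) (fun _ => 0) ε r hε
  have hfe : ∀ e : Fin n × Bool, f (P.part e) = f (P.part (e.1, true)) := by
    rintro ⟨i, c⟩
    cases c
    · exact (hf i).symm
    · rfl
  refine ⟨fun i => f (P.part (i, true)), ?_, ?_⟩
  · intro B hB e he e' he'
    dsimp only
    rw [← hfe e, ← hfe e', P.part_eq_of_mem hB he, P.part_eq_of_mem hB he']
  · have e1 : ∀ k : Fin n → ℕ, ∀ B ∈ P.parts, ∑ e ∈ B, pairFreq ε r k e =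
        0 + ∑ i, edgeValue (fun c => P.part (i, c)) (ε i) (r i) (k i) B := by
      intro k B hB
      have eB : ∑ e ∈ B, pairFreq ε r k e = ∑ e, if e ∈ B then pairFreq ε r k e else 0 := by
        simp
      rw [eB]
      simp only [Fintype.sum_prod_type, Fintype.sum_bool, zero_add]
      refine Finset.sum_congr rfl fun i _ => ?_
      have h1 := P.part_eq_iff_mem hB (a := (i, true))
      have h2 := P.part_eq_iff_mem hB (a := (i, false))
      have e3 : edgeValue (fun c => P.part (i, c)) (ε i) (r i) (k i) B =
          (if (i, true) ∈ B then ε i * (k i : ℤ) else 0) -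
            (if (i, false) ∈ B then ε i * (k i + r i) else 0) := by
        rw [edgeValue]
        congr 1
        · exact if_congr h1 rfl rfl
        · exact if_congr h2 rfl rfl
      rw [e3]
      simp only [pairFreq, if_true, Bool.false_eq_true, if_false]
      split_ifs <;> ring
    -- Blocks are nonempty, so every component contains some pair.
    have e2 : P.parts.image f = univ.image (fun i => f (P.part (i, true))) := by
      ext u
      simp only [Finset.mem_image, mem_univ, true_and]
      constructor
      · rintro ⟨B, hB, rfl⟩
        obtain ⟨e, he⟩ := P.nonempty_of_mem_parts hB
        exact ⟨e.1, by rw [← hfe e, P.part_eq_of_mem hB he]⟩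
      · rintro ⟨i, rfl⟩
        exact ⟨_, P.part_mem.2 (mem_univ _), rfl⟩
    calc _ = ∑ k ∈ Fintype.piFinset (fun _ : Fin n => Icc 1 T), ∏ B ∈ P.parts,
          weight T (0 + ∑ i, edgeValue (fun c => P.part (i, c)) (ε i) (r i) (k i) B) :=
          Finset.sum_congr rfl fun k _ => Finset.prod_congr rfl fun B hB => by rw [e1 k B hB]
      _ ≤ _ := H
      _ = _ := by
        rw [e2]
        congr 1
        refine Finset.prod_congr rfl fun u _ => ?_
        rw [← weight_neg]
        simp

/-- The bound for the pairs of two shifts, when the partition joins them. -/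
theorem prod_weight_le (T : ℕ) {V : Type*} [DecidableEq V] (h : Fin 4 → V) (r s : ℤ)
    (hr : ¬ (T : ℤ) ∣ r) (hs : ¬ (T : ℤ) ∣ s)
    (hj : ∃ i j : Fin 4, (i = 0 ∨ i = 1) ∧ (j = 2 ∨ j = 3) ∧ h i = h j) :
    ∏ u ∈ univ.image h, weight T (∑ i, if h i = u then (![r, -r, s, -s] : Fin 4 → ℤ) i else 0) ≤
      (T + 1 : ℝ) ^ (if (T : ℤ) ∣ r - s ∨ (T : ℤ) ∣ r + s then 2 else 1) := by
  set A : V → ℤ := fun u => ∑ i, if h i = u then (![r, -r, s, -s] : Fin 4 → ℤ) i else 0 with hA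
  set D := {u ∈ univ.image h | (T : ℤ) ∣ A u} with hD
  have hprod : ∏ u ∈ univ.image h, weight T (A u) = (T + 1 : ℝ) ^ #D := by
    rw [← Finset.prod_filter_mul_prod_filter_not _ (fun u => (T : ℤ) ∣ A u),
      Finset.prod_congr rfl (fun u hu => weight_of_dvd (Finset.mem_filter.1 hu).2),
      Finset.prod_congr (s₁ := {u ∈ univ.image h | ¬ (T : ℤ) ∣ A u}) rfl
        (fun u hu => weight_of_not_dvd (Finset.mem_filter.1 hu).2)]
    simp [hD]
  rw [hprod]
  have hT1 : (1 : ℝ) ≤ T + 1 := by simp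
  refine pow_le_pow_right₀ hT1 ?_
  have hr' : ¬ (T : ℤ) ∣ -r := by rwa [dvd_neg]
  have hs' : ¬ (T : ℤ) ∣ -s := by rwa [dvd_neg]
  -- a nonempty fibre with vanishing sum has two elements at least
  have hfib : ∀ u ∈ D, 2 ≤ #{i | h i = u} := by
    intro u hu
    simp only [hD, Finset.mem_filter, Finset.mem_image, mem_univ, true_and] at hu
    obtain ⟨⟨i, hi⟩, hdvd⟩ := hu
    by_contra hlt
    have h1 : #{i | h i = u} = 1 := by
      have : 0 < #{i | h i = u} := card_pos.2 ⟨i, by simp [hi]⟩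
      omega
    obtain ⟨j, hj⟩ := card_eq_one.1 h1
    have : A u = (![r, -r, s, -s] : Fin 4 → ℤ) j := by
      rw [hA]; dsimp only
      rw [← Finset.sum_filter, hj, Finset.sum_singleton]
    rw [this] at hdvd
    fin_cases j <;> simp_all
  -- Four pairs are distributed over the components, and each component counted in `D` uses up two.
  have hcard : #D * 2 ≤ 4 := by
    have h1 : ∑ u ∈ D, #{i | h i = u} ≤ #(univ : Finset (Fin 4)) :=
      by
      rw [← card_biUnion (fun x _ y _ hxy => ?_)]
      · exact card_le_card (subset_univ _)
      · rw [Function.onFun, disjoint_left]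
        intro i hi hi'
        simp only [Finset.mem_filter, mem_univ, true_and] at hi hi'
        exact hxy (hi.symm.trans hi')
    have h2 := Finset.sum_le_sum hfib
    simp only [Finset.sum_const, smul_eq_mul] at h2
    simpa using h2.trans h1
  split_ifs with hc
  · omega
  · push Not at hc
    have c1 := hc.1
    have c2 := hc.2
    -- Among the partial sums of `r, -r, s, -s`, the only ones divisible by `T` are now the empty
    -- one, the two cancelling pairs and the full sum; a sum of three terms reduces to a single `±r`
    -- or `±s`.
    have key : ∀ u ∈ D, (h 0 = u ↔ h 1 = u) ∧ (h 2 = u ↔ h 3 = u) := by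
      intro u hu
      have hdvd := (Finset.mem_filter.1 hu).2
      have c3 : ¬ (T : ℤ) ∣ -r + s := by
        rwa [← dvd_neg, show -(-r + s) = r - s by ring]
      have c4 : ¬ (T : ℤ) ∣ -r + -s := by
        rwa [← dvd_neg, show -(-r + -s) = r + s by ring]
      have c5 : ¬ (T : ℤ) ∣ r + -s := by rwa [← sub_eq_add_neg]
      simp only [hA, Fin.sum_univ_four, Matrix.cons_val] at hdvd
      by_cases a0 : h 0 = u <;> by_cases a1 : h 1 = u <;> by_cases a2 : h 2 = u <;>
        by_cases a3 : h 3 = u <;>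
        simp [a0, a1, a2, a3, hr, hs, c2, c3, c4, c5] at hdvd ⊢
    obtain ⟨i, j, hi, hj, hij⟩ := hj
    -- Some component meets both halves. With `key`, a component in `D` that holds one of the
    -- cancelling pairs therefore holds the other too, so all of `D` is one component.
    have hall : ∀ u ∈ D, h 0 = u ∧ h 2 = u := by
      intro u hu
      obtain ⟨k1, k2⟩ := key u hu
      obtain ⟨l, -, hl⟩ := Finset.mem_image.1 (Finset.mem_filter.1 hu).1
      have h01 : h 0 = u → h 2 = u := fun h0 => by
        have h1 := k1.1 h0
        rcases hi with rfl | rfl <;> rcases hj with rfl | rfl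
        · exact hij.symm.trans h0
        · exact k2.2 (hij.symm.trans h0)
        · exact hij.symm.trans h1
        · exact k2.2 (hij.symm.trans h1)
      have h23 : h 2 = u → h 0 = u := fun h2 => by
        have h3 := k2.1 h2
        rcases hi with rfl | rfl <;> rcases hj with rfl | rfl
        · exact hij.trans h2
        · exact hij.trans h3
        · exact k1.2 (hij.trans h2)
        · exact k1.2 (hij.trans h3)
      have : h 0 = u ∨ h 2 = u := by
        fin_cases l
        · exact Or.inl hl
        · exact Or.inl (k1.2 hl)
        · exact Or.inr hl
        · exact Or.inr (k2.2 hl)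
      rcases this with h0 | h2
      · exact ⟨h0, h01 h0⟩
      · exact ⟨h23 h2, h2⟩
    rw [card_le_one]
    intro u hu v hv
    exact (hall u hu).1.symm.trans (hall v hv).1

end Weights

end OrthSample

end

noncomputable section

namespace OrthSample

/-! ### Cumulants as multilinear maps on variables with eight moments. -/

section Multilinear

variable {Ω : Type*} [MeasurableSpace Ω]

/-- The complex random variables with a finite eighth moment. -/
def eighthMoments (μ : Measure Ω) : Submodule ℂ (Ω → ℂ) where
  carrier := {Y | MemLp Y 8 μ}
  add_mem' h h' := h.add h'
  zero_mem' := MemLp.zero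
  smul_mem' c _ h := h.const_smul c

/-- Hölder's inequality for at most eight factors in `L⁸`; the resulting exponent is at least one,
and the measure is finite. -/
theorem integrable_prod_of_memLp {ι : Type*} {μ : Measure Ω} [IsProbabilityMeasure μ]
    (B : Finset ι) (hB : #B ≤ 8) (Y : ι → Ω → ℂ) (hY : ∀ i ∈ B, MemLp (Y i) 8 μ) :
    Integrable (fun w => ∏ i ∈ B, Y i w) μ := by
  have h := MemLp.prod' (s := B) (p := fun _ => 8) hY
  rw [← memLp_one_iff_integrable]
  refine h.mono_exponent ?_
  rw [Finset.sum_const, nsmul_eq_mul, ENNReal.le_inv_iff_mul_le, one_mul]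
  rw [← div_eq_mul_inv]
  refine ENNReal.div_le_of_le_mul ?_
  rw [one_mul]
  exact_mod_cast hB

/-- The moment of a set of random variables. -/
def moment {ι : Type*} (μ : Measure Ω) (Y : ι → Ω → ℂ) (B : Finset ι) : ℂ :=
  ∫ w, ∏ i ∈ B, Y i w ∂μ

theorem moment_empty {ι : Type*} (μ : Measure Ω) [IsProbabilityMeasure μ] (Y : ι → Ω → ℂ) :
    moment μ Y ∅ = 1 := by simp [moment]

theorem moment_update_of_notMem {ι : Type*} [DecidableEq ι] (μ : Measure Ω) (Y : ι → Ω → ℂ)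
    {B : Finset ι} {i : ι} (hi : i ∉ B) (x : Ω → ℂ) :
    moment μ (Function.update Y i x) B = moment μ Y B := by
  unfold moment
  congr 1
  ext w
  refine Finset.prod_congr rfl fun j hj => ?_
  rw [Function.update_of_ne]
  rintro rfl
  exact hi hj

theorem moment_update_of_mem {ι : Type*} [DecidableEq ι] (μ : Measure Ω) (Y : ι → Ω → ℂ)
    {B : Finset ι} {i : ι} (hi : i ∈ B) (x : Ω → ℂ) :
    moment μ (Function.update Y i x) B = ∫ w, x w * ∏ j ∈ B.erase i, Y j w ∂μ := by
  unfold moment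
  congr 1
  ext w
  rw [← Finset.mul_prod_erase B _ hi, Function.update_self]
  congr 1
  refine Finset.prod_congr rfl fun j hj => ?_
  rw [Function.update_of_ne (Finset.mem_erase.1 hj).1]

/-- Exactly one block contains `i`, so the product of moments depends on the `i`-th variable through
one integral only, and linearly. Multilinearity of the cumulant follows term by term. -/
theorem prod_moment_update {ι : Type*} [DecidableEq ι] [Fintype ι] (μ : Measure Ω) (Y : ι → Ω → ℂ)
    (P : Finpartition (univ : Finset ι)) (i : ι) (x : Ω → ℂ) :
    ∏ B ∈ P.parts, moment μ (Function.update Y i x) B =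
      (∏ B ∈ P.parts.erase (P.part i), moment μ Y B) *
        ∫ w, x w * ∏ j ∈ (P.part i).erase i, Y j w ∂μ := by
  have hmem := P.part_mem.2 (mem_univ i)
  rw [← Finset.mul_prod_erase P.parts _ hmem, mul_comm,
    moment_update_of_mem μ Y (P.mem_part_self.2 (mem_univ i))]
  congr 1
  refine Finset.prod_congr rfl fun B hB => ?_
  obtain ⟨h1, h2⟩ := Finset.mem_erase.1 hB
  exact moment_update_of_notMem μ Y (fun h => h1 (P.part_eq_of_mem h2 h).symm) x

theorem integrable_mul_prod {ι : Type*} [DecidableEq ι] {μ : Measure Ω} [IsProbabilityMeasure μ]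
    (Y : ι → Ω → ℂ) (hY : ∀ i, MemLp (Y i) 8 μ) {B : Finset ι} (hB : #B ≤ 8) {i : ι} (hi : i ∈ B)
    {x : Ω → ℂ} (hx : MemLp x 8 μ) :
    Integrable (fun w => x w * ∏ j ∈ B.erase i, Y j w) μ := by
  have h := integrable_prod_of_memLp B hB (Function.update Y i x) (fun j _ => by
    by_cases h : j = i
    · subst h; simpa
    · rw [Function.update_of_ne h]; exact hY j)
  refine h.congr (ae_of_all _ fun w => ?_)
  dsimp only
  rw [← Finset.mul_prod_erase B _ hi, Function.update_self]
  congr 1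
  refine Finset.prod_congr rfl fun j hj => ?_
  rw [Function.update_of_ne (Finset.mem_erase.1 hj).1]

/-- The joint cumulant is multilinear. -/
def cumulantMultilinear (μ : Measure Ω) [IsProbabilityMeasure μ] (n : ℕ) (hn : n ≤ 8) :
    MultilinearMap ℂ (fun _ : Fin n => eighthMoments μ) ℂ where
  toFun Y := setCumulant (moment μ fun i => (Y i : Ω → ℂ)) univ
  map_update_add' := by
    intro inst Y i x y
    obtain rfl : inst = instDecidableEqFin n := Subsingleton.elim _ _
    have hup : ∀ z : eighthMoments μ, (fun j => ((Function.update Y i z j : eighthMoments μ) : Ω → ℂ))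
        = Function.update (fun j => (Y j : Ω → ℂ)) i z := by
      intro z; ext1 j
      by_cases h : j = i
      · subst h; simp
      · simp [h]
    simp only [hup, setCumulant, prod_moment_update, ← Finset.sum_add_distrib]
    refine Finset.sum_congr rfl fun P _ => ?_
    have hc : #(P.part i) ≤ 8 :=
      (card_le_univ _).trans (by simpa using hn)
    rw [← mul_add, ← mul_add, ← integral_add]
    · simp [add_mul]
    · exact integrable_mul_prod _ (fun j => (Y j).2) hc (P.mem_part_self.2 (mem_univ i)) x.2
    · exact integrable_mul_prod _ (fun j => (Y j).2) hc (P.mem_part_self.2 (mem_univ i)) y.2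
  map_update_smul' := by
    intro inst Y i c x
    obtain rfl : inst = instDecidableEqFin n := Subsingleton.elim _ _
    have hup : ∀ z : eighthMoments μ, (fun j => ((Function.update Y i z j : eighthMoments μ) : Ω → ℂ))
        = Function.update (fun j => (Y j : Ω → ℂ)) i z := by
      intro z; ext1 j
      by_cases h : j = i
      · subst h; simp
      · simp [h]
    simp only [hup, setCumulant, prod_moment_update, Finset.smul_sum]
    refine Finset.sum_congr rfl fun P _ => ?_
    have : ∀ w, ((c • x : eighthMoments μ) : Ω → ℂ) w * ∏ j ∈ (P.part i).erase i, (Y j : Ω → ℂ) w =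
        c * ((x : Ω → ℂ) w * ∏ j ∈ (P.part i).erase i, (Y j : Ω → ℂ) w) := by
      intro w; simp [mul_assoc]
    simp only [this, integral_const_mul, smul_eq_mul]
    ring

end Multilinear

/-! ### Cumulants of discrete Fourier transforms. -/

section Transform

/-- The character `t ↦ exp(2πi q t / T)`. -/
def character (T : ℕ) (q t : ℤ) : ℂ := Complex.exp (Complex.I * t * ((2 * Real.pi * q / T : ℝ) : ℂ))

theorem character_add (T : ℕ) (q s t : ℤ) :
    character T q (s + t) = character T q s * character T q t := by
  rw [character, character, character, ← Complex.exp_add]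
  congr 1; push_cast; ring

theorem character_add_left (T : ℕ) (q q' t : ℤ) :
    character T (q + q') t = character T q t * character T q' t := by
  rw [character, character, character, ← Complex.exp_add]
  congr 1; push_cast; ring

theorem character_zero_left (T : ℕ) (t : ℤ) : character T 0 t = 1 := by simp [character]

theorem character_sum_left (T : ℕ) {ι : Type*} (s : Finset ι) (q : ι → ℤ) (t : ℤ) :
    character T (∑ i ∈ s, q i) t = ∏ i ∈ s, character T (q i) t := by
  classical
  induction s using Finset.induction_on with
  | empty => simp [character_zero_left]
  | insert a s ha ih => rw [Finset.sum_insert ha, Finset.prod_insert ha, character_add_left, ih]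

theorem norm_character (T : ℕ) (q t : ℤ) : ‖character T q t‖ = 1 := by
  rw [character, Complex.norm_exp]
  simp

theorem character_eq_pow (T : ℕ) (q : ℤ) (t : ℕ) :
    character T q t = (character T q 1) ^ t := by
  rw [character, character, ← Complex.exp_nat_mul]
  congr 1; push_cast; ring

theorem character_pow_self {T : ℕ} (hT : 1 ≤ T) (q : ℤ) : (character T q 1) ^ T = 1 := by
  rw [← character_eq_pow, character, Complex.exp_eq_one_iff]
  refine ⟨q, ?_⟩
  have : (T : ℂ) ≠ 0 := by exact_mod_cast (by omega : T ≠ 0)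
  push_cast
  field_simp

theorem character_one_eq_one_iff {T : ℕ} (hT : 1 ≤ T) (q : ℤ) :
    character T q 1 = 1 ↔ (T : ℤ) ∣ q := by
  have h0 : (T : ℂ) ≠ 0 := by exact_mod_cast (by omega : T ≠ 0)
  have hpi : (Real.pi : ℂ) ≠ 0 := by exact_mod_cast Real.pi_ne_zero
  rw [character, Complex.exp_eq_one_iff]
  constructor
  · rintro ⟨n, hn⟩
    refine ⟨n, ?_⟩
    push_cast at hn
    field_simp at hn
    exact_mod_cast hn
  · rintro ⟨n, rfl⟩
    refine ⟨n, ?_⟩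
    push_cast
    field_simp

theorem sum_character {T : ℕ} (hT : 1 ≤ T) (q : ℤ) :
    ∑ t ∈ Icc 1 T, character T q (t : ℕ) = if (T : ℤ) ∣ q then (T : ℂ) else 0 := by
  simp only [character_eq_pow]
  split_ifs with h
  · rw [(character_one_eq_one_iff hT q).2 h]; simp
  · have h1 := mt (character_one_eq_one_iff hT q).1 h
    have h2 : ∑ t ∈ Icc 1 T, character T q 1 ^ t =
        character T q 1 * ∑ t ∈ range T, character T q 1 ^ t := by
      rw [Finset.mul_sum, Finset.range_eq_Ico, Finset.sum_Ico_eq_sum_range,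
        ← Finset.Ico_succ_right_eq_Icc, Finset.sum_Ico_eq_sum_range]
      simp [pow_add]
    rw [h2, geom_sum_eq h1, character_pow_self hT]
    simp

variable {Ω : Type*}

/-- The discrete Fourier transform at the frequency `2πq/T`. -/
def dftInt (X : ℤ → Ω → ℝ) (T : ℕ) (q : ℤ) (w : Ω) : ℂ := dft X T (2 * Real.pi * q / T) w

theorem dftInt_eq (X : ℤ → Ω → ℝ) (T : ℕ) (q : ℤ) (w : Ω) :
    dftInt X T q w = ((1 / Real.sqrt (2 * Real.pi * T) : ℝ) : ℂ) *
      ∑ t ∈ Icc 1 T, character T q (t : ℕ) * (X (t : ℕ) w : ℂ) := by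
  rw [dftInt, dft]
  congr 1
  refine Finset.sum_congr rfl fun t _ => ?_
  rw [mul_comm, character]; push_cast; rfl

theorem dft_freq (X : ℤ → Ω → ℝ) (T k : ℕ) (w : Ω) : dft X T (freq T k) w = dftInt X T k w := by
  simp [dftInt, freq]

/-- As the series is real, conjugation only negates the frequency; every moment with conjugates
becomes a moment of transforms at signed integer frequencies. -/
theorem conj_dftInt (X : ℤ → Ω → ℝ) (T : ℕ) (q : ℤ) (w : Ω) :
    (starRingEnd ℂ) (dftInt X T q w) = dftInt X T (-q) w := by
  rw [dftInt_eq, dftInt_eq, map_mul, Complex.conj_ofReal, map_sum]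
  congr 1
  refine Finset.sum_congr rfl fun t _ => ?_
  rw [map_mul, Complex.conj_ofReal, character, character, ← Complex.exp_conj]
  congr 2
  simp only [map_mul, Complex.conj_I, Complex.conj_ofReal]
  simp
  ring

variable [MeasurableSpace Ω] {μ : Measure Ω} {X : ℤ → Ω → ℝ}

theorem memLp_ofReal (hX : CumulantCondition μ X 8) (t : ℤ) :
    MemLp (fun w => (X t w : ℂ)) 8 μ := by
  have := (hX.memLp t).ofReal (K := ℂ)
  simpa using this

theorem memLp_dftInt (hX : CumulantCondition μ X 8) (T : ℕ) (q : ℤ) :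
    MemLp (dftInt X T q) 8 μ := by
  have : dftInt X T q = fun w => ((1 / Real.sqrt (2 * Real.pi * T) : ℝ) : ℂ) *
      ∑ t ∈ Icc 1 T, character T q (t : ℕ) * (X (t : ℕ) w : ℂ) := funext (dftInt_eq X T q)
  rw [this]
  refine MemLp.const_mul ?_ _
  refine memLp_finsetSum (f := fun (t : ℕ) w => character T q (t : ℕ) * (X (t : ℕ) w : ℂ)) _
    fun t _ => ?_
  exact MemLp.const_mul (memLp_ofReal hX t) _

theorem integral_prod_shift (hX : CumulantCondition μ X 8) {ι : Type*} (B : Finset ι)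
    (hB : #B ≤ 8) (t : ι → ℤ) (h : ℤ) :
    ∫ w, ∏ i ∈ B, X (t i + h) w ∂μ = ∫ w, ∏ i ∈ B, X (t i) w ∂μ := by
  have e := hX.stationary #B hB (fun i => t (B.equivFin.symm i)) h
  have l : ∀ g : ι → Ω → ℝ, ∫ w, ∏ i ∈ B, g i w ∂μ =
      ∫ w, ∏ i : Fin #B, g (B.equivFin.symm i) w ∂μ := by
    intro g
    congr 1; ext w
    rw [Equiv.prod_comp B.equivFin.symm (fun i : B => g i w), Finset.prod_coe_sort B (g · w)]
  rw [l (fun i => X (t i + h)), l (fun i => X (t i))]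
  exact e

theorem cumulant_eq_kappa (hX : CumulantCondition μ X 8) {n : ℕ} (hn : n + 1 ≤ 8)
    (t : Fin (n + 1) → ℤ) :
    cumulant μ (fun i => X (t i)) = kappa μ X (fun i : Fin n => t i.succ - t 0) := by
  unfold kappa cumulant
  refine Finset.sum_congr rfl fun P _ => ?_
  congr 1
  refine Finset.prod_congr rfl fun B _ => ?_
  rw [← integral_prod_shift hX B ((card_le_univ _).trans (by simpa using hn))
    (Fin.cons 0 (fun i : Fin n => t i.succ - t 0)) (t 0)]
  congr 1; ext w
  refine Finset.prod_congr rfl fun i _ => ?_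
  refine Fin.cases ?_ (fun j => ?_) i <;> simp

theorem setCumulant_moment_ofReal (n : ℕ) (Y : Fin n → Ω → ℝ) :
    setCumulant (moment μ (fun i w => (Y i w : ℂ))) univ = (cumulant μ Y : ℂ) := by
  have h : cumulant μ Y = setCumulant (fun B => ∫ w, ∏ i ∈ B, Y i w ∂μ) univ := rfl
  rw [h, ← Complex.ofRealHom_eq_coe, map_setCumulant]
  congr 1
  ext B
  rw [moment, Complex.ofRealHom_eq_coe, ← integral_complex_ofReal]
  congr 1; ext w; push_cast; rfl

/-- Multilinearity expands the cumulant over all choices of times, and shift invariance makes each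
resulting cumulant a function of the lags `t_{i+1} - t_0`. -/
theorem setCumulant_dftInt [IsProbabilityMeasure μ] (hX : CumulantCondition μ X 8) (T : ℕ) {n : ℕ}
    (hn : n + 1 ≤ 8) (q : Fin (n + 1) → ℤ) :
    setCumulant (moment μ (fun i => dftInt X T (q i))) univ =
      ((1 / Real.sqrt (2 * Real.pi * T) : ℝ) : ℂ) ^ (n + 1) *
      ∑ t ∈ Fintype.piFinset (fun _ : Fin (n + 1) => Icc 1 T),
        (∏ i, character T (q i) (t i)) * (kappa μ X (fun i : Fin n => (t i.succ : ℤ) - t 0) : ℂ) := by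
  let x : ℤ → eighthMoments μ := fun t => ⟨fun w => (X t w : ℂ), memLp_ofReal hX t⟩
  let c : ℂ := ((1 / Real.sqrt (2 * Real.pi * T) : ℝ) : ℂ)
  have h1 : (fun i => dftInt X T (q i)) = fun i : Fin (n + 1) =>
      ((c • ∑ t ∈ Icc 1 T, character T (q i) (t : ℕ) • x t : eighthMoments μ) : Ω → ℂ) := by
    ext i w
    rw [dftInt_eq]
    simp [x, c]
  rw [h1]
  change cumulantMultilinear μ (n + 1) hn (fun i => c • ∑ t ∈ Icc 1 T,
    character T (q i) (t : ℕ) • x t) = _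
  rw [MultilinearMap.map_smul_univ, MultilinearMap.map_sum_finset]
  simp only [MultilinearMap.map_smul_univ, Finset.prod_const, card_univ, Fintype.card_fin,
    smul_eq_mul]
  congr 1
  refine Finset.sum_congr rfl fun t _ => ?_
  congr 1
  have h2 := setCumulant_moment_ofReal (μ := μ) (n + 1) (fun i => X (t i : ℤ))
  rw [cumulant_eq_kappa hX hn] at h2
  exact h2

end Transform

end OrthSample

end

noncomputable section

namespace OrthSample

/-! ### Fourier series of cumulants and the boundary error of box sums. -/

section Spectrum

variable {n : ℕ} (κ : (Fin n → ℤ) → ℝ)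

/-- The sum `∑ᵤ (1 + ∑ⱼ |uⱼ|) |κ u|`. -/
def decay : ℝ := ∑' u : Fin n → ℤ, (1 + ∑ j, |(u j : ℝ)|) * |κ u|

/-- The Fourier series with coefficients `κ`. -/
def spectrum (x : Fin n → ℝ) : ℂ :=
  ∑' u : Fin n → ℤ, (κ u : ℂ) * Complex.exp (Complex.I * ((∑ j, u j * x j : ℝ) : ℂ))

theorem decay_nonneg : 0 ≤ decay κ := tsum_nonneg fun u => by positivity

variable {κ}

theorem norm_coeff_mul_exp (u : Fin n → ℤ) (y : ℝ) :
    ‖(κ u : ℂ) * Complex.exp (Complex.I * (y : ℂ))‖ = |κ u| := by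
  rw [norm_mul, Complex.norm_real, mul_comm Complex.I, Complex.norm_exp_ofReal_mul_I, mul_one,
    Real.norm_eq_abs]

variable (hκ : Summable fun u : Fin n → ℤ => (1 + ∑ j, |(u j : ℝ)|) * |κ u|)

include hκ

theorem summable_abs : Summable fun u => |κ u| := by
  refine Summable.of_nonneg_of_le (fun u => abs_nonneg _) (fun u => ?_) hκ
  have : 0 ≤ ∑ j, |(u j : ℝ)| := Finset.sum_nonneg fun _ _ => abs_nonneg _
  nlinarith [abs_nonneg (κ u)]

theorem summable_spectrum (x : Fin n → ℝ) : Summable fun u : Fin n → ℤ =>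
    (κ u : ℂ) * Complex.exp (Complex.I * ((∑ j, u j * x j : ℝ) : ℂ)) := by
  refine Summable.of_norm ?_
  simp only [norm_coeff_mul_exp]
  exact summable_abs hκ

theorem norm_spectrum_le (x : Fin n → ℝ) : ‖spectrum κ x‖ ≤ decay κ := by
  refine tsum_of_norm_bounded hκ.hasSum fun u => ?_
  rw [norm_coeff_mul_exp]
  have : 0 ≤ ∑ j, |(u j : ℝ)| := Finset.sum_nonneg fun _ _ => abs_nonneg _
  nlinarith [abs_nonneg (κ u)]

/-- Since `|exp(ia) - exp(ib)| ≤ |a - b|`, the coefficient at `u` varies by at most `∑ⱼ |uⱼ| δ |κ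
u|`. This is where the factors `1 + |jᵢ|` of the cumulant condition give Lipschitz spectra. -/
theorem norm_spectrum_sub_le (x y : Fin n → ℝ) {δ : ℝ} (h : ∀ j, |x j - y j| ≤ δ) (hδ : 0 ≤ δ) :
    ‖spectrum κ x - spectrum κ y‖ ≤ decay κ * δ := by
  rw [spectrum, spectrum, ← (summable_spectrum hκ x).tsum_sub (summable_spectrum hκ y)]
  refine tsum_of_norm_bounded (hκ.hasSum.mul_right δ) fun u => ?_
  rw [← mul_sub, norm_mul, Complex.norm_real, Real.norm_eq_abs]
  have h1 : ‖Complex.exp (Complex.I * ((∑ j, u j * x j : ℝ) : ℂ)) -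
      Complex.exp (Complex.I * ((∑ j, u j * y j : ℝ) : ℂ))‖ ≤ |∑ j, u j * x j - ∑ j, u j * y j| := by
    have e : Complex.exp (Complex.I * ((∑ j, u j * x j : ℝ) : ℂ)) -
      Complex.exp (Complex.I * ((∑ j, u j * y j : ℝ) : ℂ)) =
      Complex.exp (Complex.I * ((∑ j, u j * y j : ℝ) : ℂ)) *
       (Complex.exp (Complex.I * ((∑ j, u j * x j - ∑ j, u j * y j : ℝ) : ℂ)) - 1) := by
      rw [mul_sub, ← Complex.exp_add, mul_one]
      congr 2
      push_cast; ring
    rw [e, norm_mul, mul_comm Complex.I, Complex.norm_exp_ofReal_mul_I, one_mul]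
    have := Real.norm_exp_I_mul_ofReal_sub_one_le (x := ∑ j, u j * x j - ∑ j, u j * y j)
    simpa [Real.norm_eq_abs] using this
  have h2 : |∑ j, u j * x j - ∑ j, u j * y j| ≤ (∑ j, |(u j : ℝ)|) * δ := by
    rw [← Finset.sum_sub_distrib, Finset.sum_mul]
    refine (Finset.abs_sum_le_sum_abs _ _).trans (Finset.sum_le_sum fun j _ => ?_)
    rw [← mul_sub, abs_mul]
    exact mul_le_mul_of_nonneg_left (h j) (abs_nonneg _)
  have h3 := mul_le_mul_of_nonneg_left (h1.trans h2) (abs_nonneg (κ u))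
  nlinarith [mul_nonneg (abs_nonneg (κ u)) hδ]

omit hκ

theorem prod_character_eq_exp (T : ℕ) (q u : Fin n → ℤ) :
    ∏ j, character T (q j) (u j) =
      Complex.exp (Complex.I * ((∑ j, u j * (2 * Real.pi * q j / T) : ℝ) : ℂ)) := by
  simp only [character]
  rw [← Complex.exp_sum]
  congr 1
  push_cast
  rw [Finset.mul_sum]
  refine Finset.sum_congr rfl fun j _ => ?_
  ring

theorem card_filter_shift_le (T : ℕ) (u : ℤ) :
    (#{x ∈ Icc 1 T | ¬ (1 ≤ (x : ℕ) + u ∧ (x : ℕ) + u ≤ T)} : ℤ) ≤ |u| := by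
  have h : #{x ∈ Icc 1 T | ¬ (1 ≤ (x : ℕ) + u ∧ (x : ℕ) + u ≤ T)} ≤ u.natAbs := by
    rcases le_total 0 u with h0 | h0
    · have : {x ∈ Icc 1 T | ¬ (1 ≤ (x : ℕ) + u ∧ (x : ℕ) + u ≤ T)} ⊆ Ioc (T - u.natAbs) T := by
        intro x hx
        simp only [Finset.mem_filter, Finset.mem_Icc, Finset.mem_Ioc] at hx ⊢
        omega
      refine (card_le_card this).trans ?_
      rw [Nat.card_Ioc]; omega
    · have : {x ∈ Icc 1 T | ¬ (1 ≤ (x : ℕ) + u ∧ (x : ℕ) + u ≤ T)} ⊆ Icc 1 u.natAbs := by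
        intro x hx
        simp only [Finset.mem_filter, Finset.mem_Icc] at hx ⊢
        omega
      refine (card_le_card this).trans ?_
      rw [Nat.card_Icc]; omega
  rw [Int.abs_eq_natAbs]
  exact_mod_cast h

/-- The indicator that the translate of `u` by `x` lies in `{1, …, T}`. -/
def boxIndicator (T : ℕ) (u : Fin n → ℤ) (x : ℕ) : Prop := ∀ j, 1 ≤ (x : ℤ) + u j ∧ (x : ℤ) + u j ≤ T

-- A point `x` is lost only if some `x + u j` leaves `{1, …, T}`, and for each `j` this happens for
-- at most `|u j|` values of `x`.
open Classical in
theorem norm_sum_boxIndicator_sub_le (T : ℕ) (u : Fin n → ℤ) (Q : ℤ) :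
    ‖(∑ x ∈ Icc 1 T, if boxIndicator T u x then character T Q (x : ℕ) else 0) -
      ∑ x ∈ Icc 1 T, character T Q (x : ℕ)‖ ≤ ∑ j, |(u j : ℝ)| := by
  rw [← Finset.sum_sub_distrib]
  have h1 : ∀ x ∈ Icc 1 T, ‖(if boxIndicator T u x then character T Q (x : ℕ) else 0) -
      character T Q (x : ℕ)‖ ≤
      ∑ j, if ¬ (1 ≤ (x : ℕ) + u j ∧ (x : ℕ) + u j ≤ T) then (1 : ℝ) else 0 := by
    intro x _
    by_cases hx : boxIndicator T u x
    · simp only [hx, if_true, sub_self, norm_zero]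
      exact Finset.sum_nonneg fun j _ => by split_ifs <;> simp
    · simp only [hx, if_false, zero_sub, norm_neg, norm_character]
      simp only [boxIndicator, not_forall] at hx
      obtain ⟨j, hj⟩ := hx
      refine le_trans (by rw [if_pos hj]) (Finset.single_le_sum (f := fun j =>
        if ¬ (1 ≤ (x : ℕ) + u j ∧ (x : ℕ) + u j ≤ T) then (1 : ℝ) else 0)
        (fun j _ => by split_ifs <;> simp) (mem_univ j))
  refine (norm_sum_le _ _).trans ((Finset.sum_le_sum h1).trans ?_)
  rw [Finset.sum_comm]
  refine Finset.sum_le_sum fun j _ => ?_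
  rw [Finset.sum_boole]
  have := card_filter_shift_le T (u j)
  exact_mod_cast this

open Classical in
theorem sum_box_eq_tsum (T : ℕ) (x : ℕ) (G : (Fin n → ℤ) → ℂ) :
    ∑ t ∈ Fintype.piFinset (fun _ : Fin n => Icc 1 T), G (fun j => (t j : ℤ) - x) =
      ∑' u : Fin n → ℤ, if boxIndicator T u x then G u else 0 := by
  set S := (Fintype.piFinset (fun _ : Fin n => Icc 1 T)).image (fun t j => (t j : ℤ) - x) with hS
  have hmem : ∀ u : Fin n → ℤ, boxIndicator T u x ↔ u ∈ S := by
    intro u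
    simp only [hS, Finset.mem_image, Fintype.mem_piFinset, Finset.mem_Icc, boxIndicator]
    constructor
    · intro h
      refine ⟨fun j => (x + u j).toNat, fun j => ?_, ?_⟩
      · have := h j
        change 1 ≤ ((x : ℤ) + u j).toNat ∧ ((x : ℤ) + u j).toNat ≤ T
        omega
      · ext j
        have := h j
        change ((((x : ℤ) + u j).toNat : ℕ) : ℤ) - x = u j
        omega
    · rintro ⟨t, ht, rfl⟩ j
      have := ht j
      change 1 ≤ (x : ℤ) + ((t j : ℤ) - x) ∧ (x : ℤ) + ((t j : ℤ) - x) ≤ T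
      omega
  rw [tsum_eq_sum (s := S) (fun u hu => by rw [if_neg (mt (hmem u).1 hu)])]
  rw [hS, Finset.sum_image]
  · refine Finset.sum_congr rfl fun t ht => ?_
    rw [if_pos]
    rw [hmem, hS]
    exact Finset.mem_image_of_mem _ ht
  · intro t _ t' _ h
    ext j
    have := congrFun h j
    simpa using this

/-- Substitute `t_0 = x` and `t_{j+1} = x + u j`. For fixed `u` the unrestricted sum over `x` is a
full character sum, equal to `T` or `0`; the restriction to the box costs at most `∑ⱼ |u j|`, and
summation against `|κ u|` is bounded by `decay κ`. -/
theorem norm_sum_box_sub_le {T : ℕ} (hT : 1 ≤ T)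
    (hκ : Summable fun u : Fin n → ℤ => (1 + ∑ j, |(u j : ℝ)|) * |κ u|) (q : Fin (n + 1) → ℤ) :
    ‖(∑ t ∈ Fintype.piFinset (fun _ : Fin (n + 1) => Icc 1 T),
        (∏ i, character T (q i) (t i)) * (κ (fun i : Fin n => (t i.succ : ℤ) - t 0) : ℂ)) -
      (if (T : ℤ) ∣ ∑ i, q i then (T : ℂ) else 0) *
        spectrum κ (fun j => 2 * Real.pi * q j.succ / T)‖ ≤ decay κ := by
  classical
  have h1 : ∑ t ∈ Fintype.piFinset (fun _ : Fin (n + 1) => Icc 1 T),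
        (∏ i, character T (q i) (t i)) * (κ (fun i : Fin n => (t i.succ : ℤ) - t 0) : ℂ) =
      ∑ x ∈ Icc 1 T, ∑' u : Fin n → ℤ, if boxIndicator T u x then
        character T (∑ i, q i) (x : ℕ) *
          ((κ u : ℂ) * Complex.exp (Complex.I * ((∑ j, u j * (2 * Real.pi * q j.succ / T) : ℝ) : ℂ)))
        else 0 := by
    rw [sum_piFinset_succ, Finset.sum_comm]
    refine Finset.sum_congr rfl fun x _ => ?_
    rw [← sum_box_eq_tsum T x (fun u => character T (∑ i, q i) (x : ℕ) *
      ((κ u : ℂ) * Complex.exp (Complex.I * ((∑ j, u j * (2 * Real.pi * q j.succ / T) : ℝ) : ℂ))))]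
    refine Finset.sum_congr rfl fun t _ => ?_
    rw [← prod_character_eq_exp T (fun j => q j.succ) (fun j => (t j : ℤ) - x)]
    rw [character_sum_left, Fin.prod_univ_succ, Fin.prod_univ_succ]
    simp only [Fin.cons_zero, Fin.cons_succ]
    have : ∏ j : Fin n, character T (q j.succ) (t j : ℕ) =
        (∏ j : Fin n, character T (q j.succ) (x : ℕ)) *
          ∏ j : Fin n, character T (q j.succ) ((t j : ℤ) - x) := by
      rw [← Finset.prod_mul_distrib]
      refine Finset.prod_congr rfl fun j _ => ?_
      rw [← character_add]; congr 1; ring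
    rw [this]
    ring
  set e : (Fin n → ℤ) → ℂ := fun u =>
    (κ u : ℂ) * Complex.exp (Complex.I * ((∑ j, u j * (2 * Real.pi * q j.succ / T) : ℝ) : ℂ)) with he
  have hes : Summable e := summable_spectrum hκ _
  have hsx : ∀ x ∈ Icc 1 T, Summable fun u : Fin n → ℤ => if boxIndicator T u x then
        character T (∑ i, q i) (x : ℕ) * e u else 0 := by
    intro x _
    refine Summable.of_norm_bounded (g := fun u => |κ u|) (summable_abs hκ) fun u => ?_
    split_ifs
    · rw [norm_mul, norm_character, one_mul, he, norm_coeff_mul_exp]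
    · simp
  rw [h1, ← Summable.tsum_finsetSum hsx, ← sum_character hT, spectrum, ← tsum_mul_left,
    ← (summable_sum hsx).tsum_sub (hes.mul_left _)]
  refine tsum_of_norm_bounded hκ.hasSum fun u => ?_
  have h2 : (∑ x ∈ Icc 1 T, if boxIndicator T u x then character T (∑ i, q i) (x : ℕ) * e u else 0) =
      (∑ x ∈ Icc 1 T, if boxIndicator T u x then character T (∑ i, q i) (x : ℕ) else 0) * e u := by
    rw [Finset.sum_mul]
    refine Finset.sum_congr rfl fun x _ => ?_
    split_ifs <;> simp
  rw [h2, ← sub_mul, norm_mul]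
  have h3 : ‖e u‖ = |κ u| := norm_coeff_mul_exp u _
  rw [h3]
  refine mul_le_mul_of_nonneg_right ?_ (abs_nonneg _)
  refine (norm_sum_boxIndicator_sub_le T u _).trans ?_
  linarith

end Spectrum

/-! ### Uniform bounds for cumulants of Fourier transforms. -/

section CumulantBounds

variable {Ω : Type*} [MeasurableSpace Ω] {μ : Measure Ω} {X : ℤ → Ω → ℝ}

theorem summable_kappa (hX : CumulantCondition μ X 8) {n : ℕ} (h1 : 1 ≤ n) (hn : n + 1 ≤ 8) :
    Summable fun u : Fin n → ℤ => (1 + ∑ j, |(u j : ℝ)|) * |kappa μ X u| := by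
  refine Summable.of_nonneg_of_le (fun u => by positivity) (fun u => ?_)
    (summable_sum (s := univ) fun i _ => hX.summable n h1 hn i)
  rw [← Finset.sum_mul, Finset.sum_add_distrib]
  refine mul_le_mul_of_nonneg_right ?_ (abs_nonneg _)
  have : (1 : ℝ) ≤ n := by exact_mod_cast h1
  simpa using this

/-- The normalisation of the Fourier transform. -/
def dftScale (T : ℕ) : ℝ := 1 / Real.sqrt (2 * Real.pi * T)

theorem dftScale_nonneg (T : ℕ) : 0 ≤ dftScale T := by unfold dftScale; positivity

theorem dftScale_sq (T : ℕ) : dftScale T ^ 2 = 1 / (2 * Real.pi * T) := by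
  rw [dftScale, div_pow, one_pow, Real.sq_sqrt (by positivity)]

theorem dftScale_le (T : ℕ) : dftScale T ≤ 1 / Real.sqrt T := by
  unfold dftScale
  rcases Nat.eq_zero_or_pos T with rfl | hT
  · simp
  refine one_div_le_one_div_of_le (Real.sqrt_pos.2 (by exact_mod_cast hT)) (Real.sqrt_le_sqrt ?_)
  have h1 : (1 : ℝ) ≤ 2 * Real.pi := by linarith [Real.pi_gt_three]
  nlinarith [Nat.cast_nonneg (α := ℝ) T]

/-- A common bound for the constants of the cumulants up to order eight. -/
def cumulantConst (μ : Measure Ω) (X : ℤ → Ω → ℝ) : ℝ :=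
  1 + ∑ n ∈ range 8, decay (kappa μ X (n := n))

theorem one_le_cumulantConst : 1 ≤ cumulantConst μ X :=
  le_add_of_nonneg_right (Finset.sum_nonneg fun _ _ => decay_nonneg _)

theorem decay_le_cumulantConst {n : ℕ} (hn : n + 1 ≤ 8) :
    decay (kappa μ X (n := n)) ≤ cumulantConst μ X := by
  have := Finset.single_le_sum (f := fun n => decay (kappa μ X (n := n)))
    (fun n _ => decay_nonneg _) (mem_range.2 (show n < 8 by omega))
  unfold cumulantConst
  linarith

variable [IsProbabilityMeasure μ]

theorem norm_setCumulant_sub_le (hX : CumulantCondition μ X 8) {T : ℕ} (hT : 1 ≤ T) {n : ℕ}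
    (h1 : 1 ≤ n) (hn : n + 1 ≤ 8) (q : Fin (n + 1) → ℤ) :
    ‖setCumulant (moment μ (fun i => dftInt X T (q i))) univ - (dftScale T : ℂ) ^ (n + 1) *
      ((if (T : ℤ) ∣ ∑ i, q i then (T : ℂ) else 0) *
        spectrum (kappa μ X) (fun j : Fin n => 2 * Real.pi * q j.succ / T))‖ ≤
      dftScale T ^ (n + 1) * decay (kappa μ X (n := n)) := by
  rw [setCumulant_dftInt hX T hn, ← dftScale, ← mul_sub, norm_mul, norm_pow, Complex.norm_real,
    Real.norm_of_nonneg (dftScale_nonneg T)]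
  exact mul_le_mul_of_nonneg_left (norm_sum_box_sub_le hT (summable_kappa hX h1 hn) q)
    (pow_nonneg (dftScale_nonneg T) _)

theorem norm_setCumulant_le (hX : CumulantCondition μ X 8) {T : ℕ} (hT : 1 ≤ T) {n : ℕ}
    (h1 : 1 ≤ n) (hn : n + 1 ≤ 8) (q : Fin (n + 1) → ℤ) :
    ‖setCumulant (moment μ (fun i => dftInt X T (q i))) univ‖ ≤
      decay (kappa μ X (n := n)) * (dftScale T ^ (n + 1) * weight T (∑ i, q i)) := by
  have h := norm_setCumulant_sub_le hX hT h1 hn q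
  have h2 := norm_spectrum_le (summable_kappa hX h1 hn) (fun j : Fin n => 2 * Real.pi * q j.succ / T)
  have h3 : ‖(dftScale T : ℂ) ^ (n + 1) * ((if (T : ℤ) ∣ ∑ i, q i then (T : ℂ) else 0) *
        spectrum (kappa μ X) (fun j : Fin n => 2 * Real.pi * q j.succ / T))‖ ≤
      dftScale T ^ (n + 1) * ((if (T : ℤ) ∣ ∑ i, q i then (T : ℝ) else 0) *
        decay (kappa μ X (n := n))) := by
    rw [norm_mul, norm_pow, Complex.norm_real, Real.norm_of_nonneg (dftScale_nonneg T), norm_mul]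
    refine mul_le_mul_of_nonneg_left ?_ (pow_nonneg (dftScale_nonneg T) _)
    refine mul_le_mul ?_ h2 (norm_nonneg _) (by split_ifs <;> simp)
    split_ifs <;> simp
  have h4 := norm_le_norm_add_norm_sub' (setCumulant (moment μ (fun i => dftInt X T (q i))) univ)
    ((dftScale T : ℂ) ^ (n + 1) * ((if (T : ℤ) ∣ ∑ i, q i then (T : ℂ) else 0) *
        spectrum (kappa μ X) (fun j : Fin n => 2 * Real.pi * q j.succ / T)))
  unfold weight
  calc _ ≤ _ := h4
    _ ≤ _ := add_le_add h3 h
    _ = _ := by ring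

theorem integral_dftInt (hX : CumulantCondition μ X 8) (hmean : ∀ t, ∫ w, X t w ∂μ = 0) (T : ℕ)
    (q : ℤ) : ∫ w, dftInt X T q w ∂μ = 0 := by
  simp only [dftInt_eq]
  rw [integral_const_mul, integral_finsetSum]
  · rw [Finset.sum_eq_zero, mul_zero]
    intro t _
    rw [integral_const_mul, integral_complex_ofReal, hmean]
    simp
  · intro t _
    exact ((memLp_ofReal hX t).integrable (by norm_num)).const_mul _

/-- The cumulant of Fourier transforms over any set of indices. -/
theorem norm_setCumulant_subset_le (hX : CumulantCondition μ X 8)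
    (hmean : ∀ t, ∫ w, X t w ∂μ = 0) {T : ℕ} (hT : 1 ≤ T) {ι : Type*} [DecidableEq ι]
    (q : ι → ℤ) (B : Finset ι) (hB : B.Nonempty) (hc : #B ≤ 8) :
    ‖setCumulant (moment μ (fun i => dftInt X T (q i))) B‖ ≤
      cumulantConst μ X * (dftScale T ^ #B * weight T (∑ i ∈ B, q i)) := by
  obtain ⟨n, hn⟩ : ∃ n, #B = n + 1 := ⟨#B - 1, by have := card_pos.2 hB; omega⟩
  let e : Fin (n + 1) ↪ ι := ((finCongr hn).symm.trans B.equivFin.symm).toEmbedding.trans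
    (Function.Embedding.subtype _)
  have he : univ.map e = B := by
    ext x
    simp only [Finset.mem_map, mem_univ, true_and]
    constructor
    · rintro ⟨i, rfl⟩; simp [e]
    · intro hx
      exact ⟨(finCongr hn) (B.equivFin ⟨x, hx⟩), by simp [e]⟩
  have hm : ∀ C : Finset (Fin (n + 1)), moment μ (fun i => dftInt X T (q i)) (C.map e) =
      moment μ (fun i => dftInt X T (q (e i))) C := by
    intro C; simp [moment]
  have hs : ∑ i ∈ B, q i = ∑ i, q (e i) := by
    conv_lhs => rw [← he]
    rw [Finset.sum_map]
  have hw : 0 ≤ dftScale T ^ (n + 1) * weight T (∑ i, q (e i)) :=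
    mul_nonneg (pow_nonneg (dftScale_nonneg T) _) (weight_nonneg _ _)
  rw [hs, hn]
  conv_lhs => rw [← he]
  rw [setCumulant_map e _ (moment_empty μ _)]
  simp only [hm]
  rcases Nat.eq_zero_or_pos n with rfl | h1
  -- The summability condition starts at order two; a cumulant of order one is a mean and vanishes.
  · have : (univ : Finset (Fin (0 + 1))) = {0} := rfl
    rw [this, setCumulant_singleton _ (moment_empty μ _)]
    simp only [moment, Finset.prod_singleton, integral_dftInt hX hmean, norm_zero]
    exact mul_nonneg (zero_le_one.trans one_le_cumulantConst) (by simpa using hw)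
  · refine (norm_setCumulant_le hX hT h1 (by omega) _).trans ?_
    exact mul_le_mul_of_nonneg_right (decay_le_cumulantConst (by omega)) hw

end CumulantBounds

end OrthSample

end

noncomputable section

namespace OrthSample

/-! ### Moments of products of pair forms. -/

section Pairs

variable {Ω : Type*}

/-- The normalised sum of products of two Fourier transforms at a fixed distance. -/
def pairForm (X : ℤ → Ω → ℝ) (T : ℕ) (g : ℕ → ℂ) (ε r : ℤ) (w : Ω) : ℂ :=
  (1 / (T : ℂ)) * ∑ k ∈ Icc 1 T, g k *
    (dftInt X T (ε * (k : ℕ)) w * dftInt X T (-(ε * ((k : ℕ) + r))) w)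

theorem weightedPeriodogram_eq_pairForm (X : ℤ → Ω → ℝ) (T : ℕ) (φ : ℝ → ℂ) (r : ℕ) (w : Ω) :
    weightedPeriodogram X T φ r w = pairForm X T (fun k => φ (freq T k)) 1 r w := by
  rw [weightedPeriodogram, pairForm]
  congr 1
  refine Finset.sum_congr rfl fun k _ => ?_
  rw [dft_freq, dft_freq, conj_dftInt, one_mul, one_mul, mul_assoc]
  push_cast; rfl

theorem conj_pairForm (X : ℤ → Ω → ℝ) (T : ℕ) (g : ℕ → ℂ) (ε r : ℤ) (w : Ω) :
    (starRingEnd ℂ) (pairForm X T g ε r w) =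
      pairForm X T (fun k => (starRingEnd ℂ) (g k)) (-ε) r w := by
  simp only [pairForm, map_mul, map_sum, conj_dftInt, map_div₀, map_one, Complex.conj_natCast]
  congr 1
  refine Finset.sum_congr rfl fun k _ => ?_
  congr 3 <;> ring_nf

theorem prod_pairForm (X : ℤ → Ω → ℝ) (T : ℕ) {n : ℕ} (g : Fin n → ℕ → ℂ) (ε r : Fin n → ℤ)
    (w : Ω) : ∏ i, pairForm X T (g i) (ε i) (r i) w = (1 / (T : ℂ)) ^ n *
      ∑ k ∈ Fintype.piFinset (fun _ : Fin n => Icc 1 T), (∏ i, g i (k i)) *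
        ∏ e : Fin n × Bool, dftInt X T (pairFreq ε r k e) w := by
  simp only [pairForm, Finset.prod_mul_distrib, Finset.prod_const, card_univ, Fintype.card_fin]
  congr 1
  rw [Finset.prod_univ_sum]
  refine Finset.sum_congr rfl fun k _ => ?_
  rw [Finset.prod_mul_distrib, Fintype.prod_prod_type]
  simp [pairFreq]

variable [MeasurableSpace Ω] {μ : Measure Ω} {X : ℤ → Ω → ℝ}

theorem memLp_mul_dftInt (hX : CumulantCondition μ X 8) (T : ℕ) (p q : ℤ) :
    MemLp (fun w => dftInt X T p w * dftInt X T q w) 4 μ := by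
  have : ENNReal.HolderTriple 8 8 4 := ⟨by
    rw [← two_mul, show (8 : ENNReal) = 2 * 4 by norm_num,
      ENNReal.mul_inv (Or.inl (by norm_num)) (Or.inl (by norm_num)), ← mul_assoc,
      ENNReal.mul_inv_cancel (by norm_num) (by norm_num), one_mul]⟩
  exact MemLp.mul' (memLp_dftInt hX T q) (memLp_dftInt hX T p)

theorem memLp_pairForm (hX : CumulantCondition μ X 8) (T : ℕ) (g : ℕ → ℂ) (ε r : ℤ) :
    MemLp (pairForm X T g ε r) 4 μ := by
  unfold pairForm
  refine MemLp.const_mul ?_ _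
  refine memLp_finsetSum (f := fun (k : ℕ) w => g k *
    (dftInt X T (ε * (k : ℕ)) w * dftInt X T (-(ε * ((k : ℕ) + r))) w)) _ fun k _ => ?_
  exact MemLp.const_mul (memLp_mul_dftInt hX T _ _) _

/-- The number of partitions of the elements of `n` pairs. -/
def pairPartitionCount (n : ℕ) : ℝ := Fintype.card (Finpartition (univ : Finset (Fin n × Bool)))

/-- The constant in the moment bounds for `n` pair forms. -/
def pairConst (μ : Measure Ω) (X : ℤ → Ω → ℝ) (n : ℕ) : ℝ :=
  pairPartitionCount n * (3 * cumulantConst μ X ^ 2) ^ n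

theorem pairConst_nonneg (n : ℕ) : 0 ≤ pairConst μ X n := by
  unfold pairConst pairPartitionCount; positivity

variable [IsProbabilityMeasure μ]

theorem integrable_prod_dftInt (hX : CumulantCondition μ X 8) (T : ℕ) {ι : Type*} (B : Finset ι)
    (hB : #B ≤ 8) (q : ι → ℤ) : Integrable (fun w => ∏ e ∈ B, dftInt X T (q e) w) μ :=
  integrable_prod_of_memLp B hB _ fun _ _ => memLp_dftInt hX T _

theorem integral_prod_pairForm (hX : CumulantCondition μ X 8) (T : ℕ) {n : ℕ} (hn : n ≤ 4)
    (g : Fin n → ℕ → ℂ) (ε r : Fin n → ℤ) :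
    ∫ w, ∏ i, pairForm X T (g i) (ε i) (r i) w ∂μ = (1 / (T : ℂ)) ^ n *
      ∑ k ∈ Fintype.piFinset (fun _ : Fin n => Icc 1 T), (∏ i, g i (k i)) *
        moment μ (fun e : Fin n × Bool => dftInt X T (pairFreq ε r k e)) univ := by
  simp only [prod_pairForm]
  rw [integral_const_mul, integral_finsetSum]
  · simp only [integral_const_mul, moment]
  · intro k _
    refine (integrable_prod_dftInt hX T univ ?_ _).const_mul _
    simp; omega

theorem sum_piFinset_two {M : Type*} [AddCommMonoid M] (A : Finset ℕ) (F : (Fin 2 → ℕ) → M) :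
    ∑ k ∈ Fintype.piFinset (fun _ => A), F k = ∑ b ∈ A, ∑ a ∈ A, F ![a, b] := by
  simp only [sum_piFinset_succ, Fintype.piFinset_of_isEmpty, univ_unique, Finset.sum_singleton]
  refine Finset.sum_congr rfl fun b _ => Finset.sum_congr rfl fun a _ => ?_
  congr 1

theorem sum_piFinset_four {M : Type*} [AddCommMonoid M] (A : Finset ℕ) (F : (Fin 4 → ℕ) → M) :
    ∑ k ∈ Fintype.piFinset (fun _ => A), F k =
      ∑ d ∈ A, ∑ c ∈ A, ∑ b ∈ A, ∑ a ∈ A, F ![a, b, c, d] := by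
  simp only [sum_piFinset_succ, Fintype.piFinset_of_isEmpty, univ_unique, Finset.sum_singleton]
  refine Finset.sum_congr rfl fun d _ => Finset.sum_congr rfl fun c _ =>
    Finset.sum_congr rfl fun b _ => Finset.sum_congr rfl fun a _ => ?_
  congr 1

/-- The covariance of two products of two pair forms, through the moments of the transforms. -/
theorem cov_pairForm_eq (hX : CumulantCondition μ X 8) (T : ℕ)
    (g : Fin 4 → ℕ → ℂ) (ε r : Fin 4 → ℤ) :
    ∫ w, ∏ i, pairForm X T (g i) (ε i) (r i) w ∂μ -
      (∫ w, pairForm X T (g 0) (ε 0) (r 0) w * pairForm X T (g 1) (ε 1) (r 1) w ∂μ) *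
      (∫ w, pairForm X T (g 2) (ε 2) (r 2) w * pairForm X T (g 3) (ε 3) (r 3) w ∂μ) =
    (1 / (T : ℂ)) ^ 4 * ∑ k ∈ Fintype.piFinset (fun _ : Fin 4 => Icc 1 T), (∏ i, g i (k i)) *
      (moment μ (fun e : Fin 4 × Bool => dftInt X T (pairFreq ε r k e))
          (({0, 1} : Finset (Fin 4)) ×ˢ univ ∪ ({2, 3} : Finset (Fin 4)) ×ˢ univ) -
        moment μ (fun e : Fin 4 × Bool => dftInt X T (pairFreq ε r k e))
          (({0, 1} : Finset (Fin 4)) ×ˢ univ) *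
        moment μ (fun e : Fin 4 × Bool => dftInt X T (pairFreq ε r k e))
          (({2, 3} : Finset (Fin 4)) ×ˢ univ)) := by
  have hu : (({0, 1} : Finset (Fin 4)) ×ˢ univ ∪ ({2, 3} : Finset (Fin 4)) ×ˢ univ) =
      (univ : Finset (Fin 4 × Bool)) := by decide
  have h01 := integral_prod_pairForm hX T (n := 2) (by norm_num) ![g 0, g 1] ![ε 0, ε 1] ![r 0, r 1]
  have h23 := integral_prod_pairForm hX T (n := 2) (by norm_num) ![g 2, g 3] ![ε 2, ε 3] ![r 2, r 3]
  simp only [Fin.prod_univ_two, Matrix.cons_val_zero, Matrix.cons_val_one] at h01 h23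
  rw [h01, h23, integral_prod_pairForm hX T (n := 4) le_rfl, hu]
  simp only [mul_sub, Finset.sum_sub_distrib]
  congr 1
  rw [sum_piFinset_two, sum_piFinset_two, sum_piFinset_four]
  rw [mul_mul_mul_comm, ← pow_add]
  congr 1
  simp only [Finset.sum_mul, Finset.mul_sum]
  refine Finset.sum_congr rfl fun d _ => Finset.sum_congr rfl fun c _ =>
    Finset.sum_congr rfl fun b _ => Finset.sum_congr rfl fun a _ => ?_
  have m1 : moment μ (fun e : Fin 2 × Bool => dftInt X T
      (pairFreq ![ε 0, ε 1] ![r 0, r 1] ![a, b] e)) univ =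
      moment μ (fun e : Fin 4 × Bool => dftInt X T (pairFreq ε r ![a, b, c, d] e))
          (({0, 1} : Finset (Fin 4)) ×ˢ univ) := by
    unfold moment
    congr 1
  have m2 : moment μ (fun e : Fin 2 × Bool => dftInt X T
      (pairFreq ![ε 2, ε 3] ![r 2, r 3] ![c, d] e)) univ =
      moment μ (fun e : Fin 4 × Bool => dftInt X T (pairFreq ε r ![a, b, c, d] e))
          (({2, 3} : Finset (Fin 4)) ×ˢ univ) := by
    unfold moment
    congr 1
  rw [← m1, ← m2]
  simp only [Fin.prod_univ_four, Matrix.cons_val]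
  ring

/-- The bound for one partition. -/
theorem exists_sum_prod_setCumulant_le (hX : CumulantCondition μ X 8)
    (hmean : ∀ t, ∫ w, X t w ∂μ = 0) {T : ℕ} (hT : 1 ≤ T) {n : ℕ} (hn : n ≤ 4)
    (ε r : Fin n → ℤ) (hε : ∀ i, ε i = 1 ∨ ε i = -1)
    (P : Finpartition (univ : Finset (Fin n × Bool))) :
    ∃ h : Fin n → Finset (Fin n × Bool), (∀ B ∈ P.parts, ∀ e ∈ B, ∀ e' ∈ B, h e.1 = h e'.1) ∧
      ∑ k ∈ Fintype.piFinset (fun _ : Fin n => Icc 1 T), ∏ B ∈ P.parts,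
          ‖setCumulant (moment μ (fun e => dftInt X T (pairFreq ε r k e))) B‖ ≤
        (3 * cumulantConst μ X ^ 2) ^ n *
          ∏ u ∈ univ.image h, weight T (∑ i, if h i = u then ε i * r i else 0) := by
  obtain ⟨h, h1, h2⟩ := exists_sum_prod_weight_partition_le T P ε r hε
  refine ⟨h, h1, ?_⟩
  have hC := one_le_cumulantConst (μ := μ) (X := X)
  have hC0 : 0 ≤ cumulantConst μ X := zero_le_one.trans hC
  have hTpos : (0 : ℝ) < T := by exact_mod_cast hT
  have hcard : #(univ : Finset (Fin n × Bool)) = 2 * n := by simp [mul_comm]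
  -- There are at most `2n` blocks and the constant is at least one, so its power can be taken to be
  -- `2n` for every partition.
  have hP : #P.parts ≤ 2 * n := P.card_parts_le_card.trans hcard.le
  -- The `2n` normalisations give `T^(-n)`, which cancels the `T^n` from contracting `n` edges.
  have hsc : dftScale T ^ (2 * n) ≤ (1 / (T : ℝ)) ^ n := by
    rw [pow_mul]
    refine pow_le_pow_left₀ (sq_nonneg _) ?_ n
    refine (pow_le_pow_left₀ (dftScale_nonneg T) (dftScale_le T) 2).trans ?_
    rw [div_pow, Real.sq_sqrt hTpos.le, one_pow]
  have hW : ∀ k, 0 ≤ ∏ B ∈ P.parts, weight T (∑ e ∈ B, pairFreq ε r k e) := fun k =>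
    Finset.prod_nonneg fun _ _ => weight_nonneg _ _
  have hk : ∀ k, ∏ B ∈ P.parts,
      ‖setCumulant (moment μ (fun e => dftInt X T (pairFreq ε r k e))) B‖ ≤
      cumulantConst μ X ^ (2 * n) * (1 / (T : ℝ)) ^ n *
        ∏ B ∈ P.parts, weight T (∑ e ∈ B, pairFreq ε r k e) := by
    intro k
    refine (Finset.prod_le_prod (fun _ _ => norm_nonneg _) fun B hB =>
      norm_setCumulant_subset_le hX hmean hT (pairFreq ε r k) B (P.nonempty_of_mem_parts hB)
        ((card_le_card (subset_univ B)).trans (by rw [hcard]; omega))).trans ?_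
    rw [Finset.prod_mul_distrib, Finset.prod_mul_distrib, Finset.prod_const, ← mul_assoc,
      Finset.prod_pow_eq_pow_sum, P.sum_card_parts, hcard]
    refine mul_le_mul_of_nonneg_right ?_ (hW k)
    exact mul_le_mul (pow_le_pow_right₀ hC hP) hsc (pow_nonneg (dftScale_nonneg T) _)
      (pow_nonneg hC0 _)
  refine (Finset.sum_le_sum fun k _ => hk k).trans ?_
  rw [← Finset.mul_sum]
  refine (mul_le_mul_of_nonneg_left h2 (by positivity)).trans (le_of_eq ?_)
  rw [← mul_assoc]
  congr 1
  rw [pow_mul, ← mul_pow, ← mul_pow]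
  congr 1
  field_simp

/-- The predicate `p` selects the partitions that matter: all of them for a second moment, those
joining the two halves for a covariance. For each it remains to bound the product of the component
weights. -/
theorem norm_sum_weighted_le (hX : CumulantCondition μ X 8)
    (hmean : ∀ t, ∫ w, X t w ∂μ = 0) {T : ℕ} (hT : 1 ≤ T) {n : ℕ} (hn : n ≤ 4)
    (ε r : Fin n → ℤ) (hε : ∀ i, ε i = 1 ∨ ε i = -1) (g : Fin n → ℕ → ℂ) {G : ℝ}
    (hg : ∀ i, ∀ k ∈ Icc 1 T, ‖g i k‖ ≤ G) (hG : 0 ≤ G) (bound : ℝ) (hb : 0 ≤ bound)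
    (p : Finpartition (univ : Finset (Fin n × Bool)) → Prop) [DecidablePred p]
    (hp : ∀ P, p P → ∀ h : Fin n → Finset (Fin n × Bool),
      (∀ B ∈ P.parts, ∀ e ∈ B, ∀ e' ∈ B, h e.1 = h e'.1) →
      ∏ u ∈ univ.image h, weight T (∑ i, if h i = u then ε i * r i else 0) ≤ bound) :
    ‖(1 / (T : ℂ)) ^ n * ∑ k ∈ Fintype.piFinset (fun _ : Fin n => Icc 1 T), (∏ i, g i (k i)) *
      ∑ P : Finpartition (univ : Finset (Fin n × Bool)), if p P then ∏ B ∈ P.parts,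
        setCumulant (moment μ (fun e => dftInt X T (pairFreq ε r k e))) B else 0‖ ≤
      pairConst μ X n * G ^ n * ((1 / (T : ℝ)) ^ n * bound) := by
  have hTpos : (0 : ℝ) < T := by exact_mod_cast hT
  rw [norm_mul, norm_pow, norm_div, norm_one, Complex.norm_natCast]
  have h1 : ∀ k ∈ Fintype.piFinset (fun _ : Fin n => Icc 1 T), ‖(∏ i, g i (k i)) *
      ∑ P : Finpartition (univ : Finset (Fin n × Bool)), if p P then ∏ B ∈ P.parts,
        setCumulant (moment μ (fun e => dftInt X T (pairFreq ε r k e))) B else 0‖ ≤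
      G ^ n * ∑ P : Finpartition (univ : Finset (Fin n × Bool)), if p P then ∏ B ∈ P.parts,
        ‖setCumulant (moment μ (fun e => dftInt X T (pairFreq ε r k e))) B‖ else 0 := by
    intro k hk
    rw [norm_mul, norm_prod]
    refine mul_le_mul ?_ ?_ (norm_nonneg _) (pow_nonneg hG _)
    · refine (Finset.prod_le_prod (fun _ _ => norm_nonneg _) fun i _ =>
        hg i (k i) (Fintype.mem_piFinset.1 hk i)).trans (by simp)
    · refine (norm_sum_le _ _).trans (Finset.sum_le_sum fun P _ => ?_)
      split_ifs
      · rw [norm_prod]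
      · simp
  have h2 : ∑ k ∈ Fintype.piFinset (fun _ : Fin n => Icc 1 T),
      ∑ P : Finpartition (univ : Finset (Fin n × Bool)), (if p P then ∏ B ∈ P.parts,
        ‖setCumulant (moment μ (fun e => dftInt X T (pairFreq ε r k e))) B‖ else 0) ≤
      pairConst μ X n * bound := by
    rw [Finset.sum_comm]
    refine (Finset.sum_le_card_nsmul univ _ ((3 * cumulantConst μ X ^ 2) ^ n * bound)
      fun P _ => ?_).trans (le_of_eq ?_)
    · by_cases h : p P
      · simp only [h, if_true]
        obtain ⟨f, hf, hle⟩ := exists_sum_prod_setCumulant_le hX hmean hT hn ε r hε P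
        exact hle.trans (mul_le_mul_of_nonneg_left (hp P h f hf) (by positivity))
      · simp only [h, if_false, Finset.sum_const_zero]
        positivity
    · rw [pairConst, pairPartitionCount, nsmul_eq_mul, card_univ]
      ring
  calc _ ≤ (1 / (T : ℝ)) ^ n * (G ^ n * (pairConst μ X n * bound)) := by
        refine mul_le_mul_of_nonneg_left ?_ (by positivity)
        refine (norm_sum_le _ _).trans ((Finset.sum_le_sum h1).trans ?_)
        rw [← Finset.mul_sum]
        exact mul_le_mul_of_nonneg_left h2 (by positivity)
    _ = _ := by ring

/-- The covariance of two squared pair forms. -/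
theorem norm_cov_pairForm_le (hX : CumulantCondition μ X 8)
    (hmean : ∀ t, ∫ w, X t w ∂μ = 0) {T : ℕ} (hT : 1 ≤ T) (g : Fin 4 → ℕ → ℂ) {G : ℝ}
    (hg : ∀ i, ∀ k ∈ Icc 1 T, ‖g i k‖ ≤ G) (hG : 0 ≤ G) (r s : ℤ)
    (hr : ¬ (T : ℤ) ∣ r) (hs : ¬ (T : ℤ) ∣ s) :
    ‖∫ w, ∏ i, pairForm X T (g i) ((![1, -1, 1, -1] : Fin 4 → ℤ) i)
        ((![r, r, s, s] : Fin 4 → ℤ) i) w ∂μ -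
      (∫ w, pairForm X T (g 0) 1 r w * pairForm X T (g 1) (-1) r w ∂μ) *
      (∫ w, pairForm X T (g 2) 1 s w * pairForm X T (g 3) (-1) s w ∂μ)‖ ≤
    pairConst μ X 4 * G ^ 4 * ((1 / (T : ℝ)) ^ 4 *
      (T + 1 : ℝ) ^ (if (T : ℤ) ∣ r - s ∨ (T : ℤ) ∣ r + s then 2 else 1)) := by
  classical
  have h := cov_pairForm_eq hX T g ![1, -1, 1, -1] ![r, r, s, s]
  simp only [Matrix.cons_val] at h
  rw [h]
  have hdisj : Disjoint (({0, 1} : Finset (Fin 4)) ×ˢ (univ : Finset Bool))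
      (({2, 3} : Finset (Fin 4)) ×ˢ (univ : Finset Bool)) := by decide
  simp only [sub_eq_sum_nonsplit _ (moment_empty μ _) _ _ hdisj]
  have hu : (({0, 1} : Finset (Fin 4)) ×ˢ univ ∪ ({2, 3} : Finset (Fin 4)) ×ˢ univ) =
      (univ : Finset (Fin 4 × Bool)) := by decide
  rw [hu]
  refine norm_sum_weighted_le hX hmean hT (n := 4) le_rfl ![1, -1, 1, -1] ![r, r, s, s] ?_ g hg hG
    _ (by positivity) _ ?_
  · intro i; fin_cases i <;> simp
  · rintro P ⟨B, hB, h1, h2⟩ f hf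
    have e : ∀ i : Fin 4, (![1, -1, 1, -1] : Fin 4 → ℤ) i * (![r, r, s, s] : Fin 4 → ℤ) i =
        (![r, -r, s, -s] : Fin 4 → ℤ) i := by
      intro i; fin_cases i <;> simp
    simp only [e]
    refine prod_weight_le T f r s hr hs ?_
    obtain ⟨e1, he1, hn1⟩ := Finset.not_subset.1 h1
    obtain ⟨e2, he2, hn2⟩ := Finset.not_subset.1 h2
    refine ⟨e2.1, e1.1, ?_, ?_, hf B hB e2 he2 e1 he1⟩
    · simp only [Finset.mem_product, mem_univ, and_true, Finset.mem_insert,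
        Finset.mem_singleton] at hn2
      omega
    · simp only [Finset.mem_product, mem_univ, and_true, Finset.mem_insert,
        Finset.mem_singleton] at hn1
      omega

/-- The second moment of a pair form. -/
theorem norm_integral_mul_pairForm_le (hX : CumulantCondition μ X 8)
    (hmean : ∀ t, ∫ w, X t w ∂μ = 0) {T : ℕ} (hT : 1 ≤ T) (g : Fin 2 → ℕ → ℂ) {G : ℝ}
    (hg : ∀ i, ∀ k ∈ Icc 1 T, ‖g i k‖ ≤ G) (hG : 0 ≤ G) (r : ℤ) :
    ‖∫ w, pairForm X T (g 0) 1 r w * pairForm X T (g 1) (-1) r w ∂μ‖ ≤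
    pairConst μ X 2 * G ^ 2 * ((1 / (T : ℝ)) ^ 2 *
      (T + 1 : ℝ) ^ (if (T : ℤ) ∣ r then 2 else 1)) := by
  classical
  have h := integral_prod_pairForm hX T (n := 2) (by norm_num) g ![1, -1] ![r, r]
  simp only [Fin.prod_univ_two, Matrix.cons_val_zero, Matrix.cons_val_one] at h
  rw [h]
  simp only [eq_partitionSum_setCumulant _ (moment_empty μ _), partitionSum]
  have h2 := norm_sum_weighted_le hX hmean hT (n := 2) (by norm_num) ![1, -1] ![r, r]
    (by intro i; fin_cases i <;> simp) g hg hG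
    ((T + 1 : ℝ) ^ (if (T : ℤ) ∣ r then 2 else 1)) (by positivity) (fun _ => True) ?_
  · simpa [Fin.prod_univ_two] using h2
  · intro P _ f _
    have hT1 : (1 : ℝ) ≤ T + 1 := by simp
    -- If the two pairs share a component, it has total shift `r - r = 0` and one weight `T + 1` is
    -- left. Otherwise there are two components with weight `weight T r` each.
    by_cases hf : f 0 = f 1
    · have : univ.image f = {f 0} := by
        ext u; simp [Fin.exists_fin_two, ← hf, eq_comm]
      rw [this, Finset.prod_singleton]
      refine (weight_le _ _).trans ?_
      split_ifs
      · nlinarith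
      · simp
    · have : univ.image f = {f 0, f 1} := by
        ext u; simp [Fin.exists_fin_two, eq_comm]
      rw [this, Finset.prod_pair hf]
      simp only [Fin.sum_univ_two, hf, Ne.symm hf, if_true, if_false, Matrix.cons_val_zero,
        Matrix.cons_val_one, add_zero, zero_add, one_mul, neg_mul, weight_neg]
      split_ifs with hd
      · rw [weight_of_dvd hd, sq]
      · rw [weight_of_not_dvd hd]; simp

end Pairs

end OrthSample

end

noncomputable section

namespace OrthSample

/-! ### Mean and variance of the estimator for a deterministic weight. -/

section VarianceBounds

variable {Ω : Type*}

theorem ofReal_norm_sq_weightedPeriodogram (X : ℤ → Ω → ℝ) (T : ℕ) (φ : ℝ → ℂ) (r : ℕ) (w : Ω) :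
    ((‖weightedPeriodogram X T φ r w‖ ^ 2 : ℝ) : ℂ) =
      pairForm X T (fun k => φ (freq T k)) 1 r w *
        pairForm X T (fun k => (starRingEnd ℂ) (φ (freq T k))) (-1) r w := by
  rw [← conj_pairForm, ← weightedPeriodogram_eq_pairForm, Complex.mul_conj']
  push_cast; rfl

theorem varEstimator_nonneg (X : ℤ → Ω → ℝ) (T M : ℕ) (φ : ℝ → ℂ) (w : Ω) :
    0 ≤ varEstimator X T M φ w := by
  unfold varEstimator; positivity

variable [MeasurableSpace Ω] {μ : Measure Ω} {X : ℤ → Ω → ℝ}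

theorem memLp_weightedPeriodogram (hX : CumulantCondition μ X 8) (T : ℕ) (φ : ℝ → ℂ) (r : ℕ) :
    MemLp (weightedPeriodogram X T φ r) 4 μ := by
  have : weightedPeriodogram X T φ r = pairForm X T (fun k => φ (freq T k)) 1 r :=
    funext (weightedPeriodogram_eq_pairForm X T φ r)
  rw [this]
  exact memLp_pairForm hX T _ _ _

theorem memLp_norm_sq (hX : CumulantCondition μ X 8) (T : ℕ) (φ : ℝ → ℂ) (r : ℕ) :
    MemLp (fun w => ‖weightedPeriodogram X T φ r w‖ ^ 2) 2 μ := by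
  have : ENNReal.HolderTriple 4 4 2 := ⟨by
    rw [← two_mul, show (4 : ENNReal) = 2 * 2 by norm_num,
      ENNReal.mul_inv (Or.inl (by norm_num)) (Or.inl (by norm_num)), ← mul_assoc,
      ENNReal.mul_inv_cancel (by norm_num) (by norm_num), one_mul]⟩
  have h := (memLp_weightedPeriodogram hX T φ r).norm
  have h2 := MemLp.mul' (r := 2) h h
  simpa only [sq] using h2

variable [IsProbabilityMeasure μ]

theorem integrable_norm_sq (hX : CumulantCondition μ X 8) (T : ℕ) (φ : ℝ → ℂ) (r : ℕ) :
    Integrable (fun w => ‖weightedPeriodogram X T φ r w‖ ^ 2) μ :=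
  (memLp_norm_sq hX T φ r).integrable (by norm_num)

/-- For `T ∤ r` the second moment is of order `1/T`; for `T ∣ r` periodicity gives back the shift
`0`, of order one. Both cases are kept because `M` may exceed `T`. -/
theorem integral_norm_sq_le (hX : CumulantCondition μ X 8) (hmean : ∀ t, ∫ w, X t w ∂μ = 0)
    {T : ℕ} (hT : 1 ≤ T) (φ : ℝ → ℂ) {G : ℝ} (hφ : ∀ k ∈ Icc 1 T, ‖φ (freq T k)‖ ≤ G)
    (hG : 0 ≤ G) (r : ℕ) :
    ∫ w, ‖weightedPeriodogram X T φ r w‖ ^ 2 ∂μ ≤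
      pairConst μ X 2 * G ^ 2 * (2 / T + 4 * if T ∣ r then 1 else 0) := by
  have h := norm_integral_mul_pairForm_le hX hmean hT
    ![fun k => φ (freq T k), fun k => (starRingEnd ℂ) (φ (freq T k))] (G := G)
    (by intro i k hk; fin_cases i <;> simpa using hφ k hk) hG r
  simp only [Matrix.cons_val_zero, Matrix.cons_val_one, ← ofReal_norm_sq_weightedPeriodogram,
    Int.natCast_dvd_natCast] at h
  rw [integral_complex_ofReal, Complex.norm_real, Real.norm_eq_abs] at h
  refine (le_abs_self _).trans (h.trans ?_)
  refine mul_le_mul_of_nonneg_left ?_ (mul_nonneg (pairConst_nonneg 2) (sq_nonneg G))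
  have hT' : (1 : ℝ) ≤ T := by exact_mod_cast hT
  have hT0 : (0 : ℝ) < T := by linarith
  have h1 : (T + 1 : ℝ) / T ≤ 2 := by rw [div_le_iff₀ hT0]; linarith
  have h0 : 0 ≤ (T + 1 : ℝ) / T := by positivity
  split_ifs
  · have : (1 / (T : ℝ)) ^ 2 * (T + 1) ^ 2 = ((T + 1) / T) ^ 2 := by field_simp
    rw [this]
    have : 0 ≤ 2 / (T : ℝ) := by positivity
    nlinarith
  · have : (1 / (T : ℝ)) ^ 2 * (T + 1) ^ 1 = ((T + 1) / T) / T := by field_simp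
    rw [this, mul_zero, add_zero]
    gcongr

theorem integrable_varEstimator (hX : CumulantCondition μ X 8) (T M : ℕ) (φ : ℝ → ℂ) :
    Integrable (varEstimator X T M φ) μ := by
  unfold varEstimator
  exact (integrable_finsetSum _ fun r _ => integrable_norm_sq hX T φ r).const_mul _

/-- The variance estimator is bounded in mean, for every number of terms. -/
theorem integral_varEstimator_le (hX : CumulantCondition μ X 8) (hmean : ∀ t, ∫ w, X t w ∂μ = 0)
    {T M : ℕ} (hT : 1 ≤ T) (hM : 1 ≤ M) (φ : ℝ → ℂ) {G : ℝ}
    (hφ : ∀ k ∈ Icc 1 T, ‖φ (freq T k)‖ ≤ G) (hG : 0 ≤ G) :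
    ∫ w, varEstimator X T M φ w ∂μ ≤ 6 * pairConst μ X 2 * G ^ 2 := by
  unfold varEstimator
  rw [integral_const_mul, integral_finsetSum _ fun r _ => integrable_norm_sq hX T φ r]
  have hT0 : (0 : ℝ) < T := by exact_mod_cast hT
  have hM0 : (0 : ℝ) < M := by exact_mod_cast hM
  have hc : 0 ≤ pairConst μ X 2 * G ^ 2 := mul_nonneg (pairConst_nonneg 2) (sq_nonneg G)
  have h1 := Finset.sum_le_sum fun r (_ : r ∈ Icc 1 M) =>
    integral_norm_sq_le hX hmean hT φ hφ hG r
  rw [← Finset.mul_sum, Finset.sum_add_distrib, ← Finset.mul_sum, Finset.sum_boole] at h1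
  -- The exceptional shifts number at most `M/T`, which offsets their second moments being larger by
  -- a factor `T`.
  have h2 : (#{r ∈ Icc 1 M | T ∣ r} : ℝ) ≤ M / T := by
    have : Icc 1 M = Ioc 0 M := by ext; simp [Nat.succ_le_iff]
    rw [this, Nat.Ioc_filter_dvd_card_eq_div]
    exact Nat.cast_div_le
  have h3 : (∑ r ∈ Icc 1 M, 2 / (T : ℝ)) = 2 * (M / T) := by
    simp; ring
  rw [h3] at h1
  have h4 := mul_le_mul_of_nonneg_left (h1.trans (mul_le_mul_of_nonneg_left
    (show _ ≤ 6 * ((M : ℝ) / T) by linarith) hc)) (show 0 ≤ (T : ℝ) / M by positivity)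
  refine h4.trans (le_of_eq ?_)
  field_simp

/-- Because `2 * M < T`, both `|r - s|` and `r + s` are below `T`, so the exceptional case `T ∣ r ±
s` of `norm_cov_pairForm_le` is exactly `r = s`. -/
theorem cov_norm_sq_le (hX : CumulantCondition μ X 8) (hmean : ∀ t, ∫ w, X t w ∂μ = 0)
    {T M : ℕ} (hM : 2 * M < T) (φ : ℝ → ℂ) {G : ℝ}
    (hφ : ∀ k ∈ Icc 1 T, ‖φ (freq T k)‖ ≤ G) (hG : 0 ≤ G) {r s : ℕ} (hr : r ∈ Icc 1 M)
    (hs : s ∈ Icc 1 M) :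
    (T : ℝ) ^ 2 * ProbabilityTheory.covariance (fun w => ‖weightedPeriodogram X T φ r w‖ ^ 2)
      (fun w => ‖weightedPeriodogram X T φ s w‖ ^ 2) μ ≤
      pairConst μ X 4 * G ^ 4 * (2 / T + 4 * if r = s then 1 else 0) := by
  have hT : 1 ≤ T := by omega
  simp only [Finset.mem_Icc] at hr hs
  have hnd : ∀ x : ℕ, 1 ≤ x → x < T → ¬ (T : ℤ) ∣ x := by
    intro x h1 h2 h
    have := Nat.le_of_dvd h1 (Int.natCast_dvd_natCast.1 h)
    omega
  have h := norm_cov_pairForm_le hX hmean hT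
    ![fun k => φ (freq T k), fun k => (starRingEnd ℂ) (φ (freq T k)),
      fun k => φ (freq T k), fun k => (starRingEnd ℂ) (φ (freq T k))] (G := G)
    (by intro i k hk; fin_cases i <;> simpa using hφ k hk) hG r s
    (hnd r hr.1 (by omega)) (hnd s hs.1 (by omega))
  simp only [Fin.prod_univ_four, Matrix.cons_val, ← ofReal_norm_sq_weightedPeriodogram] at h
  have e1 : ∀ w, ((‖weightedPeriodogram X T φ r w‖ ^ 2 : ℝ) : ℂ) *
        pairForm X T (fun k => φ (freq T k)) 1 s w *
        pairForm X T (fun k => (starRingEnd ℂ) (φ (freq T k))) (-1) s w =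
        ((‖weightedPeriodogram X T φ r w‖ ^ 2 * ‖weightedPeriodogram X T φ s w‖ ^ 2 : ℝ) : ℂ) := by
    intro w
    rw [Complex.ofReal_mul, ofReal_norm_sq_weightedPeriodogram X T φ s]
    ring
  have e2 : ((T : ℤ) ∣ (r : ℤ) - s ∨ (T : ℤ) ∣ (r : ℤ) + s) ↔ r = s := by
    constructor
    · rintro (h | h)
      · have := Int.eq_zero_of_abs_lt_dvd h (by rw [abs_lt]; omega)
        omega
      · exact absurd h (by exact_mod_cast hnd (r + s) (by omega) (by omega))
    · rintro rfl; simp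
  simp only [e1, e2] at h
  rw [integral_complex_ofReal, integral_complex_ofReal, integral_complex_ofReal,
    ← Complex.ofReal_mul, ← Complex.ofReal_sub, Complex.norm_real, Real.norm_eq_abs] at h
  have hcov := ProbabilityTheory.covariance_eq_sub (memLp_norm_sq hX T φ r) (memLp_norm_sq hX T φ s)
  rw [hcov]
  have h3 := mul_le_mul_of_nonneg_left ((le_abs_self _).trans h) (sq_nonneg (T : ℝ))
  refine h3.trans ?_
  have hc : 0 ≤ pairConst μ X 4 * G ^ 4 := mul_nonneg (pairConst_nonneg 4) (by positivity)
  rw [mul_left_comm]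
  refine mul_le_mul_of_nonneg_left ?_ hc
  have hT' : (1 : ℝ) ≤ T := by exact_mod_cast hT
  have hT0 : (0 : ℝ) < T := by linarith
  have h1 : (T + 1 : ℝ) / T ≤ 2 := by rw [div_le_iff₀ hT0]; linarith
  have h0 : 0 ≤ (T + 1 : ℝ) / T := by positivity
  split_ifs
  · have : (T : ℝ) ^ 2 * ((1 / (T : ℝ)) ^ 4 * (T + 1) ^ 2) = ((T + 1) / T) ^ 2 := by field_simp
    rw [this]
    have : 0 ≤ 2 / (T : ℝ) := by positivity
    nlinarith
  · have : (T : ℝ) ^ 2 * ((1 / (T : ℝ)) ^ 4 * (T + 1) ^ 1) = ((T + 1) / T) / T := by field_simp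
    rw [this, mul_zero, add_zero]
    gcongr

/-- Up to a common constant, the double sum of covariances has `M²` terms `2/T` and `M` diagonal
terms `4`; division by `M²` leaves `2/T + 4/M`. -/
theorem variance_varEstimator_le (hX : CumulantCondition μ X 8) (hmean : ∀ t, ∫ w, X t w ∂μ = 0)
    {T M : ℕ} (h1 : 1 ≤ M) (hM : 2 * M < T) (φ : ℝ → ℂ) {G : ℝ}
    (hφ : ∀ k ∈ Icc 1 T, ‖φ (freq T k)‖ ≤ G) (hG : 0 ≤ G) :
    ProbabilityTheory.variance (varEstimator X T M φ) μ ≤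
      4 * pairConst μ X 4 * G ^ 4 * (1 / M + 1 / T) := by
  have hT0 : (0 : ℝ) < T := by exact_mod_cast (by omega : 0 < T)
  have hM0 : (0 : ℝ) < M := by exact_mod_cast h1
  have hc : 0 ≤ pairConst μ X 4 * G ^ 4 := mul_nonneg (pairConst_nonneg 4) (by positivity)
  have e1 : varEstimator X T M φ = fun w => ((T : ℝ) / M) *
      (∑ r ∈ Icc 1 M, fun w => ‖weightedPeriodogram X T φ r w‖ ^ 2) w := by
    ext w; simp [varEstimator]
  rw [e1, ProbabilityTheory.variance_const_mul,
    ProbabilityTheory.variance_sum' (fun r _ => memLp_norm_sq hX T φ r)]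
  have e2 : ((T : ℝ) / M) ^ 2 = (1 / M) ^ 2 * T ^ 2 := by field_simp
  rw [e2, mul_assoc, Finset.mul_sum]
  simp only [Finset.mul_sum (Icc 1 M) _ ((T : ℝ) ^ 2)]
  have h2 := Finset.sum_le_sum fun r (hr : r ∈ Icc 1 M) => Finset.sum_le_sum
    fun s (hs : s ∈ Icc 1 M) => cov_norm_sq_le hX hmean hM φ hφ hG hr hs
  refine (mul_le_mul_of_nonneg_left h2 (by positivity)).trans ?_
  simp only [← Finset.mul_sum, Finset.sum_add_distrib, Finset.sum_ite_eq, Finset.sum_const,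
    Nat.card_Icc, Nat.add_sub_cancel, nsmul_eq_mul]
  have h3 : (∑ r ∈ Icc 1 M, if r ∈ Icc 1 M then (1 : ℝ) else 0) = M := by
    rw [Finset.sum_congr rfl (g := fun _ => (1 : ℝ)) (fun r hr => by simp [hr])]
    simp
  rw [h3]
  have h4 : (1 / (M : ℝ)) ^ 2 * (pairConst μ X 4 * G ^ 4 * (M * (M * (2 / T)) + 4 * M)) =
      pairConst μ X 4 * G ^ 4 * (2 / T + 4 / M) := by field_simp
  rw [h4]
  have h5 : 0 ≤ pairConst μ X 4 * G ^ 4 * (2 / T) := mul_nonneg hc (by positivity)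
  calc _ ≤ pairConst μ X 4 * G ^ 4 * (2 / T + 4 / M) + pairConst μ X 4 * G ^ 4 * (2 / T) := by
        linarith
    _ = _ := by ring

end VarianceBounds

end OrthSample

end

noncomputable section

namespace OrthSample

/-! ### Riemann sums over a period. -/

section Riemann

/-- The average of `g` over `{1, …, T}`. -/
def avg (T : ℕ) (g : ℕ → ℂ) : ℂ := (1 / (T : ℂ)) * ∑ k ∈ Icc 1 T, g k

theorem norm_avg_le {T : ℕ} {g : ℕ → ℂ} {B : ℝ} (hB : 0 ≤ B) (h : ∀ k ∈ Icc 1 T, ‖g k‖ ≤ B) :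
    ‖avg T g‖ ≤ B := by
  rw [avg, norm_mul, norm_div, norm_one, Complex.norm_natCast]
  have h1 := (norm_sum_le (Icc 1 T) g).trans (Finset.sum_le_sum h)
  simp only [Finset.sum_const, Nat.card_Icc, Nat.add_sub_cancel, nsmul_eq_mul] at h1
  refine (mul_le_mul_of_nonneg_left h1 (by positivity)).trans ?_
  rcases Nat.eq_zero_or_pos T with rfl | hT
  · simpa using hB
  · have : (0 : ℝ) < T := by exact_mod_cast hT
    apply le_of_eq; field_simp

theorem avg_sub (T : ℕ) (g h : ℕ → ℂ) : avg T (fun k => g k - h k) = avg T g - avg T h := by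
  simp [avg, Finset.sum_sub_distrib, mul_sub]

theorem avg_add (T : ℕ) (g h : ℕ → ℂ) : avg T (fun k => g k + h k) = avg T g + avg T h := by
  simp [avg, Finset.sum_add_distrib, mul_add]

theorem avg_const_mul (T : ℕ) (c : ℂ) (g : ℕ → ℂ) : avg T (fun k => c * g k) = c * avg T g := by
  simp only [avg, ← Finset.mul_sum]; ring

theorem norm_avg_sub_le {T : ℕ} {g h : ℕ → ℂ} {B : ℝ} (hB : 0 ≤ B)
    (H : ∀ k ∈ Icc 1 T, ‖g k - h k‖ ≤ B) : ‖avg T g - avg T h‖ ≤ B := by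
  rw [← avg_sub]; exact norm_avg_le hB H

/-- Bounded by `B` and Lipschitz with constant `L` on `[0, 2π]`. -/
def BoundedLipschitz (g : ℝ → ℂ) (B L : ℝ) : Prop :=
  (∀ x ∈ Set.Icc 0 (2 * Real.pi), ‖g x‖ ≤ B) ∧
    ∀ x ∈ Set.Icc 0 (2 * Real.pi), ∀ y ∈ Set.Icc 0 (2 * Real.pi), ‖g x - g y‖ ≤ L * |x - y|

theorem zero_mem_Icc : (0 : ℝ) ∈ Set.Icc 0 (2 * Real.pi) := ⟨le_rfl, by positivity⟩

theorem BoundedLipschitz.bound_nonneg {g : ℝ → ℂ} {B L : ℝ} (h : BoundedLipschitz g B L) : 0 ≤ B :=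
  (norm_nonneg _).trans (h.1 0 zero_mem_Icc)

theorem BoundedLipschitz.lipschitz_nonneg {g : ℝ → ℂ} {B L : ℝ} (h : BoundedLipschitz g B L) :
    0 ≤ L := by
  have := (norm_nonneg _).trans (h.2 0 zero_mem_Icc (2 * Real.pi) ⟨by positivity, le_rfl⟩)
  have hpi := Real.pi_pos
  rw [zero_sub, abs_neg, abs_of_pos (by positivity)] at this
  exact nonneg_of_mul_nonneg_left this (by positivity)

theorem BoundedLipschitz.mul {g h : ℝ → ℂ} {B L B' L' : ℝ} (hg : BoundedLipschitz g B L)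
    (hh : BoundedLipschitz h B' L') :
    BoundedLipschitz (fun x => g x * h x) (B * B') (B * L' + L * B') := by
  refine ⟨fun x hx => ?_, fun x hx y hy => ?_⟩
  · rw [norm_mul]
    exact mul_le_mul (hg.1 x hx) (hh.1 x hx) (norm_nonneg _) hg.bound_nonneg
  · have e : g x * h x - g y * h y = g x * (h x - h y) + (g x - g y) * h y := by ring
    rw [e]
    refine (norm_add_le _ _).trans ?_
    rw [norm_mul, norm_mul]
    have h1 := mul_le_mul (hg.1 x hx) (hh.2 x hx y hy) (norm_nonneg _) hg.bound_nonneg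
    have h2 := mul_le_mul (hg.2 x hx y hy) (hh.1 y hy) (norm_nonneg _)
      (mul_nonneg hg.lipschitz_nonneg (abs_nonneg _))
    linarith

theorem BoundedLipschitz.conj {g : ℝ → ℂ} {B L : ℝ} (hg : BoundedLipschitz g B L) :
    BoundedLipschitz (fun x => (starRingEnd ℂ) (g x)) B L := by
  refine ⟨fun x hx => by simpa using hg.1 x hx, fun x hx y hy => ?_⟩
  rw [← map_sub, RCLike.norm_conj]
  exact hg.2 x hx y hy

theorem BoundedLipschitz.reflect {g : ℝ → ℂ} {B L : ℝ} (hg : BoundedLipschitz g B L) :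
    BoundedLipschitz (fun x => g (2 * Real.pi - x)) B L := by
  have hmem : ∀ x ∈ Set.Icc 0 (2 * Real.pi), 2 * Real.pi - x ∈ Set.Icc 0 (2 * Real.pi) := by
    intro x hx; exact ⟨by linarith [hx.2], by linarith [hx.1]⟩
  refine ⟨fun x hx => hg.1 _ (hmem x hx), fun x hx y hy => ?_⟩
  refine (hg.2 _ (hmem x hx) _ (hmem y hy)).trans (le_of_eq ?_)
  rw [show 2 * Real.pi - x - (2 * Real.pi - y) = -(x - y) by ring, abs_neg]

theorem BoundedLipschitz.continuousOn {g : ℝ → ℂ} {B L : ℝ} (hg : BoundedLipschitz g B L) :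
    ContinuousOn g (Set.Icc 0 (2 * Real.pi)) := by
  have : LipschitzOnWith ⟨L, hg.lipschitz_nonneg⟩ g (Set.Icc 0 (2 * Real.pi)) := by
    refine LipschitzOnWith.of_dist_le_mul fun x hx y hy => ?_
    rw [dist_eq_norm, Real.dist_eq]
    exact hg.2 x hx y hy
  exact this.continuousOn

/-- The mean over a period. -/
def circleMean (g : ℝ → ℂ) : ℂ := ((1 / (2 * Real.pi) : ℝ) : ℂ) * ∫ x in (0 : ℝ)..(2 * Real.pi), g x

theorem freq_mem {T k : ℕ} (hk : k ≤ T) : freq T k ∈ Set.Icc 0 (2 * Real.pi) := by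
  unfold freq
  refine ⟨by positivity, ?_⟩
  rcases Nat.eq_zero_or_pos T with rfl | hT
  · simp; positivity
  · have h1 : (0 : ℝ) < T := by exact_mod_cast hT
    rw [div_le_iff₀ h1]
    have : (k : ℝ) ≤ T := by exact_mod_cast hk
    exact mul_le_mul_of_nonneg_left this (by positivity)

/-- Right-endpoint rule: on each of the `T` cells of length `2π/T` the integrand deviates from its
endpoint value by at most `2πL/T`. The values at `0` and `2π` need not agree. -/
theorem norm_avg_sub_circleMean_le {g : ℝ → ℂ} {B L : ℝ} (hg : BoundedLipschitz g B L) {T : ℕ}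
    (hT : 1 ≤ T) : ‖avg T (fun k => g (freq T k)) - circleMean g‖ ≤ 2 * Real.pi * L / T := by
  have hT0 : (0 : ℝ) < T := by exact_mod_cast hT
  have hpi := Real.pi_pos
  have hstep : ∀ k, freq T (k + 1) - freq T k = 2 * Real.pi / T := by
    intro k; unfold freq; push_cast; field_simp; ring
  have hint : ∀ k < T, IntervalIntegrable g volume (freq T k) (freq T (k + 1)) := by
    intro k hk
    apply ContinuousOn.intervalIntegrable
    refine hg.continuousOn.mono (fun x hx => ?_)
    rw [Set.uIcc_of_le (by linarith [hstep k, div_pos (mul_pos two_pos hpi) hT0])] at hx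
    exact ⟨(freq_mem hk.le).1.trans hx.1, hx.2.trans (freq_mem (Nat.succ_le_of_lt hk)).2⟩
  have hsum := intervalIntegral.sum_integral_adjacent_intervals (a := freq T) (n := T) hint
  have h0 : freq T 0 = 0 := by simp [freq]
  have hTT : freq T T = 2 * Real.pi := by unfold freq; field_simp
  rw [h0, hTT] at hsum
  have hpiece : ∀ k ∈ range T, ‖((2 * Real.pi / T : ℝ) : ℂ) * g (freq T (k + 1)) -
      ∫ x in freq T k..freq T (k + 1), g x‖ ≤ (L * (2 * Real.pi / T)) * (2 * Real.pi / T) := by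
    intro k hk
    have hk := mem_range.1 hk
    have hle : freq T k ≤ freq T (k + 1) := by
      linarith [hstep k, div_pos (mul_pos two_pos hpi) hT0]
    have e : ((2 * Real.pi / T : ℝ) : ℂ) * g (freq T (k + 1)) =
        ∫ x in freq T k..freq T (k + 1), g (freq T (k + 1)) := by
      rw [intervalIntegral.integral_const, hstep, Complex.real_smul]
    rw [e, ← intervalIntegral.integral_sub intervalIntegrable_const (hint k hk)]
    refine (intervalIntegral.norm_integral_le_of_norm_le_const
      (C := L * (2 * Real.pi / T)) fun x hx => ?_).trans (le_of_eq ?_)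
    · rw [Set.uIoc_of_le hle] at hx
      refine (hg.2 _ (freq_mem (Nat.succ_le_of_lt hk)) x ⟨(freq_mem hk.le).1.trans hx.1.le,
        hx.2.trans (freq_mem (Nat.succ_le_of_lt hk)).2⟩).trans ?_
      refine mul_le_mul_of_nonneg_left ?_ hg.lipschitz_nonneg
      rw [abs_of_nonneg (by linarith [hx.2])]
      linarith [hstep k, hx.1]
    · rw [hstep, abs_of_nonneg (by positivity)]
  have e1 : ∑ k ∈ Icc 1 T, g (freq T k) = ∑ k ∈ range T, g (freq T (k + 1)) := by
    rw [Finset.range_eq_Ico, Finset.sum_Ico_add' (fun k => g (freq T k)) 0 T 1]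
    rfl
  have e2 : avg T (fun k => g (freq T k)) - circleMean g = ((1 / (2 * Real.pi) : ℝ) : ℂ) *
      ∑ k ∈ range T, (((2 * Real.pi / T : ℝ) : ℂ) * g (freq T (k + 1)) -
      ∫ x in freq T k..freq T (k + 1), g x) := by
    rw [Finset.sum_sub_distrib, hsum, ← Finset.mul_sum, avg, e1, circleMean, mul_sub, ← mul_assoc]
    congr 2
    have : (T : ℂ) ≠ 0 := by exact_mod_cast hT0.ne'
    have h2 : (Real.pi : ℂ) ≠ 0 := by exact_mod_cast hpi.ne'
    push_cast
    field_simp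
  rw [e2, norm_mul, Complex.norm_real, Real.norm_of_nonneg (by positivity)]
  refine (mul_le_mul_of_nonneg_left ((norm_sum_le _ _).trans (Finset.sum_le_sum hpiece))
    (by positivity)).trans (le_of_eq ?_)
  simp only [Finset.sum_const, card_range, nsmul_eq_mul]
  field_simp

theorem norm_circleMean_le {g : ℝ → ℂ} {B : ℝ}
    (hg : ∀ x ∈ Set.Icc 0 (2 * Real.pi), ‖g x‖ ≤ B) : ‖circleMean g‖ ≤ B := by
  have hpi := Real.pi_pos
  rw [circleMean, norm_mul, Complex.norm_real, Real.norm_of_nonneg (by positivity)]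
  have h := intervalIntegral.norm_integral_le_of_norm_le_const (a := 0) (b := 2 * Real.pi) (f := g)
    (C := B) (fun x hx => hg x (by
      rw [Set.uIoc_of_le (by positivity)] at hx; exact ⟨hx.1.le, hx.2⟩))
  rw [sub_zero, abs_of_pos (by positivity)] at h
  refine (mul_le_mul_of_nonneg_left h (by positivity)).trans (le_of_eq ?_)
  field_simp

theorem circleMean_sub {g h : ℝ → ℂ} (hg : ContinuousOn g (Set.Icc 0 (2 * Real.pi)))
    (hh : ContinuousOn h (Set.Icc 0 (2 * Real.pi))) :
    circleMean (fun x => g x - h x) = circleMean g - circleMean h := by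
  have hpi := Real.pi_pos
  have hu : Set.uIcc 0 (2 * Real.pi) = Set.Icc 0 (2 * Real.pi) := Set.uIcc_of_le (by positivity)
  rw [circleMean, intervalIntegral.integral_sub, mul_sub, circleMean, circleMean]
  · exact ContinuousOn.intervalIntegrable (by rwa [hu])
  · exact ContinuousOn.intervalIntegrable (by rwa [hu])

/-- Riemann sums in two variables. -/
theorem norm_avg_avg_sub_circleMean_le {h : ℝ → ℝ → ℂ} {B L : ℝ}
    (h1 : ∀ x ∈ Set.Icc 0 (2 * Real.pi), BoundedLipschitz (h x) B L)
    (h2 : ∀ y ∈ Set.Icc 0 (2 * Real.pi), BoundedLipschitz (fun x => h x y) B L) {T : ℕ}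
    (hT : 1 ≤ T) :
    ‖avg T (fun k => avg T (fun l => h (freq T k) (freq T l))) -
      circleMean (fun x => circleMean (h x))‖ ≤ 4 * Real.pi * L / T := by
  have hL := (h1 0 zero_mem_Icc).lipschitz_nonneg
  have hB := (h1 0 zero_mem_Icc).bound_nonneg
  have hpi := Real.pi_pos
  have e1 : ‖avg T (fun k => avg T (fun l => h (freq T k) (freq T l))) -
      avg T (fun k => circleMean (h (freq T k)))‖ ≤ 2 * Real.pi * L / T := by
    refine norm_avg_sub_le (by positivity) fun k hk => ?_
    exact norm_avg_sub_circleMean_le (h1 _ (freq_mem (Finset.mem_Icc.1 hk).2)) hT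
  -- The mean over the second variable inherits the Lipschitz constant in the first, so the
  -- one-variable estimate applies again.
  have hH : BoundedLipschitz (fun x => circleMean (h x)) B L := by
    refine ⟨fun x hx => norm_circleMean_le (h1 x hx).1, fun x hx y hy => ?_⟩
    rw [← circleMean_sub (h1 x hx).continuousOn (h1 y hy).continuousOn]
    exact norm_circleMean_le fun z hz => (h2 z hz).2 x hx y hy
  have e2 := norm_avg_sub_circleMean_le hH hT
  refine (norm_sub_le_norm_sub_add_norm_sub _ (avg T (fun k => circleMean (h (freq T k)))) _).trans
    ((add_le_add e1 e2).trans (le_of_eq ?_))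
  ring

end Riemann

end OrthSample

end

noncomputable section

namespace OrthSample

/-! ### The variance in terms of second moments and fourth cumulants. -/

section LimitVariance

variable {Ω : Type*} [MeasurableSpace Ω]

/-- The series `∑ᵤ κ₂(u) exp(iux)`. -/
def spectrumTwo (μ : Measure Ω) (X : ℤ → Ω → ℝ) (x : ℝ) : ℂ :=
  spectrum (kappa μ X (n := 1)) (fun _ => x)

/-- The series `∑ κ₄(u) exp(i(u₁x + u₂y + u₃z))`. -/
def spectrumFour (μ : Measure Ω) (X : ℤ → Ω → ℝ) (x y z : ℝ) : ℂ :=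
  spectrum (kappa μ X (n := 3)) ![x, y, z]

/-- The joint moment of two Fourier transforms. -/
def momentTwo (μ : Measure Ω) (X : ℤ → Ω → ℝ) (T : ℕ) (a b : ℤ) : ℂ :=
  ∫ w, dftInt X T a w * dftInt X T b w ∂μ

/-- The joint cumulant of four Fourier transforms. -/
def cumulantFour (μ : Measure Ω) (X : ℤ → Ω → ℝ) (T : ℕ) (q : Fin 4 → ℤ) : ℂ :=
  setCumulant (moment μ (fun i => dftInt X T (q i))) univ

variable {μ : Measure Ω} {X : ℤ → Ω → ℝ}

theorem norm_spectrumTwo_le (hX : CumulantCondition μ X 8) (x : ℝ) :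
    ‖spectrumTwo μ X x‖ ≤ cumulantConst μ X :=
  (norm_spectrum_le (summable_kappa hX le_rfl (by norm_num)) _).trans
    (decay_le_cumulantConst (by norm_num))

theorem norm_spectrumTwo_sub_le (hX : CumulantCondition μ X 8) (x y : ℝ) :
    ‖spectrumTwo μ X x - spectrumTwo μ X y‖ ≤ cumulantConst μ X * |x - y| :=
  (norm_spectrum_sub_le (summable_kappa hX le_rfl (by norm_num)) _ _ (fun _ => le_rfl)
    (abs_nonneg _)).trans (mul_le_mul_of_nonneg_right (decay_le_cumulantConst (by norm_num))
      (abs_nonneg _))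

theorem norm_spectrumFour_le (hX : CumulantCondition μ X 8) (x y z : ℝ) :
    ‖spectrumFour μ X x y z‖ ≤ cumulantConst μ X :=
  (norm_spectrum_le (summable_kappa hX (by norm_num) (by norm_num)) _).trans
    (decay_le_cumulantConst (by norm_num))

theorem norm_spectrumFour_sub_le (hX : CumulantCondition μ X 8) {x y z x' y' z' δ : ℝ} (hδ : 0 ≤ δ)
    (h1 : |x - x'| ≤ δ) (h2 : |y - y'| ≤ δ) (h3 : |z - z'| ≤ δ) :
    ‖spectrumFour μ X x y z - spectrumFour μ X x' y' z'‖ ≤ cumulantConst μ X * δ :=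
  (norm_spectrum_sub_le (summable_kappa hX (by norm_num) (by norm_num)) _ _
    (fun j => by fin_cases j <;> simpa) hδ).trans
      (mul_le_mul_of_nonneg_right (decay_le_cumulantConst (by norm_num)) hδ)

theorem dftScale_sq_le {T : ℕ} (hT : 1 ≤ T) : dftScale T ^ 2 ≤ 1 / T := by
  have hT0 : (0 : ℝ) < T := by exact_mod_cast hT
  refine (pow_le_pow_left₀ (dftScale_nonneg T) (dftScale_le T) 2).trans (le_of_eq ?_)
  rw [div_pow, Real.sq_sqrt hT0.le, one_pow]

theorem dftScale_sq_mul {T : ℕ} (hT : 1 ≤ T) : dftScale T ^ 2 * T = 1 / (2 * Real.pi) := by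
  have hT0 : (0 : ℝ) < T := by exact_mod_cast hT
  rw [dftScale_sq]; field_simp

/-- The constant `1 / (2π)`. -/
def invTwoPi : ℝ := 1 / (2 * Real.pi)

theorem invTwoPi_pos : 0 < invTwoPi := by unfold invTwoPi; have := Real.pi_pos; positivity

theorem invTwoPi_le_one : invTwoPi ≤ 1 := by
  unfold invTwoPi
  rw [div_le_one (by have := Real.pi_pos; positivity)]
  linarith [Real.pi_gt_three]

/-- The main term of the second moment. -/
def mainTwo (μ : Measure Ω) (X : ℤ → Ω → ℝ) (T : ℕ) (a b : ℤ) : ℂ :=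
  if (T : ℤ) ∣ a + b then (invTwoPi : ℂ) * spectrumTwo μ X (2 * Real.pi * b / T) else 0

theorem norm_mainTwo_le (hX : CumulantCondition μ X 8) {T : ℕ} (hT : 1 ≤ T) (a b : ℤ) :
    ‖mainTwo μ X T a b‖ ≤ cumulantConst μ X / T * weight T (a + b) := by
  have hT0 : (0 : ℝ) < T := by exact_mod_cast hT
  have hC : 0 ≤ cumulantConst μ X := zero_le_one.trans one_le_cumulantConst
  unfold mainTwo
  split_ifs with h
  · rw [weight_of_dvd h, norm_mul, Complex.norm_real, Real.norm_of_nonneg invTwoPi_pos.le]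
    calc _ ≤ 1 * cumulantConst μ X := mul_le_mul invTwoPi_le_one (norm_spectrumTwo_le hX _)
          (norm_nonneg _) zero_le_one
      _ = cumulantConst μ X / T * T := by field_simp
      _ ≤ _ := mul_le_mul_of_nonneg_left (by linarith) (by positivity)
  · rw [norm_zero]; exact mul_nonneg (by positivity) (weight_nonneg _ _)

variable [IsProbabilityMeasure μ]

theorem setCumulant_pair (hX : CumulantCondition μ X 8) (hmean : ∀ t, ∫ w, X t w ∂μ = 0) (T : ℕ)
    (a b : ℤ) : setCumulant (moment μ (fun i => dftInt X T (![a, b] i))) univ =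
      momentTwo μ X T a b := by
  rw [setCumulant_two _ (moment_empty μ _) (by simp [moment, integral_dftInt hX hmean])]
  simp [moment, momentTwo, Fin.prod_univ_two]

theorem norm_momentTwo_sub_le (hX : CumulantCondition μ X 8) (hmean : ∀ t, ∫ w, X t w ∂μ = 0)
    {T : ℕ} (hT : 1 ≤ T) (a b : ℤ) :
    ‖momentTwo μ X T a b - mainTwo μ X T a b‖ ≤ cumulantConst μ X / T := by
  have h := norm_setCumulant_sub_le hX hT (n := 1) le_rfl (by norm_num) ![a, b]
  rw [setCumulant_pair hX hmean] at h
  have hs : ∑ i, (![a, b] : Fin (1 + 1) → ℤ) i = a + b := Fin.sum_univ_two _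
  rw [hs] at h
  have e : mainTwo μ X T a b = (dftScale T : ℂ) ^ (1 + 1) *
      ((if (T : ℤ) ∣ a + b then (T : ℂ) else 0) *
        spectrum (kappa μ X) (fun j : Fin 1 => 2 * Real.pi * ((![a, b] j.succ : ℤ) : ℝ) / T)) := by
    unfold mainTwo spectrumTwo
    have e0 : (fun j : Fin 1 => 2 * Real.pi * ((![a, b] j.succ : ℤ) : ℝ) / T) =
        fun _ => 2 * Real.pi * b / T := by
      ext j; fin_cases j; rfl
    rw [e0]
    split_ifs
    · rw [← mul_assoc]
      congr 1
      rw [invTwoPi, ← dftScale_sq_mul hT]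
      push_cast; rfl
    · simp
  rw [e]
  refine h.trans ?_
  have h2 := mul_le_mul (dftScale_sq_le hT) (decay_le_cumulantConst (μ := μ) (X := X) (n := 1)
    (by norm_num)) (decay_nonneg _) (by positivity)
  refine h2.trans (le_of_eq ?_)
  ring

theorem norm_momentTwo_le (hX : CumulantCondition μ X 8) (hmean : ∀ t, ∫ w, X t w ∂μ = 0)
    {T : ℕ} (hT : 1 ≤ T) (a b : ℤ) :
    ‖momentTwo μ X T a b‖ ≤ cumulantConst μ X / T * weight T (a + b) := by
  have h := norm_setCumulant_le hX hT (n := 1) le_rfl (by norm_num) ![a, b]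
  rw [setCumulant_pair hX hmean] at h
  have hs : ∑ i, (![a, b] : Fin (1 + 1) → ℤ) i = a + b := Fin.sum_univ_two _
  rw [hs] at h
  have h2 := mul_le_mul (dftScale_sq_le hT) (decay_le_cumulantConst (μ := μ) (X := X) (n := 1)
    (by norm_num)) (decay_nonneg _) (by positivity)
  refine h.trans ?_
  have h3 := mul_le_mul_of_nonneg_right h2 (weight_nonneg T (a + b))
  calc _ = _ := by ring
    _ ≤ _ := h3
    _ = _ := by ring

/-- Products of second moments against their main terms. -/
theorem norm_momentTwo_mul_sub_le (hX : CumulantCondition μ X 8)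
    (hmean : ∀ t, ∫ w, X t w ∂μ = 0) {T : ℕ} (hT : 1 ≤ T) {a b a' b' : ℤ}
    (hab : a' + b' = -(a + b)) :
    ‖momentTwo μ X T a b * momentTwo μ X T a' b' - mainTwo μ X T a b * mainTwo μ X T a' b'‖ ≤
      2 * cumulantConst μ X ^ 2 / T ^ 2 * weight T (a + b) := by
  have hC : 0 ≤ cumulantConst μ X := zero_le_one.trans one_le_cumulantConst
  have e : momentTwo μ X T a b * momentTwo μ X T a' b' - mainTwo μ X T a b * mainTwo μ X T a' b' =
    (momentTwo μ X T a b - mainTwo μ X T a b) * momentTwo μ X T a' b' +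
    mainTwo μ X T a b * (momentTwo μ X T a' b' - mainTwo μ X T a' b') := by ring
  rw [e]
  refine (norm_add_le _ _).trans ?_
  rw [norm_mul, norm_mul]
  have h1 := mul_le_mul (norm_momentTwo_sub_le hX hmean hT a b) (norm_momentTwo_le hX hmean hT a' b')
    (norm_nonneg _) (by positivity)
  have h2 := mul_le_mul (norm_mainTwo_le hX hT a b) (norm_momentTwo_sub_le hX hmean hT a' b')
    (norm_nonneg _) (mul_nonneg (by positivity) (weight_nonneg _ _))
  rw [hab, weight_neg] at h1
  refine (add_le_add h1 h2).trans (le_of_eq ?_)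
  ring

/-- Four normalisations give `(2πT)^(-2)`. At frequencies adding up to zero the sum over times has
main term `T`, so the cumulant is of order `1/T` with boundary error of order `1/T²`; both gain a
factor `T` here. -/
theorem norm_cumulantFour_sub_le (hX : CumulantCondition μ X 8) {T : ℕ} (hT : 1 ≤ T)
    (q : Fin 4 → ℤ) (hq : ∑ i, q i = 0) :
    ‖T * cumulantFour μ X T q - (invTwoPi : ℂ) ^ 2 * spectrumFour μ X (2 * Real.pi * q 1 / T)
      (2 * Real.pi * q 2 / T) (2 * Real.pi * q 3 / T)‖ ≤ cumulantConst μ X / T := by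
  have hT0 : (0 : ℝ) < T := by exact_mod_cast hT
  have h := norm_setCumulant_sub_le hX hT (n := 3) (by norm_num) (by norm_num) q
  rw [hq] at h
  simp only [dvd_zero, if_true] at h
  have e0 : (fun j : Fin 3 => 2 * Real.pi * (q j.succ : ℝ) / T) = ![2 * Real.pi * q 1 / T,
      2 * Real.pi * q 2 / T, 2 * Real.pi * q 3 / T] := by
    ext j; fin_cases j <;> rfl
  rw [e0, ← cumulantFour, ← spectrumFour] at h
  have e1 : (invTwoPi : ℂ) = (dftScale T : ℂ) ^ 2 * T := by
    rw [invTwoPi, ← dftScale_sq_mul hT]; push_cast; rfl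
  have e2 : T * cumulantFour μ X T q - (invTwoPi : ℂ) ^ 2 * spectrumFour μ X (2 * Real.pi * q 1 / T)
      (2 * Real.pi * q 2 / T) (2 * Real.pi * q 3 / T) =
      T * (cumulantFour μ X T q - (dftScale T : ℂ) ^ (3 + 1) * (T * spectrumFour μ X
        (2 * Real.pi * q 1 / T) (2 * Real.pi * q 2 / T) (2 * Real.pi * q 3 / T))) := by
    rw [e1]; ring
  rw [e2, norm_mul, Complex.norm_natCast]
  refine (mul_le_mul_of_nonneg_left h hT0.le).trans ?_
  have h3 : dftScale T ^ (3 + 1) ≤ (1 / (T : ℝ)) ^ 2 := by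
    rw [show 3 + 1 = 2 * 2 by norm_num, pow_mul]
    exact pow_le_pow_left₀ (sq_nonneg _) (dftScale_sq_le hT) 2
  have h4 := mul_le_mul h3 (decay_le_cumulantConst (μ := μ) (X := X) (n := 3)
    (by norm_num)) (decay_nonneg _) (by positivity)
  refine (mul_le_mul_of_nonneg_left h4 hT0.le).trans (le_of_eq ?_)
  field_simp

theorem sum_weight_le (T : ℕ) (a ε : ℤ) (hε : ε = 1 ∨ ε = -1) :
    ∑ k ∈ Icc 1 T, weight T (a + ε * (k : ℕ)) ≤ 2 * T := by
  have h1 : ∀ k : ℕ, weight T (a + ε * k) = 1 + T * if (T : ℤ) ∣ a + ε * k then (1 : ℝ) else 0 := by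
    intro k; unfold weight; split_ifs <;> simp
  simp only [h1, Finset.sum_add_distrib, ← Finset.mul_sum]
  rw [Finset.sum_boole]
  have h2 : (#{k ∈ Icc 1 T | (T : ℤ) ∣ a + ε * (k : ℕ)} : ℝ) ≤ 1 := by
    exact_mod_cast card_filter_dvd_le_one T a ε hε
  have h3 := mul_le_mul_of_nonneg_left h2 (Nat.cast_nonneg (α := ℝ) T)
  have h4 : (∑ k ∈ Icc 1 T, (1 : ℝ)) = T := by simp
  rw [h4]; linarith

theorem integral_pairForm (hX : CumulantCondition μ X 8) (T : ℕ) (g : ℕ → ℂ) (ε r : ℤ) :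
    ∫ w, pairForm X T g ε r w ∂μ =
      avg T (fun k => g k * momentTwo μ X T (ε * k) (-(ε * (k + r)))) := by
  unfold pairForm avg
  rw [integral_const_mul, integral_finsetSum _ fun k _ =>
    ((memLp_mul_dftInt hX T _ _).integrable (by norm_num)).const_mul _]
  simp only [integral_const_mul, momentTwo]

/-- The variance of a weighted periodogram as a sum over moments and cumulants. -/
theorem variance_expansion (hX : CumulantCondition μ X 8) (hmean : ∀ t, ∫ w, X t w ∂μ = 0)
    (T : ℕ) (φ : ℝ → ℂ) (r : ℕ) :
    ((∫ w, ‖weightedPeriodogram X T φ r w‖ ^ 2 ∂μ -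
      ‖∫ w, weightedPeriodogram X T φ r w ∂μ‖ ^ 2 : ℝ) : ℂ) =
    avg T (fun k => avg T (fun l => φ (freq T k) * (starRingEnd ℂ) (φ (freq T l)) *
      (cumulantFour μ X T ![k, -(k + r), -l, l + r] +
        momentTwo μ X T k (-l) * momentTwo μ X T (-(k + r)) (l + r) +
        momentTwo μ X T k (l + r) * momentTwo μ X T (-(k + r)) (-l)))) := by
  have hsq : (‖∫ w, weightedPeriodogram X T φ r w ∂μ‖ : ℂ) ^ 2 =
      (∫ w, pairForm X T (fun k => φ (freq T k)) 1 r w ∂μ) *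
      ∫ w, pairForm X T (fun k => (starRingEnd ℂ) (φ (freq T k))) (-1) r w ∂μ := by
    rw [← Complex.mul_conj', ← integral_conj]
    simp only [weightedPeriodogram_eq_pairForm, conj_pairForm]
  have h2 := integral_prod_pairForm hX T (n := 2) (by norm_num)
    ![fun k => φ (freq T k), fun k => (starRingEnd ℂ) (φ (freq T k))] ![1, -1] ![r, r]
  simp only [Fin.prod_univ_two, Matrix.cons_val_zero, Matrix.cons_val_one,
    ← ofReal_norm_sq_weightedPeriodogram] at h2
  rw [integral_complex_ofReal] at h2
  push_cast
  rw [hsq, integral_pairForm hX, integral_pairForm hX]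
  rw [h2, sum_piFinset_two, Finset.sum_comm]
  simp only [avg]
  rw [mul_mul_mul_comm, ← sq, Finset.sum_mul_sum, ← mul_sub, ← Finset.sum_sub_distrib]
  simp only [← Finset.mul_sum]
  rw [← mul_assoc, ← sq]
  congr 1
  refine Finset.sum_congr rfl fun k _ => ?_
  rw [Finset.mul_sum (Icc 1 T) _ (φ (freq T k) * _), ← Finset.sum_sub_distrib]
  refine Finset.sum_congr rfl fun l _ => ?_
  -- The centred fourth moment is its cumulant plus three products of pair moments. The product that
  -- pairs `{0, 1}` with `{2, 3}` is cancelled by the squared mean.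
  have h4 := setCumulant_four (moment μ (fun i => dftInt X T
      ((![(k : ℤ), -(k + r), -l, l + r] : Fin 4 → ℤ) i))) (moment_empty μ _)
      (fun i => by simp [moment, integral_dftInt hX hmean])
  have hp : ∀ i j : Fin 4, i ≠ j → moment μ (fun i => dftInt X T
      ((![(k : ℤ), -(k + r), -l, l + r] : Fin 4 → ℤ) i)) {i, j} =
      momentTwo μ X T ((![(k : ℤ), -(k + r), -l, l + r] : Fin 4 → ℤ) i)
        ((![(k : ℤ), -(k + r), -l, l + r] : Fin 4 → ℤ) j) := by
    intro i j hij
    simp only [moment, momentTwo, Finset.prod_pair hij]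
  rw [hp 0 1 (by decide), hp 2 3 (by decide), hp 0 2 (by decide), hp 1 3 (by decide),
    hp 0 3 (by decide), hp 1 2 (by decide)] at h4
  simp only [Matrix.cons_val] at h4
  have hm : moment μ (fun e : Fin 2 × Bool => dftInt X T (pairFreq ![1, -1] ![(r : ℤ), r] ![k, l] e))
      univ = moment μ (fun i => dftInt X T
      ((![(k : ℤ), -(k + r), -l, l + r] : Fin 4 → ℤ) i)) univ := by
    unfold moment
    refine integral_congr_ae (ae_of_all _ fun w => ?_)
    dsimp only
    rw [Fintype.prod_prod_type, Fin.prod_univ_two, Fin.prod_univ_four]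
    simp [pairFreq, mul_assoc]
  rw [cumulantFour, h4, hm]
  simp only [Matrix.cons_val_zero, Matrix.cons_val_one, one_mul, neg_mul, neg_neg]
  ring

end LimitVariance

end OrthSample

end

noncomputable section

namespace OrthSample

/-! ### Convergence of the scaled variance, with a rate uniform in the shift. -/

section LimitVarianceRate

variable {Ω : Type*} [MeasurableSpace Ω] {μ : Measure Ω} {X : ℤ → Ω → ℝ}

theorem BoundedLipschitz.const_mul {g : ℝ → ℂ} {B L G : ℝ} (hg : BoundedLipschitz g B L) {c : ℂ}
    (hc : ‖c‖ ≤ G) : BoundedLipschitz (fun x => c * g x) (G * B) (G * L) := by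
  have hG : 0 ≤ G := (norm_nonneg c).trans hc
  refine ⟨fun x hx => ?_, fun x hx y hy => ?_⟩
  · rw [norm_mul]; exact mul_le_mul hc (hg.1 x hx) (norm_nonneg _) hG
  · rw [← mul_sub, norm_mul, mul_assoc]
    exact mul_le_mul hc (hg.2 x hx y hy) (norm_nonneg _) hG

theorem boundedLipschitz_spectrumTwo (hX : CumulantCondition μ X 8) :
    BoundedLipschitz (spectrumTwo μ X) (cumulantConst μ X) (cumulantConst μ X) :=
  ⟨fun x _ => norm_spectrumTwo_le hX x, fun x _ y _ => norm_spectrumTwo_sub_le hX x y⟩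

theorem boundedLipschitz_spectrumTwo_neg (hX : CumulantCondition μ X 8) :
    BoundedLipschitz (fun x => spectrumTwo μ X (-x)) (cumulantConst μ X) (cumulantConst μ X) := by
  refine ⟨fun x _ => norm_spectrumTwo_le hX _, fun x _ y _ => ?_⟩
  refine (norm_spectrumTwo_sub_le hX _ _).trans (le_of_eq ?_)
  rw [show -x - -y = -(x - y) by ring, abs_neg]

variable {φ : ℝ → ℂ} {G L : ℝ}

/-- The fourth-order part of the limiting variance. -/
def limitFour (μ : Measure Ω) (X : ℤ → Ω → ℝ) (φ : ℝ → ℂ) : ℂ :=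
  circleMean fun x => circleMean fun y =>
    φ x * (starRingEnd ℂ) (φ y) * spectrumFour μ X (-x) (-y) y

/-- The first Gaussian part of the limiting variance. -/
def limitDiag (μ : Measure Ω) (X : ℤ → Ω → ℝ) (φ : ℝ → ℂ) : ℂ :=
  circleMean fun x => φ x * ((starRingEnd ℂ) (φ x) * (spectrumTwo μ X (-x) * spectrumTwo μ X x))

/-- The second Gaussian part of the limiting variance. -/
def limitAnti (μ : Measure Ω) (X : ℤ → Ω → ℝ) (φ : ℝ → ℂ) : ℂ :=
  circleMean fun x => φ x * (spectrumTwo μ X (2 * Real.pi - x) *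
    ((starRingEnd ℂ) (φ (2 * Real.pi - x)) * spectrumTwo μ X (-(2 * Real.pi - x))))

theorem abs_shift_le {T : ℕ} (r : ℕ) {a b : ℝ}
    (h : a - b = 2 * Real.pi * r / T ∨ b - a = 2 * Real.pi * r / T ∨ a = b) :
    |a - b| ≤ 2 * Real.pi * r / T := by
  have h0 : (0 : ℝ) ≤ 2 * Real.pi * r / T := by have := Real.pi_pos; positivity
  rcases h with h | h | h
  · rw [h, abs_of_nonneg h0]
  · rw [abs_sub_comm, h, abs_of_nonneg h0]
  · rw [h, sub_self, abs_zero]; exact h0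

variable [IsProbabilityMeasure μ]

/-- Up to `1/T` the scaled cumulant is the spectrum at `(-ω_{k+r}, -ω_l, ω_{l+r})`. Removing the
shift moves each argument by at most `2πr/T`, and what remains is a Riemann sum in two variables. -/
theorem norm_fourth_sub_le (hX : CumulantCondition μ X 8) (hφ : BoundedLipschitz φ G L) {T : ℕ}
    (hT : 1 ≤ T) (r : ℕ) :
    ‖T * avg T (fun k => avg T (fun l => φ (freq T k) * (starRingEnd ℂ) (φ (freq T l)) *
      cumulantFour μ X T ![k, -(k + r), -l, l + r])) - (invTwoPi : ℂ) ^ 2 * limitFour μ X φ‖ ≤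
    (G * G * (cumulantConst μ X * (1 + 2 * Real.pi)) +
      4 * Real.pi * (G * (G * cumulantConst μ X + L * cumulantConst μ X))) * ((r + 1) / T) := by
  have hT0 : (0 : ℝ) < T := by exact_mod_cast hT
  have hC : 0 ≤ cumulantConst μ X := zero_le_one.trans one_le_cumulantConst
  have hG := hφ.bound_nonneg
  have hL := hφ.lipschitz_nonneg
  have hpi := Real.pi_pos
  set C := cumulantConst μ X with hCdef
  have hr0 : (0 : ℝ) ≤ 2 * Real.pi * r / T := by positivity
  have hc2 : ‖(invTwoPi : ℂ) ^ 2‖ ≤ 1 := by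
    rw [norm_pow, Complex.norm_real, Real.norm_of_nonneg invTwoPi_pos.le]
    exact pow_le_one₀ invTwoPi_pos.le invTwoPi_le_one
  -- the Riemann sum
  have hR := norm_avg_avg_sub_circleMean_le
    (h := fun x y => φ x * (starRingEnd ℂ) (φ y) * spectrumFour μ X (-x) (-y) y)
    (B := G * (G * C)) (L := G * (G * C + L * C)) (T := T) (fun x hx => by
      have h4 : BoundedLipschitz (fun y => spectrumFour μ X (-x) (-y) y) C C :=
        ⟨fun y _ => norm_spectrumFour_le hX _ _ _, fun y _ y' _ => norm_spectrumFour_sub_le hX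
          (abs_nonneg (y - y')) (by simp) (le_of_eq (by
            rw [show -y - -y' = -(y - y') by ring, abs_neg])) le_rfl⟩
      have := (hφ.conj.mul h4).const_mul (hφ.1 x hx)
      simpa only [mul_assoc] using this) (fun y hy => by
      have h4 : BoundedLipschitz (fun x => spectrumFour μ X (-x) (-y) y) C C :=
        ⟨fun x _ => norm_spectrumFour_le hX _ _ _, fun x _ x' _ => norm_spectrumFour_sub_le hX
          (abs_nonneg (x - x')) (le_of_eq (by
            rw [show -x - -x' = -(x - x') by ring, abs_neg])) (by simp) (by simp)⟩
      have := (hφ.mul h4).const_mul (hφ.conj.1 y hy)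
      have e : (fun x => φ x * (starRingEnd ℂ) (φ y) * spectrumFour μ X (-x) (-y) y) =
          fun x => (starRingEnd ℂ) (φ y) * (φ x * spectrumFour μ X (-x) (-y) y) := by
        ext x; ring
      rw [e]; exact this) hT
  -- the approximation of the cumulant
  have hA : ‖T * avg T (fun k => avg T (fun l => φ (freq T k) * (starRingEnd ℂ) (φ (freq T l)) *
      cumulantFour μ X T ![k, -(k + r), -l, l + r])) -
      (invTwoPi : ℂ) ^ 2 * avg T (fun k => avg T (fun l => φ (freq T k) *
        (starRingEnd ℂ) (φ (freq T l)) * spectrumFour μ X (-freq T k) (-freq T l) (freq T l)))‖ ≤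
      G * G * (C / T + C * (2 * Real.pi * r / T)) := by
    simp only [← avg_const_mul]
    refine norm_avg_sub_le (by positivity) fun k hk => norm_avg_sub_le (by positivity)
      fun l hl => ?_
    have e : (T : ℂ) * (φ (freq T k) * (starRingEnd ℂ) (φ (freq T l)) *
        cumulantFour μ X T ![k, -(k + r), -l, l + r]) - (invTwoPi : ℂ) ^ 2 * (φ (freq T k) *
        (starRingEnd ℂ) (φ (freq T l)) * spectrumFour μ X (-freq T k) (-freq T l) (freq T l)) =
        φ (freq T k) * (starRingEnd ℂ) (φ (freq T l)) *
        (T * cumulantFour μ X T ![k, -(k + r), -l, l + r] - (invTwoPi : ℂ) ^ 2 *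
          spectrumFour μ X (-freq T k) (-freq T l) (freq T l)) := by ring
    rw [e, norm_mul, norm_mul]
    refine mul_le_mul (mul_le_mul (hφ.1 _ (freq_mem (Finset.mem_Icc.1 hk).2))
      (hφ.conj.1 _ (freq_mem (Finset.mem_Icc.1 hl).2)) (norm_nonneg _) hG) ?_ (norm_nonneg _)
      (by positivity)
    have h1 := norm_cumulantFour_sub_le hX hT ![(k : ℤ), -(k + r), -l, l + r]
      (by rw [Fin.sum_univ_four]; simp only [Matrix.cons_val]; ring)
    simp only [Matrix.cons_val] at h1
    refine (norm_sub_le_norm_sub_add_norm_sub _ _ _).trans (add_le_add h1 ?_)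
    rw [← mul_sub, norm_mul]
    refine (mul_le_mul hc2 (norm_spectrumFour_sub_le hX hr0 (abs_shift_le r (Or.inr (Or.inl ?_)))
      (abs_shift_le r (Or.inr (Or.inr ?_))) (abs_shift_le r (Or.inl ?_))) (norm_nonneg _)
      zero_le_one).trans (le_of_eq (one_mul _))
    · unfold freq; push_cast; ring
    · unfold freq; push_cast; ring
    · unfold freq; push_cast; ring
  have hB := mul_le_mul hc2 hR (norm_nonneg _) zero_le_one
  rw [← norm_mul, mul_sub, one_mul] at hB
  refine (norm_sub_le_norm_sub_add_norm_sub _ _ _).trans ((add_le_add hA hB).trans ?_)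
  have h1 : 0 ≤ G * G * (C * 1) * (r / T) := by positivity
  have h2 : 0 ≤ G * G * (C * (2 * Real.pi)) * (1 / T) := by positivity
  have h3 : 0 ≤ 4 * Real.pi * (G * (G * C + L * C)) * (r / T) := by positivity
  have e : (G * G * (C * (1 + 2 * Real.pi)) + 4 * Real.pi * (G * (G * C + L * C))) * ((r + 1) / T) =
      G * G * (C / T + C * (2 * Real.pi * r / T)) + 4 * Real.pi * (G * (G * C + L * C)) / T +
      (G * G * (C * 1) * (r / T) + G * G * (C * (2 * Real.pi)) * (1 / T) +
        4 * Real.pi * (G * (G * C + L * C)) * (r / T)) := by ring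
  rw [e]
  linarith

theorem mul_avg {T : ℕ} (hT : 1 ≤ T) (g : ℕ → ℂ) : T * avg T g = ∑ k ∈ Icc 1 T, g k := by
  have : (T : ℂ) ≠ 0 := by exact_mod_cast (by omega : T ≠ 0)
  rw [avg, ← mul_assoc, mul_one_div_cancel this, one_mul]

/-- The sum over one index of products of second moments, against the main terms. -/
theorem norm_sum_momentTwo_sub_le (hX : CumulantCondition μ X 8)
    (hmean : ∀ t, ∫ w, X t w ∂μ = 0) (hφ : BoundedLipschitz φ G L) {T : ℕ} (hT : 1 ≤ T)
    {c : ℂ} (hc : ‖c‖ ≤ G) (a b a' b' : ℕ → ℤ) (p ε : ℤ) (hε : ε = 1 ∨ ε = -1)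
    (h1 : ∀ l, a l + b l = p + ε * (l : ℕ)) (h2 : ∀ l, a' l + b' l = -(a l + b l)) :
    ‖∑ l ∈ Icc 1 T, c * (starRingEnd ℂ) (φ (freq T l)) *
        (momentTwo μ X T (a l) (b l) * momentTwo μ X T (a' l) (b' l)) -
      ∑ l ∈ Icc 1 T, c * (starRingEnd ℂ) (φ (freq T l)) *
        (mainTwo μ X T (a l) (b l) * mainTwo μ X T (a' l) (b' l))‖ ≤
      G * G * (4 * cumulantConst μ X ^ 2) / T := by
  have hT0 : (0 : ℝ) < T := by exact_mod_cast hT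
  have hG := hφ.bound_nonneg
  rw [← Finset.sum_sub_distrib]
  have h3 : ∀ l ∈ Icc 1 T, ‖c * (starRingEnd ℂ) (φ (freq T l)) *
        (momentTwo μ X T (a l) (b l) * momentTwo μ X T (a' l) (b' l)) -
      c * (starRingEnd ℂ) (φ (freq T l)) *
        (mainTwo μ X T (a l) (b l) * mainTwo μ X T (a' l) (b' l))‖ ≤
      G * G * (2 * cumulantConst μ X ^ 2 / T ^ 2) * weight T (p + ε * (l : ℕ)) := by
    intro l hl
    rw [← mul_sub, norm_mul, norm_mul, ← h1, mul_assoc (G * G)]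
    exact mul_le_mul (mul_le_mul hc (hφ.conj.1 _ (freq_mem (Finset.mem_Icc.1 hl).2))
      (norm_nonneg _) hG) (norm_momentTwo_mul_sub_le hX hmean hT (h2 l)) (norm_nonneg _)
      (by positivity)
  refine (norm_sum_le _ _).trans ((Finset.sum_le_sum h3).trans ?_)
  rw [← Finset.mul_sum]
  refine (mul_le_mul_of_nonneg_left (sum_weight_le T p ε hε) (by positivity)).trans (le_of_eq ?_)
  field_simp
  ring

/-- The main terms require `T ∣ k - l`, hence `l = k`. The double average collapses to a Riemann sum
in `ω_k`, with one spectrum evaluated at `ω_{k+r}` instead of `ω_k`. -/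
theorem norm_diag_sub_le (hX : CumulantCondition μ X 8) (hmean : ∀ t, ∫ w, X t w ∂μ = 0)
    (hφ : BoundedLipschitz φ G L) {T : ℕ} (hT : 1 ≤ T) (r : ℕ) :
    ‖T * avg T (fun k => avg T (fun l => φ (freq T k) * (starRingEnd ℂ) (φ (freq T l)) *
      (momentTwo μ X T k (-l) * momentTwo μ X T (-(k + r)) (l + r)))) -
      (invTwoPi : ℂ) ^ 2 * limitDiag μ X φ‖ ≤
    (G * G * (4 * cumulantConst μ X ^ 2) + G * G * (cumulantConst μ X ^ 2 * (2 * Real.pi)) +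
      2 * Real.pi * (G * (G * (2 * cumulantConst μ X ^ 2) + L * cumulantConst μ X ^ 2) +
        L * (G * cumulantConst μ X ^ 2))) * ((r + 1) / T) := by
  have hT0 : (0 : ℝ) < T := by exact_mod_cast hT
  have hC : 0 ≤ cumulantConst μ X := zero_le_one.trans one_le_cumulantConst
  have hG := hφ.bound_nonneg
  have hL := hφ.lipschitz_nonneg
  have hpi := Real.pi_pos
  set C := cumulantConst μ X with hCdef
  have hr0 : (0 : ℝ) ≤ 2 * Real.pi * r / T := by positivity
  have hc2 : ‖(invTwoPi : ℂ) ^ 2‖ ≤ 1 := by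
    rw [norm_pow, Complex.norm_real, Real.norm_of_nonneg invTwoPi_pos.le]
    exact pow_le_one₀ invTwoPi_pos.le invTwoPi_le_one
  have hR := norm_avg_sub_circleMean_le (hφ.mul (hφ.conj.mul
    ((boundedLipschitz_spectrumTwo_neg hX).mul (boundedLipschitz_spectrumTwo hX)))) hT
  have hA : ‖T * avg T (fun k => avg T (fun l => φ (freq T k) * (starRingEnd ℂ) (φ (freq T l)) *
      (momentTwo μ X T k (-l) * momentTwo μ X T (-(k + r)) (l + r)))) -
      (invTwoPi : ℂ) ^ 2 * avg T (fun k => φ (freq T k) * ((starRingEnd ℂ) (φ (freq T k)) *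
        (spectrumTwo μ X (-freq T k) * spectrumTwo μ X (freq T k))))‖ ≤
      G * G * (4 * C ^ 2) / T + G * G * (C * (C * (2 * Real.pi * r / T))) := by
    simp only [← avg_const_mul]
    refine norm_avg_sub_le (by positivity) fun k hk => ?_
    have hk' := Finset.mem_Icc.1 hk
    have hφk := hφ.1 _ (freq_mem hk'.2)
    rw [avg_const_mul, mul_avg hT]
    have h1 := norm_sum_momentTwo_sub_le hX hmean hφ hT hφk (fun _ => (k : ℤ)) (fun l => -(l : ℤ))
      (fun _ => -((k : ℤ) + r)) (fun l => l + r) k (-1) (Or.inr rfl) (fun l => by ring)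
      (fun l => by ring)
    refine (norm_sub_le_norm_sub_add_norm_sub _ _ _).trans (add_le_add h1 ?_)
    have hmain : ∑ l ∈ Icc 1 T, φ (freq T k) * (starRingEnd ℂ) (φ (freq T l)) *
        (mainTwo μ X T k (-l) * mainTwo μ X T (-(k + r)) (l + r)) =
        φ (freq T k) * (starRingEnd ℂ) (φ (freq T k)) * ((invTwoPi : ℂ) ^ 2 *
          (spectrumTwo μ X (-freq T k) * spectrumTwo μ X (2 * Real.pi * (k + r : ℕ) / T))) := by
      rw [Finset.sum_eq_single_of_mem k hk]
      · have d1 : (T : ℤ) ∣ (k : ℤ) + -k := by simp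
        have d2 : (T : ℤ) ∣ -((k : ℤ) + r) + (k + r) := by simp
        have e1 : 2 * Real.pi * ((-k : ℤ) : ℝ) / T = -freq T k := by
          unfold freq; push_cast; ring
        have e2 : 2 * Real.pi * (((k : ℤ) + r : ℤ) : ℝ) / T = 2 * Real.pi * (k + r : ℕ) / T := by
          push_cast; ring
        rw [mainTwo, mainTwo, if_pos d1, if_pos d2, e1, e2]
        ring
      · intro l hl hne
        have hl' := Finset.mem_Icc.1 hl
        have : ¬ (T : ℤ) ∣ (k : ℤ) + -l := by
          intro h
          have := Int.eq_zero_of_abs_lt_dvd h (by rw [abs_lt]; omega)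
          omega
        rw [mainTwo, if_neg this]; ring
    rw [hmain]
    have e : φ (freq T k) * (starRingEnd ℂ) (φ (freq T k)) * ((invTwoPi : ℂ) ^ 2 *
          (spectrumTwo μ X (-freq T k) * spectrumTwo μ X (2 * Real.pi * (k + r : ℕ) / T))) -
        (invTwoPi : ℂ) ^ 2 * (φ (freq T k) * ((starRingEnd ℂ) (φ (freq T k)) *
        (spectrumTwo μ X (-freq T k) * spectrumTwo μ X (freq T k)))) =
        (invTwoPi : ℂ) ^ 2 * (φ (freq T k) * (starRingEnd ℂ) (φ (freq T k)) *
          (spectrumTwo μ X (-freq T k) * (spectrumTwo μ X (2 * Real.pi * (k + r : ℕ) / T) -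
            spectrumTwo μ X (freq T k)))) := by ring
    rw [e, norm_mul, norm_mul, norm_mul, norm_mul]
    refine (mul_le_mul hc2 (mul_le_mul (mul_le_mul hφk (hφ.conj.1 _ (freq_mem hk'.2))
      (norm_nonneg _) hG) (mul_le_mul (norm_spectrumTwo_le hX _) ((norm_spectrumTwo_sub_le hX _ _).trans
        (mul_le_mul_of_nonneg_left (abs_shift_le (T := T) r (Or.inl ?_)) hC)) (norm_nonneg _) hC)
        (by positivity) (by positivity)) (by positivity) zero_le_one).trans (le_of_eq (one_mul _))
    unfold freq; push_cast; ring
  have hB := mul_le_mul hc2 hR (norm_nonneg _) zero_le_one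
  rw [← norm_mul, mul_sub, one_mul] at hB
  refine (norm_sub_le_norm_sub_add_norm_sub _ _ _).trans ((add_le_add hA hB).trans ?_)
  have h1 : 0 ≤ G * G * (4 * C ^ 2) * (r / T) := by positivity
  have h2 : 0 ≤ G * G * (C ^ 2 * (2 * Real.pi)) * (1 / T) := by positivity
  have h3 : 0 ≤ 2 * Real.pi * (G * (G * (2 * C ^ 2) + L * C ^ 2) + L * (G * C ^ 2)) * (r / T) := by
    positivity
  refine le_trans (le_add_of_nonneg_right (add_nonneg (add_nonneg h1 h2) h3)) (le_of_eq ?_)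
  ring

/-- The main terms require `T ∣ k + l + r`. If `k + r < T`, then `l = T - k - r`, whose frequency is
within `2πr/T` of `2π - ω_k`. Otherwise `l` wraps around; as `φ` is not assumed periodic, no
comparison is made, but there are at most `r + 1` such `k`, each with error `O(1)`. -/
theorem norm_anti_sub_le (hX : CumulantCondition μ X 8) (hmean : ∀ t, ∫ w, X t w ∂μ = 0)
    (hφ : BoundedLipschitz φ G L) {T : ℕ} (hT : 1 ≤ T) (r : ℕ) (hr : r < T) :
    ‖T * avg T (fun k => avg T (fun l => φ (freq T k) * (starRingEnd ℂ) (φ (freq T l)) *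
      (momentTwo μ X T k (l + r) * momentTwo μ X T (-(k + r)) (-l)))) -
      (invTwoPi : ℂ) ^ 2 * limitAnti μ X φ‖ ≤
    (G * G * (4 * cumulantConst μ X ^ 2) + G * (cumulantConst μ X * ((G * cumulantConst μ X +
      L * cumulantConst μ X) * (2 * Real.pi))) + 2 * (G * G * cumulantConst μ X ^ 2) +
      2 * Real.pi * (G * (cumulantConst μ X * (G * cumulantConst μ X + L * cumulantConst μ X) +
        cumulantConst μ X * (G * cumulantConst μ X)) +
        L * (cumulantConst μ X * (G * cumulantConst μ X)))) * ((r + 1) / T) := by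
  have hT0 : (0 : ℝ) < T := by exact_mod_cast hT
  have hC : 0 ≤ cumulantConst μ X := zero_le_one.trans one_le_cumulantConst
  have hG := hφ.bound_nonneg
  have hL := hφ.lipschitz_nonneg
  have hpi := Real.pi_pos
  set C := cumulantConst μ X with hCdef
  have hr0 : (0 : ℝ) ≤ 2 * Real.pi * r / T := by positivity
  have hc2 : ‖(invTwoPi : ℂ) ^ 2‖ ≤ 1 := by
    rw [norm_pow, Complex.norm_real, Real.norm_of_nonneg invTwoPi_pos.le]
    exact pow_le_one₀ invTwoPi_pos.le invTwoPi_le_one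
  have hu := hφ.conj.mul (boundedLipschitz_spectrumTwo_neg hX)
  have hgl := hφ.mul ((boundedLipschitz_spectrumTwo hX).mul hu).reflect
  have hR := norm_avg_sub_circleMean_le hgl hT
  set target : ℝ → ℂ := fun x => φ x * (spectrumTwo μ X (2 * Real.pi - x) *
    ((starRingEnd ℂ) (φ (2 * Real.pi - x)) * spectrumTwo μ X (-(2 * Real.pi - x)))) with htarget
  set e₁ : ℝ := G * G * (4 * C ^ 2) / T with he₁
  set e₂ : ℝ := G * (C * ((G * C + L * C) * (2 * Real.pi * r / T))) with he₂
  set e₃ : ℝ := 2 * (G * G * C ^ 2) with he₃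
  have he₁0 : 0 ≤ e₁ := by positivity
  have he₂0 : 0 ≤ e₂ := by positivity
  have he₃0 : 0 ≤ e₃ := by positivity
  have hA : ‖T * avg T (fun k => avg T (fun l => φ (freq T k) * (starRingEnd ℂ) (φ (freq T l)) *
      (momentTwo μ X T k (l + r) * momentTwo μ X T (-(k + r)) (-l)))) -
      (invTwoPi : ℂ) ^ 2 * avg T (fun k => target (freq T k))‖ ≤
      e₁ + e₂ + e₃ * ((r + 1) / T) := by
    have hpoint : ∀ k ∈ Icc 1 T, ‖T * avg T (fun l => φ (freq T k) * (starRingEnd ℂ) (φ (freq T l)) *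
        (momentTwo μ X T k (l + r) * momentTwo μ X T (-(k + r)) (-l))) -
        (invTwoPi : ℂ) ^ 2 * target (freq T k)‖ ≤ (e₁ + e₂) + e₃ * if T ≤ k + r then 1 else 0 := by
      intro k hk
      have hk' := Finset.mem_Icc.1 hk
      have hφk := hφ.1 _ (freq_mem hk'.2)
      rw [mul_avg hT, add_assoc]
      have h1 := norm_sum_momentTwo_sub_le hX hmean hφ hT hφk (fun _ => (k : ℤ))
        (fun l => (l : ℤ) + r) (fun _ => -((k : ℤ) + r)) (fun l => -(l : ℤ)) (k + r) 1 (Or.inl rfl)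
        (fun l => by ring) (fun l => by ring)
      refine (norm_sub_le_norm_sub_add_norm_sub _ _ _).trans (add_le_add h1 ?_)
      have htb : ‖(invTwoPi : ℂ) ^ 2 * target (freq T k)‖ ≤ 1 * (G * G * C ^ 2) := by
        rw [norm_mul]
        refine mul_le_mul hc2 ((hgl.1 _ (freq_mem hk'.2)).trans (le_of_eq ?_)) (norm_nonneg _)
          zero_le_one
        ring
      have hterm : ∀ l ∈ Icc 1 T, (T : ℤ) ∣ (k : ℤ) + (l + r) →
          φ (freq T k) * (starRingEnd ℂ) (φ (freq T l)) *
          (mainTwo μ X T k (l + r) * mainTwo μ X T (-(k + r)) (-l)) =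
          (invTwoPi : ℂ) ^ 2 * (φ (freq T k) * (spectrumTwo μ X (2 * Real.pi * (l + r : ℕ) / T) *
            ((starRingEnd ℂ) (φ (freq T l)) * spectrumTwo μ X (-freq T l)))) := by
        intro l hl hd
        have d2 : (T : ℤ) ∣ -((k : ℤ) + r) + -l := by
          rw [← dvd_neg, show -(-((k : ℤ) + r) + -l) = k + (l + r) by ring]; exact hd
        have e1 : 2 * Real.pi * ((-l : ℤ) : ℝ) / T = -freq T l := by
          unfold freq; push_cast; ring
        have e2 : 2 * Real.pi * (((l : ℤ) + r : ℤ) : ℝ) / T = 2 * Real.pi * (l + r : ℕ) / T := by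
          push_cast; ring
        rw [mainTwo, mainTwo, if_pos hd, if_pos d2, e1, e2]
        ring
      have hterm0 : ∀ l : ℕ, ¬ (T : ℤ) ∣ (k : ℤ) + (l + r) →
          φ (freq T k) * (starRingEnd ℂ) (φ (freq T l)) *
          (mainTwo μ X T k (l + r) * mainTwo μ X T (-(k + r)) (-l)) = 0 := by
        intro l hd
        rw [mainTwo, if_neg hd]; ring
      -- In the wrap-around case the sum and its target are bounded separately, each by `G * G * C ^
      -- 2`; this explains the factor `2` in `e₃`.
      by_cases hkr : T ≤ k + r
      · rw [if_pos hkr, mul_one]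
        have hs : ‖∑ l ∈ Icc 1 T, φ (freq T k) * (starRingEnd ℂ) (φ (freq T l)) *
            (mainTwo μ X T k (l + r) * mainTwo μ X T (-(k + r)) (-l))‖ ≤ G * G * C ^ 2 := by
          have hb : ∀ l ∈ Icc 1 T, ‖φ (freq T k) * (starRingEnd ℂ) (φ (freq T l)) *
            (mainTwo μ X T k (l + r) * mainTwo μ X T (-(k + r)) (-l))‖ ≤
            G * G * C ^ 2 * if (T : ℤ) ∣ ((k : ℤ) + r) + 1 * (l : ℕ) then (1 : ℝ) else 0 := by
            intro l hl
            have hiff : (k : ℤ) + (l + r) = ((k : ℤ) + r) + 1 * (l : ℕ) := by ring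
            by_cases hd : (T : ℤ) ∣ (k : ℤ) + (l + r)
            · rw [hterm l hl hd, if_pos (hiff ▸ hd), mul_one]
              simp only [norm_mul]
              rw [norm_mul] at htb
              refine (mul_le_mul hc2 (mul_le_mul hφk (mul_le_mul (norm_spectrumTwo_le hX _)
                (mul_le_mul (hφ.conj.1 _ (freq_mem (Finset.mem_Icc.1 hl).2))
                (norm_spectrumTwo_le hX _) (norm_nonneg _) hG) (by positivity) hC) (by positivity) hG)
                (by positivity) zero_le_one).trans (le_of_eq ?_)
              ring
            · rw [hterm0 l hd, if_neg (hiff ▸ hd)]; simp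
          refine (norm_sum_le _ _).trans ((Finset.sum_le_sum hb).trans ?_)
          rw [← Finset.mul_sum, Finset.sum_boole]
          have h2 : (#{l ∈ Icc 1 T | (T : ℤ) ∣ ((k : ℤ) + r) + 1 * (l : ℕ)} : ℝ) ≤ 1 := by
            simpa only [Nat.cast_one] using
              (Nat.cast_le (α := ℝ)).2 (card_filter_dvd_le_one T ((k : ℤ) + r) 1 (Or.inl rfl))
          exact (mul_le_mul_of_nonneg_left h2 (by positivity)).trans (le_of_eq (mul_one _))
        refine (norm_sub_le _ _).trans ((add_le_add hs htb).trans ?_)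
        rw [he₃]; linarith
      · rw [if_neg hkr, mul_zero, add_zero]
        push Not at hkr
        have hmem : T - k - r ∈ Icc 1 T := Finset.mem_Icc.2 (by omega)
        have hdvd : (T : ℤ) ∣ (k : ℤ) + ((T - k - r : ℕ) + r) := by
          have : (k : ℤ) + ((T - k - r : ℕ) + r) = T := by omega
          rw [this]
        rw [Finset.sum_eq_single_of_mem (T - k - r) hmem, hterm _ hmem hdvd]
        -- The first spectrum is evaluated at `2π - ω_k` exactly, so only the remaining factor, with
        -- Lipschitz bound `hu`, is moved.
        · have e0 : 2 * Real.pi * ((T - k - r + r : ℕ) : ℝ) / T = 2 * Real.pi - freq T k := by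
            have : ((T - k - r + r : ℕ) : ℝ) = T - k := by
              rw [show T - k - r + r = T - k by omega, Nat.cast_sub hk'.2]
            rw [this, freq]; field_simp
          rw [e0, htarget, ← mul_sub, ← mul_sub, ← mul_sub]
          simp only [norm_mul]
          have hrefl : 2 * Real.pi - freq T k ∈ Set.Icc 0 (2 * Real.pi) := by
            have := freq_mem hk'.2
            exact ⟨by linarith [this.2], by linarith [this.1]⟩
          have h3 := (hu.2 _ (freq_mem (Finset.mem_Icc.1 hmem).2) _ hrefl).trans
            (mul_le_mul_of_nonneg_left (abs_shift_le (T := T) r (Or.inr (Or.inl (by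
              have : ((T - k - r : ℕ) : ℝ) = T - k - r := by
                rw [Nat.cast_sub (by omega), Nat.cast_sub hk'.2]
              rw [freq, freq, this]; field_simp; ring)))) hu.lipschitz_nonneg)
          exact (mul_le_mul hc2 (mul_le_mul hφk (mul_le_mul (norm_spectrumTwo_le hX _) h3
            (norm_nonneg _) hC) (by positivity) hG) (by positivity) zero_le_one).trans
            (le_of_eq (one_mul _))
        · intro l hl hne
          refine hterm0 l fun hd => hne ?_
          have hl' := Finset.mem_Icc.1 hl
          have h4 := dvd_sub hd hdvd
          have h5 := Int.eq_zero_of_abs_lt_dvd h4 (by rw [abs_lt]; omega)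
          omega
    have hsum := Finset.sum_le_sum hpoint
    rw [Finset.sum_add_distrib, ← Finset.mul_sum, Finset.sum_boole] at hsum
    have hcount : (#{k ∈ Icc 1 T | T ≤ k + r} : ℝ) ≤ r + 1 := by
      have : {k ∈ Icc 1 T | T ≤ k + r} ⊆ Icc (T - r) T := by
        intro k hk
        simp only [Finset.mem_filter, Finset.mem_Icc] at hk ⊢
        omega
      have h6 := card_le_card this
      rw [Nat.card_Icc] at h6
      exact_mod_cast h6.trans (by omega)
    simp only [← avg_const_mul]
    rw [← avg_sub, avg, norm_mul, norm_div, norm_one, Complex.norm_natCast]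
    have h7 : (∑ k ∈ Icc 1 T, (e₁ + e₂)) = T * (e₁ + e₂) := by simp; ring
    rw [h7] at hsum
    have h8 : ∑ k ∈ Icc 1 T, ‖(T * avg T (fun l => φ (freq T k) * (starRingEnd ℂ) (φ (freq T l)) *
        (momentTwo μ X T k (l + r) * momentTwo μ X T (-(k + r)) (-l))) -
        (invTwoPi : ℂ) ^ 2 * target (freq T k))‖ ≤ T * (e₁ + e₂) + e₃ * (r + 1) :=
      hsum.trans (by linarith [mul_le_mul_of_nonneg_left hcount he₃0])
    simp only [avg_const_mul]
    refine (mul_le_mul_of_nonneg_left ((norm_sum_le _ _).trans h8) (by positivity)).trans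
      (le_of_eq ?_)
    field_simp
  have hB := mul_le_mul hc2 hR (norm_nonneg _) zero_le_one
  rw [← norm_mul, mul_sub, one_mul] at hB
  refine (norm_sub_le_norm_sub_add_norm_sub _ _ _).trans ((add_le_add hA hB).trans ?_)
  have h1 : 0 ≤ G * G * (4 * C ^ 2) * (r / T) := by positivity
  have h2 : 0 ≤ G * (C * ((G * C + L * C) * (2 * Real.pi))) * (1 / T) := by positivity
  have h3 : 0 ≤ 2 * Real.pi * (G * (C * (G * C + L * C) + C * (G * C)) + L * (C * (G * C))) *
      (r / T) := by positivity
  refine le_trans (le_add_of_nonneg_right (add_nonneg (add_nonneg h1 h2) h3)) (le_of_eq ?_)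
  simp only [he₁, he₂, he₃]
  ring

/-- The limit of the scaled variance. -/
def limitVariance (μ : Measure Ω) (X : ℤ → Ω → ℝ) (φ : ℝ → ℂ) : ℂ :=
  (invTwoPi : ℂ) ^ 2 * limitFour μ X φ + (invTwoPi : ℂ) ^ 2 * limitDiag μ X φ +
    (invTwoPi : ℂ) ^ 2 * limitAnti μ X φ

/-- The same `V` serves every shift `r`, including `r = 0`. This is what allows shifted periodograms
to estimate the variance of the unshifted one. -/
theorem exists_variance_rate (hX : CumulantCondition μ X 8) (hmean : ∀ t, ∫ w, X t w ∂μ = 0)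
    (hφ : BoundedLipschitz φ G L) : ∃ V K : ℝ, 0 ≤ K ∧ ∀ T r : ℕ, r < T →
      |T * (∫ w, ‖weightedPeriodogram X T φ r w‖ ^ 2 ∂μ -
        ‖∫ w, weightedPeriodogram X T φ r w ∂μ‖ ^ 2) - V| ≤ K * ((r + 1) / T) := by
  have hC : 0 ≤ cumulantConst μ X := zero_le_one.trans one_le_cumulantConst
  have hG := hφ.bound_nonneg
  have hL := hφ.lipschitz_nonneg
  have hpi := Real.pi_pos
  set C := cumulantConst μ X with hCdef
  -- The limit is assembled as a complex number; the scaled variance is real, so comparing real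
  -- parts loses nothing.
  refine ⟨(limitVariance μ X φ).re,
    (G * G * (C * (1 + 2 * Real.pi)) + 4 * Real.pi * (G * (G * C + L * C))) +
    (G * G * (4 * C ^ 2) + G * G * (C ^ 2 * (2 * Real.pi)) +
      2 * Real.pi * (G * (G * (2 * C ^ 2) + L * C ^ 2) + L * (G * C ^ 2))) +
    (G * G * (4 * C ^ 2) + G * (C * ((G * C + L * C) * (2 * Real.pi))) + 2 * (G * G * C ^ 2) +
      2 * Real.pi * (G * (C * (G * C + L * C) + C * (G * C)) + L * (C * (G * C)))), ?_,
    fun T r hr => ?_⟩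
  rotate_left
  · have hT : 1 ≤ T := by omega
    have e := variance_expansion hX hmean T φ r
    have e2 : ((T * (∫ w, ‖weightedPeriodogram X T φ r w‖ ^ 2 ∂μ -
        ‖∫ w, weightedPeriodogram X T φ r w ∂μ‖ ^ 2) : ℝ) : ℂ) =
        T * avg T (fun k => avg T (fun l => φ (freq T k) * (starRingEnd ℂ) (φ (freq T l)) *
          cumulantFour μ X T ![k, -(k + r), -l, l + r])) +
        T * avg T (fun k => avg T (fun l => φ (freq T k) * (starRingEnd ℂ) (φ (freq T l)) *
          (momentTwo μ X T k (-l) * momentTwo μ X T (-(k + r)) (l + r)))) +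
        T * avg T (fun k => avg T (fun l => φ (freq T k) * (starRingEnd ℂ) (φ (freq T l)) *
          (momentTwo μ X T k (l + r) * momentTwo μ X T (-(k + r)) (-l)))) := by
      rw [Complex.ofReal_mul, e, ← mul_add, ← mul_add]
      simp only [← avg_add, ← mul_add, Complex.ofReal_natCast]
    have h := norm_add₃_le.trans (add_le_add (add_le_add (norm_fourth_sub_le hX hφ hT r)
      (norm_diag_sub_le hX hmean hφ hT r)) (norm_anti_sub_le hX hmean hφ hT r hr))
    have hl : limitVariance μ X φ = (invTwoPi : ℂ) ^ 2 * limitFour μ X φ +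
      (invTwoPi : ℂ) ^ 2 * limitDiag μ X φ + (invTwoPi : ℂ) ^ 2 * limitAnti μ X φ := rfl
    rw [← add_sub_add_comm, ← add_sub_add_comm, ← hl, ← e2, ← add_mul, ← add_mul] at h
    refine le_trans ?_ h
    refine le_trans (le_of_eq ?_) (Complex.abs_re_le_norm _)
    rw [Complex.sub_re, Complex.ofReal_re]
  · positivity

end LimitVarianceRate

end OrthSample

end

noncomputable section

namespace OrthSample

/-! ### Bias and mean absolute error of the estimator. -/

section MeanError

variable {Ω : Type*} [MeasurableSpace Ω] {μ : Measure Ω} {X : ℤ → Ω → ℝ} {φ : ℝ → ℂ} {G L : ℝ}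
  [IsProbabilityMeasure μ]

theorem complexVariance_eq {Z : Ω → ℂ} (hZ : MemLp Z 2 μ) :
    complexVariance μ Z = ∫ w, ‖Z w‖ ^ 2 ∂μ - ‖∫ w, Z w ∂μ‖ ^ 2 := by
  have h1 : Integrable Z μ := hZ.integrable (by norm_num)
  have h2 : Integrable (fun w => ‖Z w‖ ^ 2) μ := hZ.integrable_norm_pow (by norm_num)
  set c := ∫ w, Z w ∂μ with hc
  have h3 : Integrable (fun w => (Z w * (starRingEnd ℂ) c).re) μ := (h1.mul_const _).re
  have e : ∀ w, ‖Z w - c‖ ^ 2 = (‖Z w‖ ^ 2 + ‖c‖ ^ 2) - 2 * (Z w * (starRingEnd ℂ) c).re := by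
    intro w
    simp only [← Complex.normSq_eq_norm_sq, Complex.normSq_sub]
  have h4 : ∫ w, (Z w * (starRingEnd ℂ) c).re ∂μ = ‖c‖ ^ 2 := by
    have h5 := integral_re (𝕜 := ℂ) (h1.mul_const ((starRingEnd ℂ) c))
    simp only [RCLike.re_eq_complex_re] at h5
    rw [h5, integral_mul_const, ← hc, Complex.mul_conj', ← Complex.ofReal_pow, Complex.ofReal_re]
  unfold complexVariance
  simp only [← hc, e]
  have h5 : Integrable (fun w => ‖Z w‖ ^ 2 + ‖c‖ ^ 2) μ := h2.add (integrable_const _)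
  rw [integral_sub h5 (h3.const_mul 2),
    integral_add h2 (integrable_const _), integral_const_mul, h4]
  simp
  ring

/-- The two frequencies in each term add up to `-r`, which `T` does not divide, so each expectation
is of order `1/T`. Hence `T` times the squared mean is `O(1/T)`, and the second moment can stand in
for the variance. -/
theorem norm_integral_weightedPeriodogram_le (hX : CumulantCondition μ X 8)
    (hmean : ∀ t, ∫ w, X t w ∂μ = 0) {T r : ℕ} (hr : 1 ≤ r) (hrT : r < T)
    (hφ : ∀ k ∈ Icc 1 T, ‖φ (freq T k)‖ ≤ G) (hG : 0 ≤ G) :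
    ‖∫ w, weightedPeriodogram X T φ r w ∂μ‖ ≤ G * cumulantConst μ X / T := by
  have hT0 : (0 : ℝ) < T := by exact_mod_cast (by omega : 0 < T)
  have e : ∫ w, weightedPeriodogram X T φ r w ∂μ =
      avg T fun k => φ (freq T k) * momentTwo μ X T (1 * k) (-(1 * (k + r))) := by
    simp only [weightedPeriodogram_eq_pairForm]
    exact integral_pairForm hX T _ 1 r
  have hC : 0 ≤ cumulantConst μ X := zero_le_one.trans one_le_cumulantConst
  rw [e]
  refine norm_avg_le (by positivity) fun k hk => ?_
  rw [norm_mul, mul_div_assoc]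
  refine mul_le_mul (hφ k hk) ((norm_momentTwo_le hX hmean (by omega) _ _).trans (le_of_eq ?_))
    (norm_nonneg _) hG
  rw [show (1 * k + -(1 * (k + r)) : ℤ) = -r by ring, weight_neg, weight_of_not_dvd, mul_one]
  intro h
  have := Nat.le_of_dvd (by omega) (Int.natCast_dvd_natCast.1 h)
  omega

/-- The bias of the variance estimator. -/
theorem exists_bias_rate (hX : CumulantCondition μ X 8) (hmean : ∀ t, ∫ w, X t w ∂μ = 0)
    (hφ : BoundedLipschitz φ G L) : ∃ V K : ℝ, 0 ≤ K ∧
      Tendsto (fun T : ℕ => (T : ℝ) * complexVariance μ (weightedPeriodogram X T φ 0)) atTop (𝓝 V) ∧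
      ∀ T M : ℕ, 1 ≤ M → 2 * M < T → |∫ w, varEstimator X T M φ w ∂μ - V| ≤ K * (M / T) := by
  obtain ⟨V, K, hK, h⟩ := exists_variance_rate hX hmean hφ
  have hC : 0 ≤ cumulantConst μ X := zero_le_one.trans one_le_cumulantConst
  have hG := hφ.bound_nonneg
  refine ⟨V, 2 * K + (G * cumulantConst μ X) ^ 2, by positivity, ?_, fun T M hM hMT => ?_⟩
  · rw [tendsto_iff_dist_tendsto_zero]
    refine squeeze_zero' (Eventually.of_forall fun _ => dist_nonneg)
      (Filter.eventually_atTop.2 ⟨1, fun T hT => ?_⟩)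
      (by simpa using (tendsto_const_nhds (x := K)).mul tendsto_one_div_atTop_nhds_zero_nat)
    rw [Real.dist_eq, complexVariance_eq ((memLp_weightedPeriodogram hX T φ 0).mono_exponent
      (by norm_num))]
    simpa using h T 0 hT
  · have hT0 : (0 : ℝ) < T := by exact_mod_cast (by omega : 0 < T)
    have hM0 : (0 : ℝ) < M := by exact_mod_cast hM
    have hM1 : (1 : ℝ) ≤ M := by exact_mod_cast hM
    have hterm : ∀ r ∈ Icc 1 M, |T * ∫ w, ‖weightedPeriodogram X T φ r w‖ ^ 2 ∂μ - V| ≤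
        (2 * K + (G * cumulantConst μ X) ^ 2) * (M / T) := by
      intro r hr
      have hr' := Finset.mem_Icc.1 hr
      have h1 := h T r (by omega)
      have hrT : r < T := by omega
      have h2 := pow_le_pow_left₀ (norm_nonneg _) (norm_integral_weightedPeriodogram_le hX hmean
        hr'.1 hrT (fun k hk => hφ.1 _ (freq_mem (Finset.mem_Icc.1 hk).2)) hG) 2
      have h3 := mul_le_mul_of_nonneg_left h2 hT0.le
      have e1 : T * (G * cumulantConst μ X / T) ^ 2 = (G * cumulantConst μ X) ^ 2 * (1 / T) := by
        field_simp
      rw [e1] at h3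
      have h4 : (r + 1 : ℝ) / T ≤ 2 * (M / T) := by
        rw [← mul_div_assoc]
        have : (r : ℝ) ≤ M := by exact_mod_cast hr'.2
        gcongr; linarith
      have h5 : (1 : ℝ) / T ≤ M / T := by gcongr
      have h6 := mul_le_mul_of_nonneg_left h4 hK
      have h7 := mul_le_mul_of_nonneg_left h5 (sq_nonneg (G * cumulantConst μ X))
      have h8 : 0 ≤ T * ‖∫ w, weightedPeriodogram X T φ r w ∂μ‖ ^ 2 := by positivity
      rw [abs_le] at h1 ⊢
      constructor <;> nlinarith [h1.1, h1.2]
    have e : ∫ w, varEstimator X T M φ w ∂μ - V = (1 / M) * ∑ r ∈ Icc 1 M,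
        (T * ∫ w, ‖weightedPeriodogram X T φ r w‖ ^ 2 ∂μ - V) := by
      unfold varEstimator
      rw [integral_const_mul, integral_finsetSum _ fun r _ => integrable_norm_sq hX T φ r,
        Finset.sum_sub_distrib, ← Finset.mul_sum]
      simp
      field_simp
    rw [e, abs_mul, abs_of_pos (by positivity)]
    refine (mul_le_mul_of_nonneg_left ((Finset.abs_sum_le_sum_abs _ _).trans
      (Finset.sum_le_sum hterm)) (by positivity)).trans (le_of_eq ?_)
    simp
    field_simp

/-- The mean absolute error of the variance estimator. -/
theorem exists_mean_error_rate (hX : CumulantCondition μ X 8) (hmean : ∀ t, ∫ w, X t w ∂μ = 0)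
    (hφ : BoundedLipschitz φ G L) : ∃ V K : ℝ, 0 ≤ K ∧
      Tendsto (fun T : ℕ => (T : ℝ) * complexVariance μ (weightedPeriodogram X T φ 0)) atTop (𝓝 V) ∧
      ∀ T M : ℕ, 1 ≤ T → 1 ≤ M →
        ∫ w, |varEstimator X T M φ w - V| ∂μ ≤ K * (M / T + 1 / Real.sqrt M) := by
  obtain ⟨V, K, hK, hV, h⟩ := exists_bias_rate hX hmean hφ
  have hG := hφ.bound_nonneg
  have hP2 : 0 ≤ pairConst μ X 2 := pairConst_nonneg 2
  have hP4 : 0 ≤ pairConst μ X 4 := pairConst_nonneg 4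
  have hc2 : 0 ≤ 6 * pairConst μ X 2 * G ^ 2 + |V| :=
    add_nonneg (mul_nonneg (mul_nonneg (by norm_num) hP2) (sq_nonneg G)) (abs_nonneg V)
  have hc4 : 0 ≤ 4 * pairConst μ X 4 * G ^ 4 :=
    mul_nonneg (mul_nonneg (by norm_num) hP4) (pow_nonneg hG 4)
  refine ⟨V, K + (4 * pairConst μ X 4 * G ^ 4 + 1) + 2 * (6 * pairConst μ X 2 * G ^ 2 + |V|),
    by linarith, hV, fun T M hT hM => ?_⟩
  have hT0 : (0 : ℝ) < T := by exact_mod_cast hT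
  have hM0 : (0 : ℝ) < M := by exact_mod_cast hM
  have hφ' : ∀ k ∈ Icc 1 T, ‖φ (freq T k)‖ ≤ G :=
    fun k hk => hφ.1 _ (freq_mem (Finset.mem_Icc.1 hk).2)
  have hint := integrable_varEstimator hX T M φ
  have ha : 0 ≤ (M : ℝ) / T := by positivity
  have hs : 0 < Real.sqrt M := Real.sqrt_pos.2 hM0
  have hb : 0 ≤ 1 / Real.sqrt M := by positivity
  rcases lt_or_ge (2 * M) T with hMT | hMT
  · set m := ∫ w, varEstimator X T M φ w ∂μ with hm
    have hmem : MemLp (varEstimator X T M φ) 2 μ := by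
      unfold varEstimator
      exact (memLp_finsetSum _ fun r _ => memLp_norm_sq hX T φ r).const_mul _
    have hvar := variance_varEstimator_le hX hmean hM hMT φ hφ' hG
    rw [ProbabilityTheory.variance_eq_integral hint.aemeasurable, ← hm] at hvar
    have hsq : Integrable (fun w => (varEstimator X T M φ w - m) ^ 2) μ :=
      (hmem.sub (memLp_const m)).integrable_sq
    -- The inequality `|x| ≤ (√M x² + 1/√M)/2` is tuned to a variance of order `1/M`: both terms
    -- then have mean of order `1/√M`.
    have hpt : ∀ w, |varEstimator X T M φ w - V| ≤
        Real.sqrt M * (1 / 2) * (varEstimator X T M φ w - m) ^ 2 +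
          (1 / Real.sqrt M * (1 / 2) + |m - V|) := by
      intro w
      have h1 := abs_sub_le (varEstimator X T M φ w) m V
      set x := varEstimator X T M φ w - m
      have h2 : |x| ≤ Real.sqrt M * (1 / 2) * x ^ 2 + 1 / Real.sqrt M * (1 / 2) := by
        rw [← sq_abs x]
        have h3 : 0 ≤ (Real.sqrt M * |x| - 1) ^ 2 / Real.sqrt M * (1 / 2) := by positivity
        have h4 : (Real.sqrt M * |x| - 1) ^ 2 / Real.sqrt M * (1 / 2) =
          Real.sqrt M * (1 / 2) * |x| ^ 2 + 1 / Real.sqrt M * (1 / 2) - |x| := by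
          field_simp; ring
        linarith
      linarith
    have h1 : ∫ w, |varEstimator X T M φ w - V| ∂μ ≤ ∫ w, (Real.sqrt M * (1 / 2) *
        (varEstimator X T M φ w - m) ^ 2 + (1 / Real.sqrt M * (1 / 2) + |m - V|)) ∂μ :=
      integral_mono (hint.sub (integrable_const V)).abs
        ((hsq.const_mul _).add (integrable_const _)) hpt
    rw [integral_add (hsq.const_mul _) (integrable_const _), integral_const_mul] at h1
    simp only [integral_const, probReal_univ, one_smul] at h1
    refine h1.trans ?_
    have h2 := h T M hM hMT
    have h3 : (1 / M + 1 / T : ℝ) ≤ 2 / M := by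
      have : (1 : ℝ) / T ≤ 1 / M := by
        have : (M : ℝ) ≤ T := by exact_mod_cast (by omega : M ≤ T)
        gcongr
      have e : (2 : ℝ) / M = 1 / M + 1 / M := by ring
      linarith
    have h4 := mul_le_mul_of_nonneg_left (hvar.trans (mul_le_mul_of_nonneg_left h3 hc4))
      (show 0 ≤ Real.sqrt M * (1 / 2) by positivity)
    have e : Real.sqrt M * (1 / 2) * (4 * pairConst μ X 4 * G ^ 4 * (2 / M)) =
        4 * pairConst μ X 4 * G ^ 4 * (1 / Real.sqrt M) := by
      nth_rewrite 2 [← Real.sq_sqrt hM0.le]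
      field_simp
    rw [e] at h4
    rw [← hm] at h2
    nlinarith [mul_nonneg hK hb, mul_nonneg hc4 ha, mul_nonneg hc2 ha, mul_nonneg hc2 hb]
  -- Here `2M ≥ T`, so `M/T ≥ 1/2`, and boundedness in mean is already the claim.
  · have hpt : ∀ w, |varEstimator X T M φ w - V| ≤ varEstimator X T M φ w + |V| := by
      intro w
      have := abs_sub (varEstimator X T M φ w) V
      rwa [abs_of_nonneg (varEstimator_nonneg X T M φ w)] at this
    have h1 : ∫ w, |varEstimator X T M φ w - V| ∂μ ≤ ∫ w, (varEstimator X T M φ w + |V|) ∂μ :=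
      integral_mono (hint.sub (integrable_const V)).abs (hint.add (integrable_const |V|)) hpt
    rw [integral_add hint (integrable_const _)] at h1
    simp only [integral_const, probReal_univ, one_smul] at h1
    have h2 := integral_varEstimator_le hX hmean hT hM φ hφ' hG
    have h3 : (1 : ℝ) ≤ 2 * (M / T) := by
      rw [← mul_div_assoc, le_div_iff₀ hT0, one_mul]
      exact_mod_cast hMT
    have h4 := mul_le_mul_of_nonneg_left h3 hc2
    nlinarith [mul_nonneg hK hb, mul_nonneg hK ha, mul_nonneg hc4 ha, mul_nonneg hc4 hb,
      mul_nonneg hc2 hb]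

end MeanError

end OrthSample

end

noncomputable section

namespace OrthSample

/-! ### Second-order Taylor remainder. -/

section Taylor

variable {E F : Type*} [NormedAddCommGroup E] [NormedSpace ℝ E] [NormedAddCommGroup F]
  [NormedSpace ℝ F]

/-- The mean value inequality is used twice: for `fderiv ℝ f` on the ball, then for `f` minus its
linear part on the closed ball of radius `‖v‖`. The constant is `K` rather than `K/2`, which is
immaterial. -/
theorem norm_taylor_remainder_le {f : E → F} {x : E} {δ K : ℝ}
    (h1 : ∀ y ∈ Metric.ball x δ, DifferentiableAt ℝ f y)
    (h2 : ∀ y ∈ Metric.ball x δ, DifferentiableAt ℝ (fderiv ℝ f) y)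
    (hK : ∀ y ∈ Metric.ball x δ, ‖fderiv ℝ (fderiv ℝ f) y‖ ≤ K) {v : E} (hv : ‖v‖ < δ) :
    ‖f (x + v) - f x - fderiv ℝ f x v‖ ≤ K * ‖v‖ ^ 2 := by
  have hδ : 0 < δ := (norm_nonneg v).trans_lt hv
  have hx : x ∈ Metric.ball x δ := Metric.mem_ball_self hδ
  have hK0 : 0 ≤ K := (norm_nonneg (fderiv ℝ (fderiv ℝ f) x)).trans (hK x hx)
  have hsub : Metric.closedBall x ‖v‖ ⊆ Metric.ball x δ := Metric.closedBall_subset_ball hv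
  have hlip : ∀ y ∈ Metric.closedBall x ‖v‖, ‖fderiv ℝ f y - fderiv ℝ f x‖ ≤ K * ‖v‖ := by
    intro y hy
    refine ((convex_ball x δ).norm_image_sub_le_of_norm_fderiv_le h2 hK hx (hsub hy)).trans ?_
    exact mul_le_mul_of_nonneg_left (by simpa [dist_eq_norm] using hy) hK0
  have h := (convex_closedBall x ‖v‖).norm_image_sub_le_of_norm_fderiv_le'
    (fun y hy => h1 y (hsub hy)) hlip (Metric.mem_closedBall_self (norm_nonneg v))
    (show x + v ∈ Metric.closedBall x ‖v‖ by simp)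
  rw [add_sub_cancel_left] at h
  exact h.trans (le_of_eq (by ring))

end Taylor

/-! ### Pathwise effect of changing the weight function. -/

section Perturbation

variable {Ω : Type*}

theorem dft_freq_add (X : ℤ → Ω → ℝ) {T : ℕ} (hT : 1 ≤ T) (k : ℕ) (w : Ω) :
    dft X T (freq T (k + T)) w = dft X T (freq T k) w := by
  have hT0 : (T : ℂ) ≠ 0 := by exact_mod_cast (by omega : T ≠ 0)
  unfold dft
  congr 1
  refine Finset.sum_congr rfl fun t _ => ?_
  congr 1
  have e : Complex.I * (t : ℂ) * ((freq T (k + T) : ℝ) : ℂ) =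
      Complex.I * t * (freq T k : ℝ) + t * (2 * Real.pi * Complex.I) := by
    unfold freq; push_cast; field_simp
  rw [e, Complex.exp_add, Complex.exp_nat_mul_two_pi_mul_I, mul_one]

theorem sum_Icc_add_of_periodic {F : ℕ → ℝ} {T : ℕ} (hF : ∀ k, F (k + T) = F k) (r : ℕ) :
    ∑ k ∈ Icc 1 T, F (k + r) = ∑ k ∈ Icc 1 T, F k := by
  induction r with
  | zero => simp
  | succ r ih =>
    rw [← ih]
    have e : ∀ G : ℕ → ℝ, ∑ k ∈ Icc 1 T, G k = ∑ k ∈ range T, G (k + 1) := by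
      intro G
      rw [Finset.range_eq_Ico, Finset.sum_Ico_add' G 0 T 1]
      congr 1
    rw [e, e]
    have h1 := Finset.sum_range_succ (fun k => F (k + 1 + r)) T
    have h2 := Finset.sum_range_succ' (fun k => F (k + 1 + r)) T
    have h3 : F (T + 1 + r) = F (0 + 1 + r) := by
      rw [show T + 1 + r = 0 + 1 + r + T by ring, hF]
    have h4 : ∀ k, F (k + 1 + (r + 1)) = F (k + 1 + 1 + r) := fun k => by
      congr 1; ring
    simp only [h4]
    linarith

/-- By `ab ≤ (a² + b²)/2` and the periodicity of the transform, the shift disappears. The bound is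
pathwise, so it applies to a weight depending on the outcome, such as the Taylor remainder at
`θhat`. -/
theorem norm_weightedPeriodogram_le (X : ℤ → Ω → ℝ) {T : ℕ} (hT : 1 ≤ T) {R : ℝ → ℂ} {ρ : ℝ}
    (hR : ∀ k ∈ Icc 1 T, ‖R (freq T k)‖ ≤ ρ) (r : ℕ) (w : Ω) :
    ‖weightedPeriodogram X T R r w‖ ≤ ρ * ‖weightedPeriodogram X T (fun _ => 1) 0 w‖ := by
  have hρ : 0 ≤ ρ := (norm_nonneg _).trans (hR 1 (Finset.mem_Icc.2 ⟨le_rfl, hT⟩))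
  have e : ‖weightedPeriodogram X T (fun _ => 1) 0 w‖ =
      (1 / T) * ∑ k ∈ Icc 1 T, ‖dft X T (freq T k) w‖ ^ 2 := by
    have : weightedPeriodogram X T (fun _ => 1) 0 w =
        ((1 / T * ∑ k ∈ Icc 1 T, ‖dft X T (freq T k) w‖ ^ 2 : ℝ) : ℂ) := by
      unfold weightedPeriodogram
      simp only [one_mul, add_zero, Complex.mul_conj']
      push_cast; rfl
    rw [this, Complex.norm_real, Real.norm_of_nonneg (by positivity)]
  rw [e]
  unfold weightedPeriodogram
  rw [norm_mul, norm_div, norm_one, Complex.norm_natCast, mul_left_comm]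
  refine mul_le_mul_of_nonneg_left ((norm_sum_le _ _).trans ?_) (by positivity)
  have hs := sum_Icc_add_of_periodic (T := T) (F := fun k => ‖dft X T (freq T k) w‖ ^ 2)
    (fun k => by rw [dft_freq_add X hT]) r
  have h1 : ∀ k ∈ Icc 1 T, ‖R (freq T k) * dft X T (freq T k) w *
      (starRingEnd ℂ) (dft X T (freq T (k + r)) w)‖ ≤
      ρ * (1 / 2) * (‖dft X T (freq T k) w‖ ^ 2 + ‖dft X T (freq T (k + r)) w‖ ^ 2) := by
    intro k hk
    rw [norm_mul, norm_mul, RCLike.norm_conj, mul_assoc, mul_assoc]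
    refine mul_le_mul (hR k hk) ?_ (by positivity) hρ
    nlinarith [sq_nonneg (‖dft X T (freq T k) w‖ - ‖dft X T (freq T (k + r)) w‖)]
  refine (Finset.sum_le_sum h1).trans (le_of_eq ?_)
  rw [← Finset.mul_sum, Finset.sum_add_distrib, hs]
  ring

theorem weightedPeriodogram_sub (X : ℤ → Ω → ℝ) (T : ℕ) (f g : ℝ → ℂ) (r : ℕ) (w : Ω) :
    weightedPeriodogram X T (fun x => f x - g x) r w =
      weightedPeriodogram X T f r w - weightedPeriodogram X T g r w := by
  simp only [weightedPeriodogram, sub_mul, Finset.sum_sub_distrib, mul_sub]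

theorem weightedPeriodogram_sum {ι : Type*} (s : Finset ι) (X : ℤ → Ω → ℝ) (T : ℕ) (c : ι → ℂ)
    (g : ι → ℝ → ℂ) (r : ℕ) (w : Ω) :
    weightedPeriodogram X T (fun x => ∑ j ∈ s, c j * g j x) r w =
      ∑ j ∈ s, c j * weightedPeriodogram X T (g j) r w := by
  simp only [weightedPeriodogram, Finset.sum_mul, Finset.mul_sum]
  rw [Finset.sum_comm]
  refine Finset.sum_congr rfl fun j _ => Finset.sum_congr rfl fun k _ => ?_
  ring

/-- The effect of a small change of the weight function on a weighted periodogram. -/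
theorem norm_weightedPeriodogram_sub_sq_le {d : ℕ} (X : ℤ → Ω → ℝ) {T : ℕ} (hT : 1 ≤ T)
    {f f' : ℝ → ℂ} (g : Fin d → ℝ → ℂ) (c : Fin d → ℂ) {η K : ℝ}
    (hc : ∀ j, ‖c j‖ ≤ η)
    (hR : ∀ k ∈ Icc 1 T, ‖f' (freq T k) - f (freq T k) - ∑ j, c j * g j (freq T k)‖ ≤ K * η ^ 2)
    (r : ℕ) (w : Ω) :
    ‖weightedPeriodogram X T f' r w - weightedPeriodogram X T f r w‖ ^ 2 ≤
      η ^ 2 * (d + 1) * (∑ j, ‖weightedPeriodogram X T (g j) r w‖ ^ 2 +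
        K ^ 2 * η ^ 2 * ‖weightedPeriodogram X T (fun _ => 1) 0 w‖ ^ 2) := by
  have h1 := norm_weightedPeriodogram_le X hT (R := fun x => f' x - f x - ∑ j, c j * g j x) hR r w
  rw [weightedPeriodogram_sub, weightedPeriodogram_sub, weightedPeriodogram_sum] at h1
  set D := weightedPeriodogram X T f' r w - weightedPeriodogram X T f r w
  set S := ‖weightedPeriodogram X T (fun _ => 1) 0 w‖
  have h2 : ‖D‖ ≤ η * (∑ j, ‖weightedPeriodogram X T (g j) r w‖ + K * η * S) := by
    have h3 : ‖∑ j, c j * weightedPeriodogram X T (g j) r w‖ ≤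
        ∑ j, η * ‖weightedPeriodogram X T (g j) r w‖ := by
      refine (norm_sum_le _ _).trans (Finset.sum_le_sum fun j _ => ?_)
      rw [norm_mul]
      exact mul_le_mul_of_nonneg_right (hc j) (norm_nonneg _)
    have h4 := norm_le_norm_sub_add D (∑ j, c j * weightedPeriodogram X T (g j) r w)
    rw [← Finset.mul_sum] at h3
    nlinarith
  have h5 : (∑ j, ‖weightedPeriodogram X T (g j) r w‖ + K * η * S) ^ 2 ≤
      (d + 1) * (∑ j, ‖weightedPeriodogram X T (g j) r w‖ ^ 2 + (K * η * S) ^ 2) := by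
    -- Cauchy–Schwarz over `Option (Fin d)`: the `d` linear terms and the remainder as an additional
    -- one.
    have h6 := sq_sum_le_card_mul_sum_sq (s := (univ : Finset (Option (Fin d))))
      (f := fun o => o.elim (K * η * S) fun j => ‖weightedPeriodogram X T (g j) r w‖)
    simp only [Fintype.sum_option, Option.elim, card_univ, Fintype.card_option,
      Fintype.card_fin] at h6
    push_cast at h6
    rw [add_comm (K * η * S), add_comm ((K * η * S) ^ 2)] at h6
    exact h6
  refine (pow_le_pow_left₀ (norm_nonneg _) h2 2).trans ?_
  rw [mul_pow]
  refine (mul_le_mul_of_nonneg_left h5 (sq_nonneg η)).trans (le_of_eq ?_)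
  ring

/-- The effect of a small change of the weight function on the variance estimator. -/
theorem abs_varEstimator_sub_le {d : ℕ} (X : ℤ → Ω → ℝ) {T M : ℕ} (hT : 1 ≤ T) (hM : 1 ≤ M)
    {f f' : ℝ → ℂ} (g : Fin d → ℝ → ℂ) (c : Fin d → ℂ) {B K : ℝ}
    (hc : ∀ j, ‖c j‖ ≤ B / Real.sqrt T)
    (hR : ∀ k ∈ Icc 1 T, ‖f' (freq T k) - f (freq T k) - ∑ j, c j * g j (freq T k)‖ ≤
      K * (B / Real.sqrt T) ^ 2) (w : Ω) :
    |varEstimator X T M f' w - varEstimator X T M f w| ≤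
      1 / Real.sqrt T * (varEstimator X T M f w + 2 * (B ^ 2 * (d + 1)) *
        (∑ j, varEstimator X T M (g j) w +
          K ^ 2 * B ^ 2 * ‖weightedPeriodogram X T (fun _ => 1) 0 w‖ ^ 2)) := by
  have hT0 : (0 : ℝ) < T := by exact_mod_cast hT
  have hT1 : (1 : ℝ) ≤ T := by exact_mod_cast hT
  have hM0 : (0 : ℝ) < M := by exact_mod_cast hM
  set S := ‖weightedPeriodogram X T (fun _ => 1) 0 w‖ with hS
  set s := Real.sqrt T with hs
  have hs0 : 0 < s := Real.sqrt_pos.2 hT0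
  have hs1 : 1 ≤ s := Real.one_le_sqrt.2 hT1
  have hsq : s ^ 2 = T := Real.sq_sqrt hT0.le
  set a : ℕ → ℂ := fun r => weightedPeriodogram X T f r w
  set b : ℕ → ℂ := fun r => weightedPeriodogram X T f' r w - weightedPeriodogram X T f r w with hb
  have hterm : ∀ r ∈ Icc 1 M, |‖weightedPeriodogram X T f' r w‖ ^ 2 - ‖a r‖ ^ 2| ≤
      1 / s * (‖a r‖ ^ 2 + 2 * (B ^ 2 * (d + 1)) *
        (∑ j, ‖weightedPeriodogram X T (g j) r w‖ ^ 2 + K ^ 2 * B ^ 2 * (1 / T) * S ^ 2)) := by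
    intro r _
    have h1 := norm_weightedPeriodogram_sub_sq_le X hT g c hc hR r w
    rw [div_pow, hsq] at h1
    change ‖b r‖ ^ 2 ≤ _ at h1
    have e : weightedPeriodogram X T f' r w = a r + b r := by simp [a, b]
    rw [e]
    have h2 : |‖a r + b r‖ ^ 2 - ‖a r‖ ^ 2| ≤ 2 * ‖a r‖ * ‖b r‖ + ‖b r‖ ^ 2 := by
      have h3 : |‖a r + b r‖ - ‖a r‖| ≤ ‖b r‖ := by
        have := abs_norm_sub_norm_le (a r + b r) (a r)
        rwa [add_sub_cancel_left] at this
      have h4 := norm_add_le (a r) (b r)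
      have e2 : ‖a r + b r‖ ^ 2 - ‖a r‖ ^ 2 =
        (‖a r + b r‖ - ‖a r‖) * (‖a r + b r‖ + ‖a r‖) := by ring
      rw [e2, abs_mul, abs_of_nonneg (add_nonneg (norm_nonneg (a r + b r)) (norm_nonneg (a r)))]
      refine (mul_le_mul h3 (show _ ≤ 2 * ‖a r‖ + ‖b r‖ by linarith) (by positivity)
        (norm_nonneg _)).trans (le_of_eq (by ring))
    -- Young's inequality with parameter `s = √T`, together with `1 ≤ s`. As `‖b r‖²` carries a
    -- factor `1/T`, both terms come out with a factor `1/s`.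
    have h5 : 2 * ‖a r‖ * ‖b r‖ + ‖b r‖ ^ 2 ≤ 1 / s * ‖a r‖ ^ 2 + 2 * s * ‖b r‖ ^ 2 := by
      have h6 : 0 ≤ 1 / s * (‖a r‖ - s * ‖b r‖) ^ 2 := by positivity
      have h7 : 1 / s * (‖a r‖ - s * ‖b r‖) ^ 2 =
          1 / s * ‖a r‖ ^ 2 - 2 * ‖a r‖ * ‖b r‖ + s * ‖b r‖ ^ 2 := by field_simp; ring
      nlinarith [sq_nonneg ‖b r‖]
    refine h2.trans (h5.trans ?_)
    have h8 := mul_le_mul_of_nonneg_left h1 (show 0 ≤ 2 * s by positivity)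
    rw [mul_add]
    refine add_le_add le_rfl (h8.trans (le_of_eq ?_))
    rw [← hsq, ← hS]
    field_simp
  have e1 : varEstimator X T M f' w - varEstimator X T M f w = (T / M) * ∑ r ∈ Icc 1 M,
      (‖weightedPeriodogram X T f' r w‖ ^ 2 - ‖a r‖ ^ 2) := by
    rw [varEstimator, varEstimator, Finset.sum_sub_distrib, mul_sub]
  rw [e1, abs_mul, abs_of_pos (by positivity)]
  refine (mul_le_mul_of_nonneg_left ((Finset.abs_sum_le_sum_abs _ _).trans
    (Finset.sum_le_sum hterm)) (by positivity)).trans (le_of_eq ?_)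
  rw [← Finset.mul_sum, Finset.sum_add_distrib, ← Finset.mul_sum, Finset.sum_add_distrib,
    Finset.sum_comm]
  simp only [varEstimator, ← Finset.mul_sum, Finset.sum_const, Nat.card_Icc, Nat.add_sub_cancel,
    nsmul_eq_mul]
  field_simp
  ring

end Perturbation

end OrthSample

end

noncomputable section

namespace OrthSample

/-! ### Plugging in the estimated parameter. -/

section PlugIn

theorem boundedLipschitz_of_derivWithin {f : ℝ → ℂ} {K : ℝ}
    (hf : DifferentiableOn ℝ f (Set.Icc 0 (2 * Real.pi)))
    (hK : ∀ x ∈ Set.Icc 0 (2 * Real.pi), ‖derivWithin f (Set.Icc 0 (2 * Real.pi)) x‖ ≤ K) :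
    BoundedLipschitz f (‖f 0‖ + K * (2 * Real.pi)) K := by
  have hK0 : 0 ≤ K := (norm_nonneg _).trans (hK 0 zero_mem_Icc)
  have hL : ∀ x ∈ Set.Icc 0 (2 * Real.pi), ∀ y ∈ Set.Icc 0 (2 * Real.pi),
      ‖f x - f y‖ ≤ K * |x - y| := fun x hx y hy =>
    (convex_Icc 0 (2 * Real.pi)).norm_image_sub_le_of_norm_derivWithin_le hf hK hy hx
  refine ⟨fun x hx => ?_, hL⟩
  have h1 := hL x hx 0 zero_mem_Icc
  have h2 : |x - 0| ≤ 2 * Real.pi := by rw [sub_zero, abs_of_nonneg hx.1]; exact hx.2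
  have h3 := norm_le_norm_add_norm_sub' (f x) (f 0)
  nlinarith [mul_le_mul_of_nonneg_left h2 hK0]

/-- The functions `g j` are the partial derivatives at `θ`. Their boundedness in `ω` is not a
hypothesis: the Taylor estimate bounds a derivative by two values of `φ`, each bounded in `ω`, and
the second-order term. -/
theorem exists_uniform_linearization {d : ℕ} {Θ : Set (EuclideanSpace ℝ (Fin d))}
    (hΘ : IsOpen Θ) {θ : EuclideanSpace ℝ (Fin d)} (hθ : θ ∈ Θ)
    {φ : ℝ → EuclideanSpace ℝ (Fin d) → ℂ}
    (hφω : ∀ θ' ∈ Θ, ∃ G L : ℝ, BoundedLipschitz (fun ω => φ ω θ') G L)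
    (hφθ : ∀ ω ∈ Set.Icc 0 (2 * Real.pi), ∀ θ' ∈ Θ,
      DifferentiableAt ℝ (φ ω) θ' ∧ DifferentiableAt ℝ (fderiv ℝ (φ ω)) θ')
    (hφθ_bdd : ∃ K : ℝ, ∀ ω ∈ Set.Icc 0 (2 * Real.pi), ∀ θ' ∈ Θ,
      ‖fderiv ℝ (fderiv ℝ (φ ω)) θ'‖ ≤ K) :
    ∃ (g : Fin d → ℝ → ℂ) (G : Fin d → ℝ) (K δ : ℝ), 0 < δ ∧ 0 ≤ K ∧
      (∀ j, ∀ ω ∈ Set.Icc 0 (2 * Real.pi), ‖g j ω‖ ≤ G j) ∧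
      ∀ θ', ‖θ' - θ‖ < δ → ∀ ω ∈ Set.Icc 0 (2 * Real.pi),
        ‖φ ω θ' - φ ω θ - ∑ j, (((θ' - θ) j : ℝ) : ℂ) * g j ω‖ ≤ K * ‖θ' - θ‖ ^ 2 := by
  obtain ⟨K, hK⟩ := hφθ_bdd
  obtain ⟨δ, hδ, hball⟩ := Metric.isOpen_iff.1 hΘ θ hθ
  have hK0 : 0 ≤ K := (norm_nonneg (fderiv ℝ (fderiv ℝ (φ 0)) θ)).trans (hK 0 zero_mem_Icc θ hθ)
  have htaylor : ∀ v, ‖v‖ < δ → ∀ ω ∈ Set.Icc 0 (2 * Real.pi),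
      ‖φ ω (θ + v) - φ ω θ - fderiv ℝ (φ ω) θ v‖ ≤ K * ‖v‖ ^ 2 := fun v hv ω hω =>
    norm_taylor_remainder_le (fun y hy => (hφθ ω hω y (hball hy)).1)
      (fun y hy => (hφθ ω hω y (hball hy)).2) (fun y hy => hK ω hω y (hball hy)) hv
  have hbound : ∀ j : Fin d, ∃ G : ℝ, ∀ ω ∈ Set.Icc 0 (2 * Real.pi),
      ‖fderiv ℝ (φ ω) θ (EuclideanSpace.single j 1)‖ ≤ G := by
    intro j
    -- A step of length `δ/2` along the axis stays inside the ball contained in `Θ`.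
    set v : EuclideanSpace ℝ (Fin d) := (δ / 2) • EuclideanSpace.single j 1 with hv
    have hvn : ‖v‖ = δ / 2 := by
      rw [hv, norm_smul, PiLp.norm_single, Real.norm_of_nonneg (by positivity)]
      simp
    have hvδ : ‖v‖ < δ := by rw [hvn]; linarith
    obtain ⟨G₁, _, h1⟩ := hφω (θ + v) (hball (by simpa using hvδ))
    obtain ⟨G₂, _, h2⟩ := hφω θ hθ
    refine ⟨(K * (δ / 2) ^ 2 + G₁ + G₂) / (δ / 2), fun ω hω => ?_⟩
    have h3 := htaylor v hvδ ω hω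
    rw [hvn] at h3
    rw [le_div_iff₀ (by positivity), mul_comm]
    have h4 : ‖fderiv ℝ (φ ω) θ v‖ = δ / 2 * ‖fderiv ℝ (φ ω) θ (EuclideanSpace.single j 1)‖ := by
      rw [hv, map_smul, norm_smul, Real.norm_of_nonneg (by positivity)]
    rw [← h4]
    have h5 := norm_sub_norm_le (fderiv ℝ (φ ω) θ v) (φ ω (θ + v) - φ ω θ)
    rw [norm_sub_rev (fderiv ℝ (φ ω) θ v)] at h5
    have h6 := norm_sub_le (φ ω (θ + v)) (φ ω θ)
    have h7 := h1.1 ω hω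
    have h8 := h2.1 ω hω
    dsimp only at h7 h8
    linarith
  choose G hG using hbound
  refine ⟨fun j ω => fderiv ℝ (φ ω) θ (EuclideanSpace.single j 1), G, K, δ, hδ, hK0, hG,
    fun θ' hθ' ω hω => ?_⟩
  have h1 := htaylor (θ' - θ) hθ' ω hω
  have h2 : fderiv ℝ (φ ω) θ (θ' - θ) =
      ∑ j, (((θ' - θ) j : ℝ) : ℂ) * fderiv ℝ (φ ω) θ (EuclideanSpace.single j 1) := by
    conv_lhs => rw [← (EuclideanSpace.basisFun (Fin d) ℝ).sum_repr (θ' - θ)]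
    rw [map_sum]
    refine Finset.sum_congr rfl fun j _ => ?_
    rw [map_smul, Complex.real_smul]
    simp
  rwa [add_sub_cancel, h2] at h1

variable {Ω : Type*} [MeasurableSpace Ω] {μ : Measure Ω} [IsProbabilityMeasure μ]

/-- Off a set of small measure, `Y` is dominated by a variable with controlled mean, and Markov's
inequality applies to that variable. Neither `Y` nor `θhat` needs to be measurable. -/
theorem isBigOInProb_of_eventually {Y : ℕ → Ω → ℝ} {a : ℕ → ℝ} (ha : ∀ᶠ T in atTop, 0 < a T)
    (h : ∀ ε : ℝ, 0 < ε → ∃ (S : ℕ → Set Ω) (W : ℕ → Ω → ℝ) (C : ℝ), 0 ≤ C ∧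
      ∀ᶠ T in atTop, μ (S T) ≤ ENNReal.ofReal ε ∧ Integrable (W T) μ ∧ ∫ w, W T w ∂μ ≤ C * a T ∧
        (∀ w, 0 ≤ W T w) ∧ ∀ w ∉ S T, |Y T w| ≤ W T w) : IsBigOInProb μ Y a := by
  intro ε hε
  obtain ⟨S, W, C, hC, hev⟩ := h (ε / 2) (by positivity)
  -- Markov's inequality then bounds the exceedance by `ε/2`; `C + 1` keeps the threshold positive
  -- when `C = 0`.
  refine ⟨(C + 1) * (2 / ε), ?_⟩
  filter_upwards [ha, hev] with T haT ⟨hS, hW, hWC, hW0, hY⟩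
  set b := (C + 1) * (2 / ε) * a T with hb
  have hb0 : 0 < b := by positivity
  have hsub : {w | b < |Y T w|} ⊆ S T ∪ {w | b ≤ W T w} := by
    intro w hw
    by_cases hwS : w ∈ S T
    · exact Or.inl hwS
    · exact Or.inr ((show b < |Y T w| from hw).le.trans (hY w hwS))
  have hmarkov := mul_meas_ge_le_integral_of_nonneg (ae_of_all μ hW0) hW b
  have h1 : μ.real {w | b ≤ W T w} ≤ ε / 2 := by
    have h2 : b * μ.real {w | b ≤ W T w} ≤ b * (ε / 2) := by
      refine hmarkov.trans (hWC.trans ?_)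
      have : b * (ε / 2) = (C + 1) * a T := by rw [hb]; field_simp
      rw [this]
      nlinarith
    exact le_of_mul_le_mul_left h2 hb0
  refine (measure_mono hsub).trans ((measure_union_le _ _).trans ?_)
  have h3 : μ {w | b ≤ W T w} ≤ ENNReal.ofReal (ε / 2) := by
    rw [← ofReal_measureReal]
    exact ENNReal.ofReal_le_ofReal h1
  refine (add_le_add hS h3).trans (le_of_eq ?_)
  rw [← ENNReal.ofReal_add (by positivity) (by positivity), add_halves]

theorem one_div_sqrt_le_rate {T M : ℕ} (hT : 1 ≤ T) (hM : 1 ≤ M) :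
    1 / Real.sqrt T ≤ (M : ℝ) / T + 1 / Real.sqrt M := by
  have hT1 : (1 : ℝ) ≤ T := by exact_mod_cast hT
  have hM0 : (0 : ℝ) < M := by exact_mod_cast hM
  have hT0 : (0 : ℝ) < T := by linarith
  rcases le_total M T with h | h
  · have : 1 / Real.sqrt T ≤ 1 / Real.sqrt M :=
      one_div_le_one_div_of_le (Real.sqrt_pos.2 hM0) (Real.sqrt_le_sqrt (by exact_mod_cast h))
    have h2 : 0 ≤ (M : ℝ) / T := by positivity
    linarith
  · have h1 : 1 / Real.sqrt T ≤ 1 := by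
      rw [div_le_one (Real.sqrt_pos.2 hT0)]; exact Real.one_le_sqrt.2 hT1
    have h2 : (1 : ℝ) ≤ M / T := by rw [one_le_div hT0]; exact_mod_cast h
    have h3 : 0 ≤ 1 / Real.sqrt M := by positivity
    linarith

/-- The error is split at the estimator with the true weight. `exists_mean_error_rate` controls that
estimator; the change caused by `θhat` is at most `Q/√T`, where `Q` is bounded in mean. -/
theorem exists_plugIn_rate {X : ℤ → Ω → ℝ} (hX : CumulantCondition μ X 8)
    (hmean : ∀ t, ∫ w, X t w ∂μ = 0)
    {d : ℕ} {Θ : Set (EuclideanSpace ℝ (Fin d))} (hΘ : IsOpen Θ)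
    {θ : EuclideanSpace ℝ (Fin d)} (hθ : θ ∈ Θ) {θhat : ℕ → Ω → EuclideanSpace ℝ (Fin d)}
    (hθhat : IsBigOInProb μ (fun T w => ‖θhat T w - θ‖) (fun T => 1 / Real.sqrt T))
    {φ : ℝ → EuclideanSpace ℝ (Fin d) → ℂ}
    (hφω : ∀ θ' ∈ Θ, ∃ G L : ℝ, BoundedLipschitz (fun ω => φ ω θ') G L)
    (hφθ : ∀ ω ∈ Set.Icc 0 (2 * Real.pi), ∀ θ' ∈ Θ,
      DifferentiableAt ℝ (φ ω) θ' ∧ DifferentiableAt ℝ (fderiv ℝ (φ ω)) θ')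
    (hφθ_bdd : ∃ K : ℝ, ∀ ω ∈ Set.Icc 0 (2 * Real.pi), ∀ θ' ∈ Θ,
      ‖fderiv ℝ (fderiv ℝ (φ ω)) θ'‖ ≤ K)
    {M : ℕ → ℕ} (hM : ∀ T, 1 ≤ M T) :
    ∃ V : ℝ,
      Tendsto (fun T : ℕ => (T : ℝ) * complexVariance μ
        (weightedPeriodogram X T (fun ω => φ ω θ) 0)) atTop (𝓝 V) ∧
      IsBigOInProb μ (fun T w => varEstimator X T (M T) (fun ω => φ ω (θhat T w)) w - V)
        (fun T => (M T : ℝ) / T + 1 / Real.sqrt (M T)) := by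
  obtain ⟨G, L, hGL⟩ := hφω θ hθ
  have hG := hGL.bound_nonneg
  obtain ⟨V, K₀, hK₀, hV, hmeanErr⟩ := exists_mean_error_rate hX hmean hGL
  obtain ⟨g, Gg, K, δ, hδ, hK, hg, hlin⟩ := exists_uniform_linearization hΘ hθ hφω hφθ hφθ_bdd
  have hGg : ∀ j, 0 ≤ Gg j := fun j => (norm_nonneg _).trans (hg j 0 zero_mem_Icc)
  refine ⟨V, hV, isBigOInProb_of_eventually ?_ fun ε hε => ?_⟩
  · filter_upwards with T
    have : (0 : ℝ) < M T := by exact_mod_cast hM T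
    have : 0 < Real.sqrt (M T) := Real.sqrt_pos.2 this
    positivity
  obtain ⟨B₀, hB₀⟩ := hθhat ε hε
  -- The constant supplied by `IsBigOInProb` may be negative.
  set B := max B₀ 0 with hBdef
  have hB : 0 ≤ B := le_max_right _ _
  set c₁ := 2 * (B ^ 2 * (d + 1)) with hc₁
  set c₂ := K ^ 2 * B ^ 2 with hc₂
  have hc₁0 : 0 ≤ c₁ := by positivity
  have hc₂0 : 0 ≤ c₂ := by positivity
  -- The bracket of `abs_varEstimator_sub_le`. It involves only the deterministic weights `φ_θ`, `g
  -- j` and `1`, so its mean is bounded uniformly in `T` and `M`.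
  set Q : ℕ → Ω → ℝ := fun T w => varEstimator X T (M T) (fun ω => φ ω θ) w +
    c₁ * (∑ j, varEstimator X T (M T) (g j) w +
      c₂ * ‖weightedPeriodogram X T (fun _ => 1) 0 w‖ ^ 2) with hQ
  set C := 6 * pairConst μ X 2 * G ^ 2 + c₁ * (∑ j, 6 * pairConst μ X 2 * Gg j ^ 2 +
    c₂ * (6 * pairConst μ X 2)) with hCdef
  have hC : 0 ≤ C := by
    have h6 : 0 ≤ 6 * pairConst μ X 2 := mul_nonneg (by norm_num) (pairConst_nonneg 2)
    exact add_nonneg (mul_nonneg h6 (sq_nonneg G)) (mul_nonneg hc₁0 (add_nonneg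
      (Finset.sum_nonneg fun j _ => mul_nonneg h6 (sq_nonneg _)) (mul_nonneg hc₂0 h6)))
  have hest : ∀ T ψ, Integrable (varEstimator X T (M T) ψ) μ :=
    fun T ψ => integrable_varEstimator hX T (M T) ψ
  have hi1 : ∀ T, Integrable (fun w => ∑ j, varEstimator X T (M T) (g j) w) μ :=
    fun T => integrable_finsetSum _ fun j _ => hest T (g j)
  have hi2 : ∀ T, Integrable (fun w => c₂ * ‖weightedPeriodogram X T (fun _ => 1) 0 w‖ ^ 2) μ :=
    fun T => (integrable_norm_sq hX T _ 0).const_mul _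
  have hi3 : ∀ T, Integrable (fun w => c₁ * (∑ j, varEstimator X T (M T) (g j) w +
      c₂ * ‖weightedPeriodogram X T (fun _ => 1) 0 w‖ ^ 2)) μ :=
    fun T => ((hi1 T).add (hi2 T)).const_mul _
  have hQi : ∀ T, Integrable (Q T) μ := fun T => (hest T _).add (hi3 T)
  have hQ0 : ∀ T w, 0 ≤ Q T w := fun T w =>
    add_nonneg (varEstimator_nonneg X T _ _ w) (mul_nonneg hc₁0 (add_nonneg
      (Finset.sum_nonneg fun j _ => varEstimator_nonneg X T _ _ w)
      (mul_nonneg hc₂0 (sq_nonneg _))))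
  have hQC : ∀ T, 1 ≤ T → ∫ w, Q T w ∂μ ≤ C := by
    intro T hT
    have hT1 : (1 : ℝ) ≤ T := by exact_mod_cast hT
    have h1 : ∀ (ψ : ℝ → ℂ) (G' : ℝ), 0 ≤ G' → (∀ ω ∈ Set.Icc 0 (2 * Real.pi), ‖ψ ω‖ ≤ G') →
        ∫ w, varEstimator X T (M T) ψ w ∂μ ≤ 6 * pairConst μ X 2 * G' ^ 2 :=
      fun ψ G' hG' h => integral_varEstimator_le hX hmean hT (hM T) ψ
        (fun k hk => h _ (freq_mem (Finset.mem_Icc.1 hk).2)) hG'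
    have h2 := integral_norm_sq_le hX hmean hT (fun _ => 1) (G := 1) (by simp) zero_le_one 0
    have h3 : 2 / (T : ℝ) ≤ 2 := div_le_self (by norm_num) hT1
    have h4 : ∫ w, ‖weightedPeriodogram X T (fun _ => 1) 0 w‖ ^ 2 ∂μ ≤ 6 * pairConst μ X 2 := by
      simp only [dvd_zero, if_true, one_pow, mul_one] at h2
      nlinarith [pairConst_nonneg (μ := μ) (X := X) 2]
    simp only [hQ]
    rw [integral_add (hest T _) (hi3 T), integral_const_mul, integral_add (hi1 T) (hi2 T),
      integral_const_mul, integral_finsetSum _ fun j _ => hest T (g j)]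
    exact add_le_add (h1 _ G hG hGL.1) (mul_le_mul_of_nonneg_left (add_le_add
      (Finset.sum_le_sum fun j _ => h1 _ _ (hGg j) (hg j))
      (mul_le_mul_of_nonneg_left h4 hc₂0)) hc₁0)
  clear_value C
  -- Eventually the estimator lies in the ball where the linearization is valid, outside the
  -- exceptional set.
  have hsmall : ∀ᶠ T : ℕ in atTop, B / Real.sqrt T < δ :=
    (tendsto_const_nhds.div_atTop (Real.tendsto_sqrt_atTop.comp
      tendsto_natCast_atTop_atTop)).eventually (gt_mem_nhds hδ)
  refine ⟨fun T => {w | B₀ * (1 / Real.sqrt T) < |‖θhat T w - θ‖|},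
    fun T w => |varEstimator X T (M T) (fun ω => φ ω θ) w - V| + 1 / Real.sqrt T * Q T w,
    K₀ + C, by positivity, ?_⟩
  filter_upwards [hB₀, hsmall, eventually_ge_atTop 1] with T hTθ hTδ hT
  have hT0 : (0 : ℝ) < T := by exact_mod_cast hT
  have hierr : Integrable (fun w => |varEstimator X T (M T) (fun ω => φ ω θ) w - V|) μ :=
    ((hest T _).sub (integrable_const V)).abs
  refine ⟨hTθ, hierr.add ((hQi T).const_mul _), ?_, fun w => ?_, fun w hw => ?_⟩
  · rw [integral_add hierr ((hQi T).const_mul _), integral_const_mul, add_mul]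
    refine add_le_add (hmeanErr T (M T) hT (hM T)) ?_
    have h1 := mul_le_mul (one_div_sqrt_le_rate hT (hM T)) (hQC T hT)
      (integral_nonneg (hQ0 T)) (by positivity)
    rwa [mul_comm C]
  · exact add_nonneg (abs_nonneg _) (mul_nonneg (by positivity) (hQ0 T w))
  · have hs : 0 < Real.sqrt T := Real.sqrt_pos.2 hT0
    have hnorm : ‖θhat T w - θ‖ ≤ B / Real.sqrt T := by
      have h1 : ‖θhat T w - θ‖ ≤ B₀ * (1 / Real.sqrt T) := by simpa using hw
      refine h1.trans ?_
      rw [mul_one_div]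
      exact div_le_div_of_nonneg_right (le_max_left _ _) hs.le
    have h2 := abs_varEstimator_sub_le X hT (hM T) (f := fun ω => φ ω θ)
      (f' := fun ω => φ ω (θhat T w)) g (fun j => (((θhat T w - θ) j : ℝ) : ℂ)) (K := K)
      (fun j => by
        rw [Complex.norm_real]
        exact (PiLp.norm_apply_le (θhat T w - θ) j).trans hnorm)
      (fun k hk => (hlin _ (hnorm.trans_lt hTδ) _ (freq_mem (Finset.mem_Icc.1 hk).2)).trans
        (mul_le_mul_of_nonneg_left (pow_le_pow_left₀ (norm_nonneg _) hnorm 2) hK)) w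
    have h3 := abs_sub_le (varEstimator X T (M T) (fun ω => φ ω (θhat T w)) w)
      (varEstimator X T (M T) (fun ω => φ ω θ) w) V
    simp only [hQ]
    linarith

end PlugIn

end OrthSample

end

theorem mainTheorem5
    {Ω : Type*} [MeasurableSpace Ω] (μ : Measure Ω) [IsProbabilityMeasure μ]
    -- a zero-mean time series with the cumulant condition of order eight
    (X : ℤ → Ω → ℝ)
    (hX : OrthSample.CumulantCondition μ X 8)
    (hmean : ∀ t, ∫ w, X t w ∂μ = 0)
    -- the parameter set, the true parameter and its estimator
    {d : ℕ} (Θ : Set (EuclideanSpace ℝ (Fin d))) (hΘ : IsOpen Θ)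
    (θ : EuclideanSpace ℝ (Fin d)) (hθ : θ ∈ Θ)
    (θhat : ℕ → Ω → EuclideanSpace ℝ (Fin d))
    (hθhat : OrthSample.IsBigOInProb μ (fun T w => ‖θhat T w - θ‖)
      (fun T => 1 / Real.sqrt T))
    -- the weight function, with uniformly bounded derivative in the frequency and uniformly
    -- bounded second derivative in the parameter
    (φ : ℝ → EuclideanSpace ℝ (Fin d) → ℂ)
    (hφω : ∀ θ' ∈ Θ, DifferentiableOn ℝ (fun ω => φ ω θ') (Set.Icc 0 (2 * Real.pi)))
    (hφω_bdd : ∃ K : ℝ, ∀ θ' ∈ Θ, ∀ ω ∈ Set.Icc 0 (2 * Real.pi),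
      ‖derivWithin (fun ω => φ ω θ') (Set.Icc 0 (2 * Real.pi)) ω‖ ≤ K)
    (hφθ : ∀ ω ∈ Set.Icc 0 (2 * Real.pi), ∀ θ' ∈ Θ,
      DifferentiableAt ℝ (φ ω) θ' ∧ DifferentiableAt ℝ (fderiv ℝ (φ ω)) θ')
    (hφθ_bdd : ∃ K : ℝ, ∀ ω ∈ Set.Icc 0 (2 * Real.pi), ∀ θ' ∈ Θ,
      ‖fderiv ℝ (fderiv ℝ (φ ω)) θ'‖ ≤ K)
    -- the number of terms of the orthogonal sample
    (M : ℕ → ℕ) (hM : ∀ T, 1 ≤ M T) :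
    ∃ V : ℝ,
      Tendsto (fun T : ℕ => (T : ℝ) * OrthSample.complexVariance μ
        (OrthSample.weightedPeriodogram X T (fun ω => φ ω θ) 0)) atTop (𝓝 V) ∧
      OrthSample.IsBigOInProb μ
        (fun T w => OrthSample.varEstimator X T (M T) (fun ω => φ ω (θhat T w)) w - V)
        (fun T => (M T : ℝ) / T + 1 / Real.sqrt (M T)) := by
  obtain ⟨K, hK⟩ := hφω_bdd
  exact OrthSample.exists_plugIn_rate hX hmean hΘ hθ hθhat (fun θ' hθ' =>
    ⟨_, K, OrthSample.boundedLipschitz_of_derivWithin (hφω θ' hθ') (hK θ' hθ')⟩) hφθ hφθ_bdd hM
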